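/- Let $d\in\{2,3\}$ and let $R,h,\rho,\beta>0$. Write points and velocities of $\mathbb R^d$ as $\mathbf x=(x,\mathbf x_\perp)$, $\mathbf v=(v_x,\mathbf v_\perp)$. A body of unit mass moves along the $x$-axis with velocity $V(t)$ and position $X(t)=\int_0^tV$; at time $t$ it occupies $C(t)=D(t)\cup S(t)$, where $D(t)=\{x=X(t),\,|\mathbf x_\perp|\le R\}$ is the base and $S(t)=\{0\le x-X(t)\le h,\ |\mathbf x_\perp|=R\}$ the lateral barrier. It is subject to a constant force $E$ and to a gas with phase-space density $f(\mathbf x,\mathbf v,t)$. A solution with initial velocity $V_0$ is a pair $(V,f)$ such that, for $t\ge 0$: * $(\partial_t+\mathbf v\cdot\nabla_{\mathbf x})f=0$ for $\mathbf x\notin C(t)$ (that is, $f$ is constant along free flights), and $f(\mathbf x,\mathbf v,0)=f_0(\mathbf v)=\rho(\beta/\pi)^{d/2}e^{-\beta|\mathbf v|^2}$; * with $f_\pm(\mathbf x,\mathbf v,t)=\lim_{\varepsilon\to0^+}f(\mathbf x\pm\varepsilon\mathbf v,\mathbf v,t\pm\varepsilon)$, one has $f_+(\mathbf x,\mathbf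 v',t)=f_-(\mathbf x,\mathbf v,t)$ on $D(t)$, with $\mathbf v'=(2V(t)-v_x,\mathbf v_\perp)$, and $f_+(\mathbf x,\tilde{\mathbf v},t)=f_-(\mathbf x,\mathbf v,t)$ on $S(t)$, with $\tilde{\mathbf v}=(v_x,\ \mathbf v_\perp-2(\mathbf v_\perp\cdot\hat{\mathbf x}_\perp)\hat{\mathbf x}_\perp)$, $\hat{\mathbf x}_\perp=\mathbf x_\perp/|\mathbf x_\perp|$; these conditions are imposed at transversal impacts away from the edge $D(t)\cap S(t)$ and for particles whose backward evolution down to time $0$ consists of free flights and finitely many such impacts; on the remaining, negligible, set of particles $f$ is normalized to $f_0$; * $V$ is locally absolutely continuous, $V(0)=V_0$, and $\dot V(t)=E-F(t)$ for almost every $t$, where $$F(t)=2\int_{|\mathbf x_\perp|\le R}d\mathbf x_\perp\Big[\int_{v_x<V(t)}-\int_{v_x>V(t)}\Big](v_x-V(t))^2f_-(X(t),\mathbf x_\perp,\mathbf v,t)\,d\mathbf v ,$$ the integrals being absolutely convergent for almost every $t$ and $F$ locally integrable. Let $$F_0(V)=2\rho\Big(\frac\beta\pi\Big)^{d/2}\,|\{\mathbf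 x_\perp\in\mathbb R^{d-1}:|\mathbf x_\perp|\le R\}|\int_{\mathbb R^{d-1}}e^{-\beta|\mathbf v_\perp|^2}d\mathbf v_\perp\Big[\int_{u<V}-\int_{u\ge V}\Big](u-V)^2e^{-\beta u^2}\,du$$ be the friction without recollisions, let $V_\infty>0$ be such that $F_0(V_\infty)=E$, and put $C_-=F_0'(V_\infty)$. **Theorem.** There are $\gamma_0>0$ and $A_->0$, depending only on $d,\beta,\rho,E,R,h,V_\infty$, such that for every $\gamma\in(0,\gamma_0)$ there is $\bar t>0$ (depending on $\gamma$) for which every solution $(V,f)$ with $V(0)=V_0=V_\infty-\gamma$ satisfies $$V_\infty-V(t)\ \ge\ \gamma e^{-C_-t}+\frac{A_-\gamma^4}{t^3}\,\chi\{t>\bar t\}\qquad\text{for all }t\ge0 .$$ -/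

import Mathlib

noncomputable section

namespace HollowCylinder

open MeasureTheory Set Filter Topology

/-- The directions orthogonal to the `x`-axis, in space dimension `d`. -/
abbrev Transverse (d : ℕ) : Type := EuclideanSpace ℝ (Fin (d - 1))

/-- Positions `(x, x_⊥)` and velocities `(v_x, v_⊥)` in space dimension `d`. -/
abbrev Vect (d : ℕ) : Type := ℝ × Transverse d

/-- The data of the model: radius `R` of the base, length `h` of the lateral barrier, density
`ρ` and inverse temperature `β` of the gas, external force `E`. The body has mass `1`. -/
structure Model (d : ℕ) where
  R : ℝ
  h : ℝ
  ρ : ℝ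
  β : ℝ
  E : ℝ

variable {d : ℕ}

/-- The Maxwell–Boltzmann density of the unperturbed gas. -/
def Model.f₀ (M : Model d) (v : Vect d) : ℝ :=
  M.ρ * (M.β / Real.pi) ^ ((d : ℝ) / 2) * Real.exp (-M.β * (v.1 ^ 2 + ‖v.2‖ ^ 2))

/-- The constant `A` in front of the friction in absence of recollisions: it contains the area of
the base and the integral over the transverse velocity. -/
def Model.A (M : Model d) : ℝ :=
  2 * M.ρ * (M.β / Real.pi) ^ ((d : ℝ) / 2) *
    volume.real (Metric.closedBall (0 : Transverse d) M.R) *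
      ∫ w : Transverse d, Real.exp (-M.β * ‖w‖ ^ 2)

/-- The friction `F₀(V)` in absence of recollisions. -/
def Model.F₀ (M : Model d) (V : ℝ) : ℝ :=
  M.A * ((∫ u in Iio V, (u - V) ^ 2 * Real.exp (-M.β * u ^ 2)) -
    ∫ u in Ici V, (u - V) ^ 2 * Real.exp (-M.β * u ^ 2))

/-- The position of the base at time `t`, for a body that moves with velocity `V` from `0`. -/
def position (V : ℝ → ℝ) (t : ℝ) : ℝ := ∫ τ in (0 : ℝ)..t, V τ

/-- The base of the body at time `t`. -/
def Model.base (M : Model d) (V : ℝ → ℝ) (t : ℝ) : Set (Vect d) :=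
  {x | x.1 = position V t ∧ ‖x.2‖ ≤ M.R}

/-- The lateral barrier at time `t`. -/
def Model.side (M : Model d) (V : ℝ → ℝ) (t : ℝ) : Set (Vect d) :=
  {x | 0 ≤ x.1 - position V t ∧ x.1 - position V t ≤ M.h ∧ ‖x.2‖ = M.R}

/-- The body at time `t`. -/
def Model.body (M : Model d) (V : ℝ → ℝ) (t : ℝ) : Set (Vect d) :=
  M.base V t ∪ M.side V t

/-- Elastic reflection on the base, when the body has velocity `W`. -/
def reflectBase (W : ℝ) (v : Vect d) : Vect d := (2 * W - v.1, v.2)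

/-- Elastic reflection on the barrier at a point with transverse position `y`: the transverse
velocity changes by `- 2 |v_⊥| cos θ ŷ`, where `θ` is the angle between `v_⊥` and `y`. -/
def reflectSide (y : Transverse d) (v : Vect d) : Vect d :=
  (v.1, v.2 - (2 * inner ℝ v.2 y / ‖y‖ ^ 2) • y)

/-- A particle with velocity `v` at the point `x` can hit the base (away from its edge) at
time `t`: it is not at rest relative to the base. -/
def Model.HitsBase (M : Model d) (V : ℝ → ℝ) (t : ℝ) (x v : Vect d) : Prop :=
  x ∈ M.base V t ∧ ‖x.2‖ < M.R ∧ v.1 ≠ V t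

/-- A particle with velocity `v` at the point `x` can hit the barrier (away from the edge of the
base) at time `t`: it does not move tangentially. -/
def Model.HitsSide (M : Model d) (V : ℝ → ℝ) (t : ℝ) (x v : Vect d) : Prop :=
  x ∈ M.side V t ∧ 0 < x.1 - position V t ∧ inner ℝ v.2 x.2 ≠ 0

/-- `M.History V t x v v₀`: a particle which arrives at time `t` at the point `x` with velocity `v`
(the velocity before the impact, if `x` is on the body) comes, through free flights and finitely
many elastic collisions during `(0, t)`, from a particle with velocity `v₀` at time `0`. -/
inductive Model.History (M : Model d) (V : ℝ → ℝ) : ℝ → Vect d → Vect d → Vect d → Prop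
  | free (t : ℝ) (x v : Vect d) (ht : 0 ≤ t)
      (hfree : ∀ τ ∈ Ioo 0 t, x - (t - τ) • v ∉ M.body V τ) : M.History V t x v v
  | base (t s : ℝ) (x v v₀ : Vect d) (hs : 0 < s) (hst : s < t)
      (hfree : ∀ τ ∈ Ioo s t, x - (t - τ) • v ∉ M.body V τ)
      (hhit : M.HitsBase V s (x - (t - s) • v) v)
      (hprev : M.History V s (x - (t - s) • v) (reflectBase (V s) v) v₀) : M.History V t x v v₀
  | side (t s : ℝ) (x v v₀ : Vect d) (hs : 0 < s) (hst : s < t)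
      (hfree : ∀ τ ∈ Ioo s t, x - (t - τ) • v ∉ M.body V τ)
      (hhit : M.HitsSide V s (x - (t - s) • v) v)
      (hprev : M.History V s (x - (t - s) • v) (reflectSide (x - (t - s) • v).2 v) v₀) :
      M.History V t x v v₀

/-- The backward evolution of the particle is defined up to time `0`. It fails to be so only on a
negligible set of particles: those that somewhere in the past hit the edge of the base, were
tangent to the body, or collided infinitely often. -/
def Model.Regular (M : Model d) (V : ℝ → ℝ) (t : ℝ) (x v : Vect d) : Prop :=
  ∃ v₀, M.History V t x v v₀

/-- The trace `f₋(x, v, t)`, the limit of `f(x - εv, v, t - ε)` as `ε → 0⁺`. -/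
def traceBefore (f : ℝ → Vect d → Vect d → ℝ) (t : ℝ) (x v : Vect d) : ℝ :=
  limUnder (𝓝[>] (0 : ℝ)) fun ε => f (t - ε) (x - ε • v) v

/-- The trace `f₊(x, v, t)`, the limit of `f(x + εv, v, t + ε)` as `ε → 0⁺`. -/
def traceAfter (f : ℝ → Vect d → Vect d → ℝ) (t : ℝ) (x v : Vect d) : ℝ :=
  limUnder (𝓝[>] (0 : ℝ)) fun ε => f (t + ε) (x + ε • v) v

/-- `f t x v` is the density of the gas in the presence of a body moving with velocity `V`.
As `f` jumps across the trajectories that touch the edges of the body, the free Vlasov equation is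
read along characteristics: `f` is constant along every free flight. Near a transversal impact `f` is
therefore constant along the incoming and the outgoing flight, and the two traces in the boundary
conditions are genuine limits. On the negligible set of particles without a backward evolution
the density, which is defined up to null sets only, is normalized to its equilibrium value. -/
structure Model.IsGasDensity (M : Model d) (V : ℝ → ℝ) (f : ℝ → Vect d → Vect d → ℝ) :
    Prop where
  initial : ∀ x v, f 0 x v = M.f₀ v
  vlasov : ∀ s t x v, 0 ≤ s → s ≤ t → (∀ τ ∈ Icc s t, x - (t - τ) • v ∉ M.body V τ) →
    f t x v = f s (x - (t - s) • v) v
  boundary_base : ∀ t x v, 0 < t → M.HitsBase V t x v → M.Regular V t x v →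
    traceAfter f t x (reflectBase (V t) v) = traceBefore f t x v
  boundary_side : ∀ t x v, 0 < t → M.HitsSide V t x v → M.Regular V t x v →
    traceAfter f t x (reflectSide x.2 v) = traceBefore f t x v
  normalized : ∀ t x v, 0 ≤ t → x ∉ M.body V t → ¬ M.Regular V t x v → f t x v = M.f₀ v

/-- Pairs `(x_⊥, v)` of particles that hit the base from the front, when its velocity is `W`. -/
def Model.front (M : Model d) (W : ℝ) : Set (Transverse d × Vect d) :=
  {p | ‖p.1‖ ≤ M.R ∧ p.2.1 < W}

/-- Pairs `(x_⊥, v)` of particles that hit the base from behind, when its velocity is `W`. -/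
def Model.back (M : Model d) (W : ℝ) : Set (Transverse d × Vect d) :=
  {p | ‖p.1‖ ≤ M.R ∧ W < p.2.1}

/-- The integrand `(v_x - V(t))² f₋(X(t), x_⊥, v, t)` of the force. -/
def pressure (V : ℝ → ℝ) (f : ℝ → Vect d → Vect d → ℝ) (t : ℝ) (p : Transverse d × Vect d) : ℝ :=
  (p.2.1 - V t) ^ 2 * traceBefore f t (position V t, p.1) p.2

/-- The action `F(t)` of the gas on the base. -/
def Model.force (M : Model d) (V : ℝ → ℝ) (f : ℝ → Vect d → Vect d → ℝ) (t : ℝ) : ℝ :=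
  2 * (∫ p in M.front (V t), pressure V f t p) - 2 * ∫ p in M.back (V t), pressure V f t p

/-- `(V, f)` solves the coupled problem of the gas and the body for `t ≥ 0`, with `V(0) = V₀`.
The equation of motion `dV/dt = E - F(t)` is understood for almost every `t`, with `V` locally
absolutely continuous, i.e. in integrated form. -/
structure Model.IsSolution (M : Model d) (V₀ : ℝ) (V : ℝ → ℝ)
    (f : ℝ → Vect d → Vect d → ℝ) : Prop where
  gas : M.IsGasDensity V f
  integrable : ∀ᵐ t ∂(volume.restrict (Ioi (0 : ℝ))),
    IntegrableOn (pressure V f t) (M.front (V t)) ∧ IntegrableOn (pressure V f t) (M.back (V t))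
  force_integrable : ∀ t, 0 ≤ t → IntervalIntegrable (M.force V f) volume 0 t
  motion : ∀ t, 0 ≤ t → V t = V₀ + ∫ τ in (0 : ℝ)..t, (M.E - M.force V f τ)

end HollowCylinder

end

/-!
The friction `F₀` is increasing, and a bootstrap shows that the deviation `Vinf - V t` stays below a
profile `γ L² / (L + t)²`. By energy comparison along the collisions, a particle that reaches the
base from the front was not faster, in absolute value along the axis, at time `0`, and one that
reaches it from behind was not slower. Hence recollisions only increase the friction, `F ≥ F₀(V)`,
and as `F₀` is convex on the positive axis, `Vinf - V t ≥ γ e^{-Ct}` with `C = F₀'(Vinf)`.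

The algebraic tail comes from the particles that hit the base during an initial layer `[0, s₀]` and
then fly ahead of it, inside the hollow, until it catches up with them at a late time `t`. Their
velocities fill an interval of length of order `γ / t` at a distance of order `γ / t` from `V t`.
The first impact changed `v_x` by an amount of order `γ`, hence also their density. As the force
weighs the density with the square of the relative velocity, `F - F₀(V)` is at least of order
`(γ / t)³ γ = γ⁴ / t³`, and comparison with a barrier transfers this to the deviation.
-/

noncomputable section

namespace HollowCylinder

open MeasureTheory Set Filter Topology

variable {d : ℕ}

/-! ### The friction without recollisions -/

theorem hasDerivAt_mul_abs (z : ℝ) : HasDerivAt (fun y : ℝ => y * |y|) (2 * |z|) z := by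
  rcases eq_or_ne z 0 with rfl | hz
  · rw [hasDerivAt_iff_tendsto_slope]
    simp only [slope_fun_def, sub_zero, abs_zero, mul_zero, smul_eq_mul]
    refine (by simpa using (continuous_abs (G := ℝ)).tendsto 0 :
      Tendsto (fun y : ℝ => |y|) (𝓝 0) (𝓝 0)).mono_left nhdsWithin_le_nhds |>.congr' ?_
    filter_upwards [self_mem_nhdsWithin] with y hy
    rw [vsub_eq_sub, sub_zero, inv_mul_cancel_left₀ hy]
  · refine ((hasDerivAt_id z).mul (hasDerivAt_abs hz)).congr_deriv ?_
    rw [id_eq, one_mul, ← sign_mul_self z, mul_comm z, two_mul]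

theorem abs_sub_add_abs_add (a b : ℝ) : |a - b| + |a + b| = 2 * max |a| |b| := by
  rw [max_def]
  split_ifs with h <;> [skip; rw [not_le] at h] <;>
  rcases abs_cases a with ⟨ha, _⟩ | ⟨ha, _⟩ <;> rcases abs_cases b with ⟨hb, _⟩ | ⟨hb, _⟩ <;>
  rcases abs_cases (a - b) with ⟨hs, _⟩ | ⟨hs, _⟩ <;>
  rcases abs_cases (a + b) with ⟨hs', _⟩ | ⟨hs', _⟩ <;> linarith

section Gaussian

variable {β : ℝ}

theorem integrable_abs_pow_mul_gaussian (hβ : 0 < β) (n : ℕ) :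
    Integrable fun u : ℝ => |u| ^ n * Real.exp (-β * u ^ 2) := by
  have h := integrable_rpow_mul_exp_neg_mul_sq hβ (s := n) (by linarith [n.cast_nonneg (α := ℝ)])
  simpa [abs_mul, abs_pow] using h.abs

theorem integrable_mul_gaussian_of_abs_le (hβ : 0 < β) {g : ℝ → ℝ} (hg : Continuous g) (C : ℝ)
    (hC : ∀ u, |g u| ≤ C * (1 + u ^ 2)) :
    Integrable fun u : ℝ => g u * Real.exp (-β * u ^ 2) := by
  have h := ((integrable_abs_pow_mul_gaussian hβ 0).add
    (integrable_abs_pow_mul_gaussian hβ 2)).const_mul C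
  refine h.mono' (by fun_prop) (ae_of_all _ fun u => ?_)
  rw [norm_mul, Real.norm_eq_abs, Real.norm_eq_abs, Real.abs_exp]
  refine (mul_le_mul_of_nonneg_right (hC u) (Real.exp_pos _).le).trans_eq ?_
  rw [Pi.add_apply, sq_abs]
  ring

theorem integrable_sub_sq_mul_gaussian (hβ : 0 < β) (V : ℝ) :
    Integrable fun u : ℝ => (u - V) ^ 2 * Real.exp (-β * u ^ 2) := by
  refine integrable_mul_gaussian_of_abs_le hβ (by fun_prop) (2 * (1 + V ^ 2)) fun u => ?_
  rw [abs_of_nonneg (sq_nonneg _)]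
  nlinarith [sq_nonneg (u + V), sq_nonneg (u * V)]

theorem integrable_mul_abs_sub_mul_gaussian (hβ : 0 < β) (V : ℝ) :
    Integrable fun u : ℝ => (V - u) * |V - u| * Real.exp (-β * u ^ 2) := by
  refine (integrable_sub_sq_mul_gaussian hβ V).mono' (by fun_prop) (ae_of_all _ fun u => ?_)
  rw [norm_mul, Real.norm_eq_abs, Real.norm_eq_abs, Real.abs_exp, abs_mul, abs_abs,
    abs_mul_abs_self, ← sq, sub_sq_comm]

theorem integrable_max_abs_mul_gaussian (hβ : 0 < β) (V : ℝ) :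
    Integrable fun u : ℝ => 2 * max |V| |u| * Real.exp (-β * u ^ 2) := by
  refine integrable_mul_gaussian_of_abs_le hβ (by fun_prop) (2 * (1 + |V|)) fun u => ?_
  rw [abs_of_nonneg (by positivity), mul_assoc, ← sq_abs u]
  refine mul_le_mul_of_nonneg_left (max_le ?_ ?_) zero_le_two
  · nlinarith [abs_nonneg V, sq_nonneg |u|]
  · nlinarith [sq_nonneg (|u| - 1), mul_nonneg (abs_nonneg V) (sq_nonneg |u|), abs_nonneg V]

theorem integrable_abs_sub_mul_gaussian (hβ : 0 < β) (V : ℝ) :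
    Integrable fun u : ℝ => 2 * |V - u| * Real.exp (-β * u ^ 2) := by
  refine ((integrable_max_abs_mul_gaussian hβ V).const_mul 2).mono' (by fun_prop)
    (ae_of_all _ fun u => ?_)
  rw [Real.norm_of_nonneg (by positivity), ← mul_assoc]
  gcongr
  linarith [abs_sub_add_abs_add V u, abs_nonneg (V + u)]

theorem integral_abs_sub_mul_gaussian (hβ : 0 < β) (V : ℝ) :
    ∫ u : ℝ, 2 * |V - u| * Real.exp (-β * u ^ 2) =
      ∫ u : ℝ, 2 * max |V| |u| * Real.exp (-β * u ^ 2) := by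
  have hreflect : ∫ u : ℝ, 2 * |V + u| * Real.exp (-β * u ^ 2) =
      ∫ u : ℝ, 2 * |V - u| * Real.exp (-β * u ^ 2) := by
    rw [← integral_neg_eq_self (fun u : ℝ => 2 * |V - u| * Real.exp (-β * u ^ 2))]
    simp
  have hint : Integrable fun u : ℝ => 2 * |V + u| * Real.exp (-β * u ^ 2) := by
    simpa using (integrable_abs_sub_mul_gaussian hβ V).comp_neg
  calc ∫ u : ℝ, 2 * |V - u| * Real.exp (-β * u ^ 2)
      = 2⁻¹ * ((∫ u : ℝ, 2 * |V - u| * Real.exp (-β * u ^ 2)) +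
        ∫ u : ℝ, 2 * |V + u| * Real.exp (-β * u ^ 2)) := by rw [hreflect]; ring
    _ = ∫ u : ℝ, 2 * max |V| |u| * Real.exp (-β * u ^ 2) := by
      rw [← integral_add (integrable_abs_sub_mul_gaussian hβ V) hint, ← integral_const_mul]
      congr 1 with u
      linear_combination Real.exp (-β * u ^ 2) * abs_sub_add_abs_add V u

theorem integrable_gaussian_norm (hβ : 0 < β) :
    Integrable fun w : Transverse d => Real.exp (-β * ‖w‖ ^ 2) := by
  refine Integrable.of_integral_ne_zero ?_
  rw [GaussianFourier.integral_rexp_neg_mul_sq_norm hβ]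
  positivity

end Gaussian

section Friction

variable {M : Model d}

theorem Model.A_nonneg (hρ : 0 ≤ M.ρ) (hβ : 0 ≤ M.β) : 0 ≤ M.A := by
  unfold Model.A
  positivity

theorem Model.A_pos (hR : 0 < M.R) (hρ : 0 < M.ρ) (hβ : 0 < M.β) : 0 < M.A := by
  have hball : 0 < volume.real (Metric.closedBall (0 : Transverse d) M.R) :=
    ENNReal.toReal_pos (Metric.measure_closedBall_pos _ _ hR).ne' measure_closedBall_lt_top.ne
  have hgauss : 0 < ∫ w : Transverse d, Real.exp (-M.β * ‖w‖ ^ 2) := by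
    rw [GaussianFourier.integral_rexp_neg_mul_sq_norm hβ]
    positivity
  unfold Model.A
  positivity

theorem Model.F₀_eq (hβ : 0 < M.β) (V : ℝ) :
    M.F₀ V = M.A * ∫ u, (V - u) * |V - u| * Real.exp (-M.β * u ^ 2) := by
  have hfront : ∫ u in Iio V, (u - V) ^ 2 * Real.exp (-M.β * u ^ 2) =
      ∫ u in Iio V, (V - u) * |V - u| * Real.exp (-M.β * u ^ 2) := by
    refine setIntegral_congr_fun measurableSet_Iio fun u (hu : u < V) => ?_
    simp only [abs_of_pos (sub_pos.2 hu)]; ring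
  have hback : ∫ u in Ici V, (u - V) ^ 2 * Real.exp (-M.β * u ^ 2) =
      -∫ u in Ici V, (V - u) * |V - u| * Real.exp (-M.β * u ^ 2) := by
    rw [← integral_neg]
    refine setIntegral_congr_fun measurableSet_Ici fun u (hu : V ≤ u) => ?_
    simp only [abs_of_nonpos (sub_nonpos.2 hu)]; ring
  rw [Model.F₀, hfront, hback, sub_neg_eq_add, ← compl_Iio,
    integral_add_compl measurableSet_Iio (integrable_mul_abs_sub_mul_gaussian hβ V)]

theorem Model.hasDerivAt_F₀ (hβ : 0 < M.β) (V : ℝ) :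
    HasDerivAt M.F₀ (M.A * ∫ u, 2 * |V - u| * Real.exp (-M.β * u ^ 2)) V := by
  have hderiv := hasDerivAt_integral_of_dominated_loc_of_deriv_le (μ := volume)
    (F := fun V u => (V - u) * |V - u| * Real.exp (-M.β * u ^ 2))
    (F' := fun V u => 2 * |V - u| * Real.exp (-M.β * u ^ 2)) (x₀ := V)
    (s := Ioo (V - 1) (V + 1)) (bound := fun u => 2 * (|V - u| + 1) * Real.exp (-M.β * u ^ 2))
    (Ioo_mem_nhds (by linarith) (by linarith))
    (Eventually.of_forall fun x =>
      (integrable_mul_abs_sub_mul_gaussian hβ x).aestronglyMeasurable)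
    (integrable_mul_abs_sub_mul_gaussian hβ V)
    (integrable_abs_sub_mul_gaussian hβ V).aestronglyMeasurable
    (ae_of_all _ fun u x hx => ?_) ?_ (ae_of_all _ fun u x _ => ?_)
  · exact (hderiv.2.const_mul M.A).congr_of_eventuallyEq (Eventually.of_forall (M.F₀_eq hβ))
  · rw [norm_mul, Real.norm_eq_abs, Real.norm_eq_abs, Real.abs_exp, abs_of_nonneg (by positivity)]
    gcongr
    have hxV : |x - V| ≤ 1 := abs_le.2 ⟨by linarith [hx.1], by linarith [hx.2]⟩
    linarith [abs_sub_le x V u]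
  · refine ((integrable_abs_sub_mul_gaussian hβ V).add
      ((integrable_abs_pow_mul_gaussian hβ 0).const_mul 2)).congr (ae_of_all _ fun u => ?_)
    rw [Pi.add_apply, pow_zero]
    ring
  · exact ((hasDerivAt_mul_abs (x - u)).comp_sub_const x u).mul_const _

theorem Model.deriv_F₀_mono (hA : 0 ≤ M.A) (hβ : 0 < M.β) {V V' : ℝ} (h : |V| ≤ |V'|) :
    deriv M.F₀ V ≤ deriv M.F₀ V' := by
  rw [(M.hasDerivAt_F₀ hβ V).deriv, (M.hasDerivAt_F₀ hβ V').deriv,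
    integral_abs_sub_mul_gaussian hβ, integral_abs_sub_mul_gaussian hβ]
  refine mul_le_mul_of_nonneg_left ?_ hA
  refine integral_mono (integrable_max_abs_mul_gaussian hβ V)
    (integrable_max_abs_mul_gaussian hβ V') fun u => ?_
  dsimp only
  gcongr

theorem Model.deriv_F₀_pos (hA : 0 < M.A) (hβ : 0 < M.β) (V : ℝ) : 0 < deriv M.F₀ V := by
  rw [(M.hasDerivAt_F₀ hβ V).deriv]
  refine mul_pos hA ((integral_pos_iff_support_of_nonneg (fun u => by positivity)
    (integrable_abs_sub_mul_gaussian hβ V)).2 ?_)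
  have hsupport : Function.support (fun u : ℝ => 2 * |V - u| * Real.exp (-M.β * u ^ 2)) = {V}ᶜ := by
    ext u
    simp [sub_eq_zero, eq_comm (a := V), (Real.exp_pos _).ne']
  rw [hsupport, measure_compl (measurableSet_singleton _) (by simp)]
  simp

theorem Model.F₀_sub_le (hA : 0 ≤ M.A) (hβ : 0 < M.β) {V V' : ℝ} (hV : 0 ≤ V) (h : V ≤ V') :
    M.F₀ V' - M.F₀ V ≤ deriv M.F₀ V' * (V' - V) := by
  have hdiff : Differentiable ℝ M.F₀ := fun x => (M.hasDerivAt_F₀ hβ x).differentiableAt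
  refine (convex_Icc V V').image_sub_le_mul_sub_of_deriv_le hdiff.continuous.continuousOn
    hdiff.differentiableOn (fun x hx => M.deriv_F₀_mono hA hβ ?_) V ⟨le_rfl, h⟩ V' ⟨h, le_rfl⟩ h
  rw [interior_Icc] at hx
  rw [abs_of_nonneg (hV.trans hx.1.le), abs_of_nonneg (hV.trans h)]
  exact hx.2.le

theorem Model.mul_sub_le_F₀_sub (hA : 0 ≤ M.A) (hβ : 0 < M.β) {V V' : ℝ} (h : V ≤ V') :
    deriv M.F₀ 0 * (V' - V) ≤ M.F₀ V' - M.F₀ V :=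
  mul_sub_le_image_sub_of_le_deriv (fun x => (M.hasDerivAt_F₀ hβ x).differentiableAt)
    (fun x => M.deriv_F₀_mono hA hβ (by simp)) h

end Friction

/-! ### The position of the base -/

section Position

variable {V : ℝ → ℝ} (hV : ContinuousOn V (Ici 0))
include hV

theorem intervalIntegrable_of_continuousOn_Ici {a b : ℝ} (ha : 0 ≤ a) (hb : 0 ≤ b) :
    IntervalIntegrable V volume a b :=
  (hV.mono fun _ hx => (le_min ha hb).trans hx.1).intervalIntegrable

theorem position_sub {a b : ℝ} (ha : 0 ≤ a) (hb : 0 ≤ b) :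
    position V b - position V a = ∫ τ in a..b, V τ :=
  intervalIntegral.integral_interval_sub_left (intervalIntegrable_of_continuousOn_Ici hV le_rfl hb)
    (intervalIntegrable_of_continuousOn_Ici hV le_rfl ha)

omit hV in
theorem position_zero (V : ℝ → ℝ) : position V 0 = 0 := intervalIntegral.integral_same

theorem hasStrictDerivAt_position {t : ℝ} (ht : 0 < t) :
    HasStrictDerivAt (position V) (V t) t :=
  intervalIntegral.integral_hasStrictDerivAt_right
    (intervalIntegrable_of_continuousOn_Ici hV le_rfl ht.le)
    ((hV.mono Ioi_subset_Ici_self).stronglyMeasurableAtFilter isOpen_Ioi t ht)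
    (hV.continuousAt (Ici_mem_nhds ht))

theorem continuous_comp_max : Continuous fun t => V (max t 0) :=
  hV.comp_continuous (by fun_prop) fun t => le_max_right t 0

theorem continuous_position_max : Continuous fun t => position V (max t 0) := by
  have h_eq : (fun t => position V (max t 0)) =
      fun t => ∫ τ in (0 : ℝ)..(max t 0), V (max τ 0) := by
    ext t
    refine intervalIntegral.integral_congr fun τ hτ => ?_
    rw [uIcc_of_le (le_max_right t 0)] at hτ
    simp [max_eq_left hτ.1]
  rw [h_eq]
  exact (intervalIntegral.continuous_primitive
    (fun a b => (continuous_comp_max hV).intervalIntegrable a b) 0).comp (by fun_prop)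

theorem continuousOn_position : ContinuousOn (position V) (Ici 0) :=
  (continuous_position_max hV).continuousOn.congr fun t (ht : 0 ≤ t) => by
    simp [max_eq_left ht]

end Position

/-! ### Returns to the base at the initial time -/

section Returns

theorem measure_eq_zero_of_mapsTo_of_injective_fderiv {E : Type*} [NormedAddCommGroup E]
    [NormedSpace ℝ E] [FiniteDimensional ℝ E] [MeasurableSpace E] [BorelSpace E] (μ : Measure E)
    [μ.IsAddHaarMeasure] {g : E → E} {g' : E → E →L[ℝ] E} {S N : Set E} (hgN : MapsTo g S N)
    (hg : ∀ x ∈ S, HasStrictFDerivAt g (g' x) x) (hg' : ∀ x ∈ S, Function.Injective (g' x))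
    (hN : μ N = 0) : μ S = 0 := by
  refine measure_null_of_locally_null S fun x hx => ?_
  have hdet : (g' x).det ≠ 0 := fun h =>
    LinearMap.det_eq_zero_iff_ker_ne_bot.1 h (LinearMap.ker_eq_bot.2 (hg' x hx))
  obtain ⟨m, hm, hmdet⟩ := ENNReal.lt_iff_exists_nnreal_btwn.1
    (ENNReal.ofReal_pos.2 (abs_pos.2 hdet))
  obtain ⟨δ, hδ, hδ0⟩ :=
    ((mul_le_addHaar_image_of_lt_det μ (g' x) hmdet).and self_mem_nhdsWithin).exists
  obtain ⟨u, hu, happrox⟩ := (hg x hx).approximates_deriv_on_nhds (Or.inr hδ0)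
  refine ⟨S ∩ u, inter_mem_nhdsWithin S hu, ?_⟩
  have h_image : (m : ENNReal) * μ (S ∩ u) ≤ 0 :=
    (hδ _ g (happrox.mono_set inter_subset_right)).trans_eq
      (measure_mono_null (hgN.mono_left inter_subset_left).image_subset hN)
  exact (mul_eq_zero.1 (le_zero_iff.1 h_image)).resolve_left hm.ne'

theorem measure_graph_eq_zero {α : Type*} [MeasurableSpace α] {μ : Measure α}
    {g : α → ℝ} (hg : Measurable g) : (μ.prod (volume : Measure ℝ)) {p | p.2 = g p.1} = 0 := by
  have hm : MeasurableSet {p : α × ℝ | p.2 = g p.1} :=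
    measurableSet_eq_fun measurable_snd (hg.comp measurable_fst)
  refine (Measure.measure_prod_null hm).2 (ae_of_all _ fun x => ?_)
  have : Prod.mk x ⁻¹' {p : α × ℝ | p.2 = g p.1} = {g x} := by ext; simp
  simp [this]

/-- The line in space-time of a particle that is on the base at time `t` with longitudinal velocity
`v`, given by its position at time `0` and its velocity. -/
def flightLine (V : ℝ → ℝ) (p : ℝ × ℝ) : ℝ × ℝ := (position V p.1 - p.1 * p.2, p.2)

variable {V : ℝ → ℝ} (hV : ContinuousOn V (Ici 0))
include hV

theorem hasStrictFDerivAt_flightLine {p : ℝ × ℝ} (hp : 0 < p.1) :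
    HasStrictFDerivAt (flightLine V)
      (((V p.1 - p.2) • ContinuousLinearMap.fst ℝ ℝ ℝ -
        p.1 • ContinuousLinearMap.snd ℝ ℝ ℝ).prod (ContinuousLinearMap.snd ℝ ℝ ℝ)) p := by
  have h_pos := (hasStrictDerivAt_position hV hp).comp_hasStrictFDerivAt p
    (hasStrictFDerivAt_fst (𝕜 := ℝ) (p := p))
  have h_mul := (hasStrictFDerivAt_fst (𝕜 := ℝ) (p := p)).mul
    (hasStrictFDerivAt_snd (𝕜 := ℝ) (p := p))
  refine ((h_pos.sub h_mul).prodMk hasStrictFDerivAt_snd).congr_fderiv ?_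
  ext <;> simp

theorem volume_eq_zero_of_mapsTo_flightLine {S N : Set (ℝ × ℝ)}
    (hS : ∀ p ∈ S, 0 < p.1 ∧ p.2 ≠ V p.1) (hSN : MapsTo (flightLine V) S N) (hN : volume N = 0) :
    volume S = 0 := by
  refine measure_eq_zero_of_mapsTo_of_injective_fderiv volume hSN
    (fun p hp => hasStrictFDerivAt_flightLine hV (hS p hp).1) (fun p hp => ?_) hN
  refine (injective_iff_map_eq_zero _).2 fun q hq => ?_
  have hq2 : q.2 = 0 := congrArg Prod.snd hq
  have hq1 : (V p.1 - p.2) * q.1 = 0 := by simpa [hq2] using congrArg Prod.fst hq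
  exact Prod.ext ((mul_eq_zero.1 hq1).resolve_left (sub_ne_zero.2 (hS p hp).2.symm)) hq2

theorem volume_image_flightLine_eq_zero {Q : Set (ℝ × ℝ)} (hQ0 : ∀ p ∈ Q, 0 < p.1)
    (hQ : volume Q = 0) : volume (flightLine V '' Q) = 0 :=
  addHaar_image_eq_zero_of_differentiableOn_of_addHaar_eq_zero volume
    (fun p hp => (hasStrictFDerivAt_flightLine hV
      (hQ0 p hp)).hasFDerivAt.differentiableAt.differentiableWithinAt) hQ

omit hV in
/-- The pairs `(t, v)` such that a particle that hits the base at time `t` with longitudinal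
velocity `v` has, after `k` previous collisions with the base, been on it at time `0`. -/
def returnSet (V : ℝ → ℝ) : ℕ → Set (ℝ × ℝ)
  | 0 => {p | 0 < p.1 ∧ p.2 ≠ V p.1 ∧ position V p.1 = p.1 * p.2}
  | k + 1 => {p | p.2 ≠ V p.1 ∧ ∃ s, 0 < s ∧ s < p.1 ∧
      position V p.1 - position V s = p.2 * (p.1 - s) ∧ (s, 2 * V s - p.2) ∈ returnSet V k}

theorem measurePreserving_reflect :
    MeasurePreserving (fun p : ℝ × ℝ => (p.1, 2 * V (max p.1 0) - p.2)) := by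
  refine (MeasurePreserving.id volume).skew_product
    (g := fun s v => 2 * V (max s 0) - v) ?_ (ae_of_all _ fun s => ?_)
  · exact (((continuous_comp_max hV).comp continuous_fst).const_mul 2).sub
      continuous_snd |>.measurable
  · exact (Measure.measurePreserving_sub_left volume (2 * V (max s 0))).map_eq

theorem volume_returnSet (k : ℕ) : volume (returnSet V k) = 0 := by
  induction k with
  | zero =>
    refine volume_eq_zero_of_mapsTo_flightLine hV (N := {0} ×ˢ univ) (fun p hp => ⟨hp.1, hp.2.1⟩)
      (fun p hp => ⟨?_, mem_univ _⟩) ?_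
    · simp [flightLine, hp.2.2]
    · simp [Measure.volume_eq_prod]
  | succ k ih =>
    set Q := {q : ℝ × ℝ | 0 < q.1} ∩
      (fun q : ℝ × ℝ => (q.1, 2 * V (max q.1 0) - q.2)) ⁻¹' returnSet V k
    have hQ : volume Q = 0 := measure_mono_null inter_subset_right
      ((measurePreserving_reflect hV).quasiMeasurePreserving.preimage_null ih)
    refine volume_eq_zero_of_mapsTo_flightLine hV (N := flightLine V '' Q) ?_ ?_
      (volume_image_flightLine_eq_zero hV (fun q hq => hq.1) hQ)
    · rintro p ⟨hne, s, hs, hst, -⟩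
      exact ⟨hs.trans hst, hne⟩
    · rintro p ⟨-, s, hs, -, hX, hmem⟩
      refine ⟨(s, p.2), ⟨hs, by simpa [max_eq_left hs.le] using hmem⟩, Prod.ext ?_ rfl⟩
      simp only [flightLine]
      linear_combination -hX

theorem ae_notMem_returnSet : ∀ᵐ t : ℝ, ∀ᵐ v : ℝ, ∀ k, (t, v) ∉ returnSet V k :=
  Measure.ae_ae_of_ae_prod (p := fun z : ℝ × ℝ => ∀ k, z ∉ returnSet V k)
    (ae_all_iff.2 fun k => measure_eq_zero_iff_ae_notMem.1 (volume_returnSet hV k))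

end Returns

/-! ### Transverse motion -/

section Transverse

/-- `‖v‖²` times the square of the half chord that the ball of radius `R` cuts from the line
through `x` in direction `v`. -/
def disc (R : ℝ) (x v : Transverse d) : ℝ := inner ℝ x v ^ 2 + ‖v‖ ^ 2 * (R ^ 2 - ‖x‖ ^ 2)

/-- The necessary condition for a particle moving freely or reflected by the sphere of radius `R`,
which is at `x` with velocity `v`, to have been on this sphere a time `τ` earlier. -/
def Touches (R : ℝ) (τ : ℝ) (x v : Transverse d) : Prop :=
  ∃ k : ℤ, inner ℝ x v - τ * ‖v‖ ^ 2 = (2 * k + 1) * √(disc R x v)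

theorem continuous_disc (R : ℝ) :
    Continuous fun q : Transverse d × Transverse d => disc R q.1 q.2 := by
  unfold disc
  fun_prop

theorem disc_add_smul (R c : ℝ) (x v : Transverse d) : disc R (x + c • v) v = disc R x v := by
  have h_norm : ‖x + c • v‖ ^ 2 = ‖x‖ ^ 2 + 2 * c * inner ℝ x v + c ^ 2 * ‖v‖ ^ 2 := by
    rw [norm_add_sq_real, inner_smul_right, norm_smul, mul_pow, Real.norm_eq_abs, sq_abs]; ring
  rw [disc, disc, h_norm, inner_add_left, inner_smul_left, real_inner_self_eq_norm_sq, conj_trivial]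
  ring

theorem measure_eq_zero_of_lines {E : Type*} [NormedAddCommGroup E] [NormedSpace ℝ E]
    [FiniteDimensional ℝ E] [MeasurableSpace E] [BorelSpace E] (μ : Measure E)
    [μ.IsAddHaarMeasure] {S : Set E} (hS : MeasurableSet S) {v : E}
    (h_line : ∀ x ∈ S, ∀ c : ℝ, x + c • v ∈ S → c = 0) : μ S = 0 := by
  have h_inj : Function.Injective fun n : ℕ => 1 / ((n : ℝ) + 1) := fun n m h => by
    simpa using h
  refine Measure.addHaar_eq_zero_of_disjoint_translates μ
    (fun n : ℕ => (1 / ((n : ℝ) + 1)) • v) ?_ (fun n m hnm => Set.disjoint_left.2 ?_) hS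
  · have h_bdd := (tendsto_one_div_add_atTop_nhds_zero_nat (𝕜 := ℝ)).smul_const v
    exact Metric.isBounded_range_of_tendsto _ h_bdd
  · simp only [singleton_add, mem_image]
    rintro z ⟨x, hx, rfl⟩ ⟨y, hy, hyx⟩
    refine hnm (h_inj (sub_eq_zero.1 (h_line x hx _ ?_)))
    have : x + (1 / ((n : ℝ) + 1) - 1 / ((m : ℝ) + 1)) • v = y := by
      rw [sub_smul, ← add_sub_assoc, add_comm x, ← hyx, add_sub_cancel_left]
    rwa [this]

theorem volume_touches_eq_zero (hd : 2 ≤ d) (R τ : ℝ) :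
    (volume.prod volume) {q : Transverse d × Transverse d | Touches R τ q.2 q.1} = 0 := by
  have h_union : {q : Transverse d × Transverse d | Touches R τ q.2 q.1} =
      ⋃ k : ℤ, {q | inner ℝ q.2 q.1 - τ * ‖q.1‖ ^ 2 = (2 * k + 1) * √(disc R q.2 q.1)} := by
    ext q; simp [Touches]
  rw [h_union]
  refine measure_iUnion_null fun k => ?_
  have h_meas : MeasurableSet {q : Transverse d × Transverse d |
      inner ℝ q.2 q.1 - τ * ‖q.1‖ ^ 2 = (2 * k + 1) * √(disc R q.2 q.1)} :=
    (isClosed_eq (by fun_prop) (continuous_const.mul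
      ((continuous_disc R).comp continuous_swap).sqrt)).measurableSet
  have : Nonempty (Fin (d - 1)) := ⟨⟨0, by omega⟩⟩
  rw [Measure.measure_prod_null h_meas]
  filter_upwards [Measure.ae_ne volume 0] with v hv
  refine measure_eq_zero_of_lines volume (measurable_prodMk_left h_meas) (v := v)
    fun x hx c hc => ?_
  simp only [mem_preimage, mem_ofPred_eq] at hx hc
  rw [disc_add_smul, inner_add_left, inner_smul_left, real_inner_self_eq_norm_sq,
    conj_trivial] at hc
  have h_zero : c * ‖v‖ ^ 2 = 0 := by linear_combination hc - hx
  exact (mul_eq_zero.1 h_zero).resolve_right (by positivity)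

theorem ae_not_touches (hd : 2 ≤ d) (R τ : ℝ) :
    ∀ᵐ p : Transverse d × Vect d, ¬ Touches R τ p.1 p.2.2 := by
  have h_prod : Measure.QuasiMeasurePreserving
      (Prod.map (Prod.snd : ℝ × Transverse d → Transverse d) (id : Transverse d → Transverse d))
      (volume.prod volume) (volume.prod volume) :=
    MeasureTheory.QuasiMeasurePreserving.prodMap Measure.quasiMeasurePreserving_snd
      (Measure.QuasiMeasurePreserving.id volume)
  exact (h_prod.comp Measure.measurePreserving_swap.quasiMeasurePreserving).ae
    (measure_eq_zero_iff_ae_notMem.1 (volume_touches_eq_zero hd R τ))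

theorem ae_transverse_ne_zero (hd : 2 ≤ d) : ∀ᵐ p : Transverse d × Vect d, p.2.2 ≠ 0 := by
  have : Nonempty (Fin (d - 1)) := ⟨⟨0, by omega⟩⟩
  have h_ne : ∀ᵐ v : Transverse d, v ≠ 0 := Measure.ae_ne volume 0
  exact (Measure.quasiMeasurePreserving_snd.comp Measure.quasiMeasurePreserving_snd).ae h_ne

theorem ae_longitudinal {P : ℝ → Prop} (h : ∀ᵐ v, P v) :
    ∀ᵐ p : Transverse d × Vect d, P p.2.1 :=
  (Measure.quasiMeasurePreserving_fst.comp Measure.quasiMeasurePreserving_snd).ae h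

theorem ae_norm_ne {R : ℝ} (hR : R ≠ 0) : ∀ᵐ p : Transverse d × Vect d, ‖p.1‖ ≠ R := by
  have h : ∀ᵐ x : Transverse d, ‖x‖ ≠ R := by
    filter_upwards [measure_eq_zero_iff_ae_notMem.1
      (Measure.addHaar_sphere_of_ne_zero (volume : Measure (Transverse d)) 0 hR)] with x hx
    simpa using hx
  exact (Measure.quasiMeasurePreserving_fst (ν := (volume : Measure (Vect d)))).ae h

theorem ae_longitudinal_ne_of_measurable {g : Transverse d × Transverse d → ℝ}
    (hg : Measurable g) : ∀ᵐ p : Transverse d × Vect d, p.2.1 ≠ g (p.1, p.2.2) := by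
  have h_swap : MeasurePreserving (Prod.map (id : Transverse d → Transverse d)
      (Prod.swap : ℝ × Transverse d → Transverse d × ℝ)) (volume.prod (volume.prod volume))
      (volume.prod (volume.prod volume)) :=
    (MeasurePreserving.id volume).prod Measure.measurePreserving_swap
  exact ((measurePreserving_prodAssoc volume volume
    volume).symm.comp h_swap).quasiMeasurePreserving.ae
      (measure_eq_zero_iff_ae_notMem.1 (measure_graph_eq_zero hg))

theorem ae_not_edge {V : ℝ → ℝ} (hV : ContinuousOn V (Ici 0)) (hd : 2 ≤ d) (R t : ℝ) :
    ∀ᵐ p : Transverse d × Vect d, ∀ s, 0 ≤ s → s < t →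
      position V t - position V s = p.2.1 * (t - s) → ¬ Touches R (t - s) p.1 p.2.2 := by
  -- The transverse velocity determines the time `t - s` up to an integer, hence also `v_x`.
  let σ : ℤ → Transverse d × Transverse d → ℝ := fun k q =>
    (inner ℝ q.1 q.2 - (2 * k + 1) * √(disc R q.1 q.2)) / ‖q.2‖ ^ 2
  let g : ℤ → Transverse d × Transverse d → ℝ := fun k q =>
    (position V t - position V (max (t - σ k q) 0)) / σ k q
  have hσ : ∀ k, Measurable (σ k) := fun k =>
    ((Continuous.inner continuous_fst continuous_snd).sub
      (continuous_const.mul (continuous_disc R).sqrt)).measurable.div (by fun_prop)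
  have hg : ∀ k, Measurable (g k) := fun k =>
    (((continuous_position_max hV).measurable.comp ((hσ k).const_sub t)).const_sub _).div (hσ k)
  filter_upwards [ae_all_iff.2 fun k => ae_longitudinal_ne_of_measurable (hg k),
    ae_transverse_ne_zero hd] with p hp hp0 s hs hst hX ⟨k, hk⟩
  have hσs : σ k (p.1, p.2.2) = t - s := by
    simp only [σ]
    rw [div_eq_iff (by positivity)]
    linear_combination hk
  refine hp k ?_
  simp only [g, hσs, sub_sub_cancel, max_eq_left hs]
  rw [hX, mul_div_cancel_right₀ _ (sub_pos.2 hst).ne']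

end Transverse

/-! ### Reflections and flights -/

section Reflections

theorem flight_eq (x v : Vect d) (t t' τ : ℝ) :
    x - (t - t') • v - (t' - τ) • v = x - (t - τ) • v := by
  module

theorem reflectBase_reflectBase (W : ℝ) (v : Vect d) : reflectBase W (reflectBase W v) = v := by
  ext <;> simp [reflectBase]

theorem inner_reflectSide (y : Transverse d) (v : Vect d) :
    inner ℝ y (reflectSide y v).2 = -inner ℝ y v.2 := by
  rcases eq_or_ne y 0 with rfl | hy
  · simp
  simp only [reflectSide, inner_sub_right, inner_smul_right, real_inner_self_eq_norm_sq,
    real_inner_comm y v.2]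
  rw [div_mul_cancel₀ _ (by positivity)]
  ring

theorem norm_reflectSide (y : Transverse d) (v : Vect d) : ‖(reflectSide y v).2‖ = ‖v.2‖ := by
  rcases eq_or_ne y 0 with rfl | hy
  · simp [reflectSide]
  have : ‖y‖ ^ 2 ≠ 0 := by positivity
  rw [← sq_eq_sq₀ (norm_nonneg _) (norm_nonneg _), reflectSide, norm_sub_sq_real,
    inner_smul_right, norm_smul, mul_pow, Real.norm_eq_abs, sq_abs]
  field_simp
  ring

theorem reflectSide_reflectSide (y : Transverse d) (v : Vect d) :
    reflectSide y (reflectSide y v) = v := by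
  have h_inner : inner ℝ (reflectSide y v).2 y = -inner ℝ v.2 y := by
    rw [real_inner_comm, inner_reflectSide, real_inner_comm]
  refine Prod.ext rfl ?_
  rw [reflectSide, h_inner]
  simp only [reflectSide]
  module

theorem touches_flight (R t s : ℝ) (x v : Transverse d) :
    Touches R s (x - (t - s) • v) v ↔ Touches R t x v := by
  have h_flight : x - (t - s) • v = x + (-(t - s)) • v := by module
  simp only [Touches, h_flight, disc_add_smul, inner_add_left, inner_smul_left,
    real_inner_self_eq_norm_sq, conj_trivial]
  refine exists_congr fun k => ?_
  constructor <;> intro h <;> linarith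

theorem sqrt_disc_of_norm_eq {R : ℝ} {x : Transverse d} (hx : ‖x‖ = R) (v : Transverse d) :
    √(disc R x v) = |inner ℝ x v| := by
  rw [disc, hx, sub_self, mul_zero, add_zero, Real.sqrt_sq_eq_abs]

theorem touches_of_norm_eq {R : ℝ} {x : Transverse d} (hx : ‖x‖ = R) (v : Transverse d) :
    Touches R 0 x v := by
  rw [Touches, sqrt_disc_of_norm_eq hx]
  rcases abs_cases (inner ℝ x v) with ⟨h, _⟩ | ⟨h, _⟩
  · exact ⟨0, by rw [h]; simp⟩
  · exact ⟨-1, by rw [h]; push_cast; ring⟩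

theorem disc_reflectSide (R : ℝ) (x : Transverse d) (v : Vect d) :
    disc R x (reflectSide x v).2 = disc R x v.2 := by
  rw [disc, disc, inner_reflectSide, norm_reflectSide, neg_sq]

theorem Touches.reflectSide {R s : ℝ} {x : Transverse d} (hx : ‖x‖ = R) {v : Vect d}
    (h : Touches R s x v.2) : Touches R s x (reflectSide x v).2 := by
  obtain ⟨k, hk⟩ := h
  rw [Touches, disc_reflectSide, inner_reflectSide, norm_reflectSide]
  rw [sqrt_disc_of_norm_eq hx] at hk ⊢
  rcases abs_cases (inner ℝ x v.2) with ⟨h, _⟩ | ⟨h, _⟩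
  · exact ⟨k - 1, by rw [h] at hk ⊢; push_cast; linear_combination hk⟩
  · exact ⟨k + 1, by rw [h] at hk ⊢; push_cast; linear_combination hk⟩

theorem touches_reflectSide_iff {R s : ℝ} {x : Transverse d} (hx : ‖x‖ = R) {v : Vect d} :
    Touches R s x (reflectSide x v).2 ↔ Touches R s x v.2 :=
  ⟨fun h => by simpa [reflectSide_reflectSide] using h.reflectSide hx, .reflectSide hx⟩

variable {M : Model d} {V : ℝ → ℝ} {t : ℝ} {x v : Vect d}

theorem Model.HitsBase.reflect (h : M.HitsBase V t x v) :
    M.HitsBase V t x (reflectBase (V t) v) :=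
  ⟨h.1, h.2.1, fun h' => h.2.2 (by simp only [reflectBase] at h'; linarith)⟩

theorem Model.HitsSide.reflect (h : M.HitsSide V t x v) :
    M.HitsSide V t x (reflectSide x.2 v) := by
  refine ⟨h.1, h.2.1, ?_⟩
  rw [real_inner_comm, inner_reflectSide, real_inner_comm]
  exact neg_ne_zero.2 h.2.2

end Reflections

/-! ### Traces of the density along histories -/

section Traces

theorem traceBefore_eq {f : ℝ → Vect d → Vect d → ℝ} {t c : ℝ} {x v : Vect d}
    (h : ∀ᶠ τ in 𝓝[<] t, f τ (x - (t - τ) • v) v = c) : traceBefore f t x v = c := by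
  have h_sub : Tendsto (fun ε : ℝ => t - ε) (𝓝[>] 0) (𝓝[<] t) := by
    refine tendsto_nhdsWithin_iff.2 ⟨Tendsto.mono_left ?_ nhdsWithin_le_nhds, ?_⟩
    · exact (continuous_const.sub continuous_id).tendsto' 0 t (sub_zero t)
    · filter_upwards [self_mem_nhdsWithin] with ε hε using sub_lt_self t hε
  refine Tendsto.limUnder_eq (tendsto_const_nhds.congr' ?_)
  filter_upwards [h_sub.eventually h] with ε hε
  rw [← hε, sub_sub_cancel]

theorem traceAfter_eq {f : ℝ → Vect d → Vect d → ℝ} {s c : ℝ} {x v : Vect d}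
    (h : ∀ᶠ τ in 𝓝[>] s, f τ (x + (τ - s) • v) v = c) : traceAfter f s x v = c := by
  have h_add : Tendsto (fun ε : ℝ => s + ε) (𝓝[>] 0) (𝓝[>] s) := by
    refine tendsto_nhdsWithin_iff.2 ⟨Tendsto.mono_left ?_ nhdsWithin_le_nhds, ?_⟩
    · exact (continuous_const.add continuous_id).tendsto' 0 s (add_zero s)
    · filter_upwards [self_mem_nhdsWithin] with ε hε using lt_add_of_pos_right s hε
  refine Tendsto.limUnder_eq (tendsto_const_nhds.congr' ?_)
  filter_upwards [h_add.eventually h] with ε hε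
  rw [← hε, add_sub_cancel_left]

/-- The particle at `x` with velocity `v` at time `t` has been on the base at time `0`, provided
that its collisions with the base happened at the times recorded by `returnSet`. -/
def Returns (V : ℝ → ℝ) (t : ℝ) (x v : Vect d) : Prop :=
  x.1 = t * v.1 ∨ ∃ k s, 0 < s ∧ s < t ∧ x.1 - (t - s) * v.1 = position V s ∧
    (s, 2 * V s - v.1) ∈ returnSet V k

variable {M : Model d} {V : ℝ → ℝ} {f : ℝ → Vect d → Vect d → ℝ} {s t : ℝ} {x v v₀ : Vect d}

theorem Returns.of_base (hs : 0 < s) (hst : s < t) (hhit : M.HitsBase V s (x - (t - s) • v) v)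
    (h : Returns V s (x - (t - s) • v) (reflectBase (V s) v)) : Returns V t x v := by
  have hX : x.1 - (t - s) * v.1 = position V s := by simpa using hhit.1.1
  refine Or.inr ?_
  rcases h with h | ⟨k, s', hs', hss', hX', hmem⟩
  · exact ⟨0, s, hs, hst, hX, hs, hhit.reflect.2.2, hhit.1.1 ▸ h⟩
  · refine ⟨k + 1, s, hs, hst, hX, hhit.reflect.2.2, s', hs', hss', ?_, hmem⟩
    rw [hhit.1.1] at hX'
    simp only [reflectBase] at hX' ⊢
    linarith

theorem Returns.of_side {y : Transverse d} (hst : s < t)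
    (h : Returns V s (x - (t - s) • v) (reflectSide y v)) : Returns V t x v := by
  rcases h with h | ⟨k, s', hs', hss', hX, hmem⟩
  · simp only [reflectSide, Prod.fst_sub, Prod.smul_fst, smul_eq_mul] at h
    exact Or.inl (by linarith)
  · simp only [reflectSide, Prod.fst_sub, Prod.smul_fst, smul_eq_mul] at hX
    exact Or.inr ⟨k, s', hs', hss'.trans hst, by linarith, hmem⟩

theorem Model.IsGasDensity.vlasov_flight (hf : M.IsGasDensity V f) {a b : ℝ} (ha : 0 ≤ a)
    (hab : a ≤ b) (hfree : ∀ τ ∈ Icc a b, x - (t - τ) • v ∉ M.body V τ) :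
    f b (x - (t - b) • v) v = f a (x - (t - a) • v) v := by
  rw [← flight_eq x v t b a]
  exact hf.vlasov a b _ v ha hab fun τ hτ => by rw [flight_eq]; exact hfree τ hτ

theorem Model.IsGasDensity.trace_flight (hf : M.IsGasDensity V f) (hs : 0 ≤ s) (hst : s < t)
    (hfree : ∀ τ ∈ Ioo s t, x - (t - τ) • v ∉ M.body V τ) :
    traceBefore f t x v = traceAfter f s (x - (t - s) • v) v := by
  obtain ⟨m, hm⟩ := nonempty_Ioo.2 hst
  have h_const : ∀ τ ∈ Ioo s t, f τ (x - (t - τ) • v) v = f m (x - (t - m) • v) v := by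
    intro τ hτ
    rcases le_total m τ with h | h
    · exact hf.vlasov_flight (hs.trans hm.1.le) h fun r hr =>
        hfree r ⟨hm.1.trans_le hr.1, hr.2.trans_lt hτ.2⟩
    · exact (hf.vlasov_flight (hs.trans hτ.1.le) h fun r hr =>
        hfree r ⟨hτ.1.trans_le hr.1, hr.2.trans_lt hm.2⟩).symm
  rw [traceBefore_eq (c := f m (x - (t - m) • v) v), traceAfter_eq (c := f m (x - (t - m) • v) v)]
  · filter_upwards [Ioo_mem_nhdsGT hst] with τ hτ
    rw [← h_const τ hτ]
    congr 1
    module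
  · filter_upwards [Ioo_mem_nhdsLT hst] with τ hτ using h_const τ hτ

theorem Model.IsGasDensity.trace_free (hf : M.IsGasDensity V f) (ht : 0 < t)
    (hfree : ∀ τ ∈ Ico 0 t, x - (t - τ) • v ∉ M.body V τ) : traceBefore f t x v = M.f₀ v := by
  refine traceBefore_eq ?_
  filter_upwards [Ioo_mem_nhdsLT ht] with τ hτ
  rw [hf.vlasov_flight le_rfl hτ.1.le fun r hr => hfree r ⟨hr.1, hr.2.trans_lt hτ.2⟩, hf.initial]

theorem Model.IsGasDensity.trace_base (hf : M.IsGasDensity V f) (hs : 0 < s) (hst : s < t)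
    (hfree : ∀ τ ∈ Ioo s t, x - (t - τ) • v ∉ M.body V τ)
    (hhit : M.HitsBase V s (x - (t - s) • v) v)
    (hreg : M.Regular V s (x - (t - s) • v) (reflectBase (V s) v)) :
    traceBefore f t x v = traceBefore f s (x - (t - s) • v) (reflectBase (V s) v) := by
  rw [hf.trace_flight hs.le hst hfree, ← hf.boundary_base s _ _ hs hhit.reflect hreg,
    reflectBase_reflectBase]

theorem Model.IsGasDensity.trace_side (hf : M.IsGasDensity V f) (hs : 0 < s) (hst : s < t)
    (hfree : ∀ τ ∈ Ioo s t, x - (t - τ) • v ∉ M.body V τ)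
    (hhit : M.HitsSide V s (x - (t - s) • v) v)
    (hreg : M.Regular V s (x - (t - s) • v) (reflectSide (x - (t - s) • v).2 v)) :
    traceBefore f t x v =
      traceBefore f s (x - (t - s) • v) (reflectSide (x - (t - s) • v).2 v) := by
  rw [hf.trace_flight hs.le hst hfree, ← hf.boundary_side s _ _ hs hhit.reflect hreg,
    reflectSide_reflectSide]

theorem Model.IsGasDensity.trace_history (hf : M.IsGasDensity V f) (H : M.History V t x v v₀)
    (ht : 0 < t) : traceBefore f t x v = M.f₀ v₀ ∨ Touches M.R t x.2 v.2 ∨ Returns V t x v := by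
  induction H with
  | free t x v _ hfree =>
    by_cases h0 : x - (t - 0) • v ∈ M.body V 0
    · refine Or.inr (h0.symm.imp (fun h0 => ?_) fun h0 => Or.inl ?_)
      · exact (touches_flight M.R t 0 x.2 v.2).1 (touches_of_norm_eq h0.2.2 _)
      · simpa [position_zero, sub_eq_zero] using h0.1
    · refine Or.inl (hf.trace_free ht fun τ hτ => ?_)
      rcases hτ.1.eq_or_lt with rfl | hτ0
      · exact h0
      · exact hfree τ ⟨hτ0, hτ.2⟩
  | base t s x v v₀ hs hst hfree hhit hprev ih =>
    rw [hf.trace_base hs hst hfree hhit ⟨v₀, hprev⟩]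
    exact (ih hs).imp_right (.imp (touches_flight M.R t s x.2 v.2).1 (.of_base hs hst hhit))
  | side t s x v v₀ hs hst hfree hhit hprev ih =>
    rw [hf.trace_side hs hst hfree hhit ⟨v₀, hprev⟩]
    exact (ih hs).imp_right (.imp (fun h => (touches_flight M.R t s x.2 v.2).1
      ((touches_reflectSide_iff hhit.1.2.2).1 h)) (.of_side hst))

theorem Model.History.extend {t' : ℝ} (htt : t' ≤ t) (H : M.History V t' (x - (t - t') • v) v v₀)
    (hfree : ∀ τ ∈ Ico t' t, x - (t - τ) • v ∉ M.body V τ) : M.History V t x v v₀ := by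
  have h_free : ∀ s, (∀ τ ∈ Ioo s t', x - (t - t') • v - (t' - τ) • v ∉ M.body V τ) →
      ∀ τ ∈ Ioo s t, x - (t - τ) • v ∉ M.body V τ := by
    intro s h τ hτ
    rcases lt_or_ge τ t' with h' | h'
    · rw [← flight_eq x v t t' τ]; exact h τ ⟨hτ.1, h'⟩
    · exact hfree τ ⟨h', hτ.2⟩
  cases H with
  | free _ _ _ ht h => exact .free t x v (ht.trans htt) (h_free 0 h)
  | base _ s _ _ _ hs hst h hhit hprev =>
    rw [flight_eq] at hhit hprev
    exact .base t s x v v₀ hs (hst.trans_le htt) (h_free s h) hhit hprev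
  | side _ s _ _ _ hs hst h hhit hprev =>
    rw [flight_eq] at hhit hprev
    exact .side t s x v v₀ hs (hst.trans_le htt) (h_free s h) hhit hprev

theorem Model.IsGasDensity.trace_of_not_regular (hf : M.IsGasDensity V f) (ht : 0 < t)
    (hfree : ∀ᶠ τ in 𝓝[<] t, x - (t - τ) • v ∉ M.body V τ) (hreg : ¬ M.Regular V t x v) :
    traceBefore f t x v = M.f₀ v := by
  obtain ⟨a, hat, ha⟩ := (mem_nhdsLT_iff_exists_Ioo_subset).1 hfree
  refine traceBefore_eq ?_
  filter_upwards [Ioo_mem_nhdsLT (max_lt ht hat)] with τ hτ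
  have h0τ : 0 < τ := (le_max_left _ _).trans_lt hτ.1
  have haτ : a < τ := (le_max_right _ _).trans_lt hτ.1
  refine hf.normalized τ _ v h0τ.le (ha ⟨haτ, hτ.2⟩) fun ⟨v₀, H⟩ => hreg ⟨v₀, ?_⟩
  exact H.extend hτ.2.le fun r hr => ha ⟨haτ.trans_le hr.1, hr.2⟩

end Traces

/-! ### Arrivals at the base -/

section Arrivals

theorem eventually_pos_left {y : ℝ → ℝ} {y' t : ℝ} (h : HasDerivAt y y' t) (h0 : y t = 0)
    (hy' : y' < 0) : ∀ᶠ τ in 𝓝[<] t, 0 < y τ := by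
  filter_upwards [self_mem_nhdsWithin, nhdsWithin_le_nhds
    (eventually_nhdsWithin_sign_eq_of_deriv_neg (h.deriv.trans_lt hy') h0)] with τ hτ h_sign
  exact sign_eq_one_iff.1 (h_sign.trans (sign_pos (sub_pos.2 hτ)))

theorem eventually_neg_left {y : ℝ → ℝ} {y' t : ℝ} (h : HasDerivAt y y' t) (h0 : y t = 0)
    (hy' : 0 < y') : ∀ᶠ τ in 𝓝[<] t, y τ < 0 := by
  filter_upwards [eventually_pos_left h.fun_neg (by simp [h0]) (neg_lt_zero.2 hy')] with τ hτ
  linarith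

theorem deriv_nonneg_of_pos_right {y : ℝ → ℝ} {y' s : ℝ} (h : HasDerivAt y y' s) (h0 : y s = 0)
    (hpos : ∀ᶠ τ in 𝓝[>] s, 0 < y τ) : 0 ≤ y' := by
  refine ge_of_tendsto ((hasDerivWithinAt_iff_tendsto_slope' self_notMem_Ioi).1
    (h.hasDerivWithinAt (s := Ioi s))) ?_
  filter_upwards [hpos, self_mem_nhdsWithin] with τ hτ (hτs : s < τ)
  rw [slope_def_field, h0, sub_zero]
  exact div_nonneg hτ.le (sub_pos.2 hτs).le

theorem deriv_nonpos_of_neg_right {y : ℝ → ℝ} {y' s : ℝ} (h : HasDerivAt y y' s) (h0 : y s = 0)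
    (hneg : ∀ᶠ τ in 𝓝[>] s, y τ < 0) : y' ≤ 0 := by
  have := deriv_nonneg_of_pos_right h.fun_neg (by simp [h0]) (hneg.mono fun τ hτ => neg_pos.2 hτ)
  linarith

variable {V : ℝ → ℝ}

theorem hasDerivAt_relative (hV : ContinuousOn V (Ici 0)) {s : ℝ} (hs : 0 < s) (a b u : ℝ) :
    HasDerivAt (fun τ => a - (b - τ) * u - position V τ) (u - V s) s := by
  have h_flight : HasDerivAt (fun τ => a - (b - τ) * u) u s := by
    simpa using (((hasDerivAt_id s).const_sub b).mul_const u).const_sub a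
  exact h_flight.sub (hasStrictDerivAt_position hV hs).hasDerivAt

/-- The point `p` is in front of the base, inside the infinite cylinder around the axis. -/
def Model.Inside (M : Model d) (V : ℝ → ℝ) (τ : ℝ) (p : Vect d) : Prop :=
  position V τ < p.1 ∧ ‖p.2‖ < M.R

/-- The point `p` is behind the base or outside the infinite cylinder around the axis. -/
def Model.Outside (M : Model d) (V : ℝ → ℝ) (τ : ℝ) (p : Vect d) : Prop :=
  p.1 < position V τ ∨ M.R < ‖p.2‖

theorem eventually_norm_lt {R : ℝ} (t : ℝ) {x : Transverse d} (hx : ‖x‖ < R) (v : Transverse d) :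
    ∀ᶠ τ in 𝓝[<] t, ‖x - (t - τ) • v‖ < R := by
  have hc : ContinuousAt (fun τ : ℝ => ‖x - (t - τ) • v‖) t := by fun_prop
  refine (hc.eventually (gt_mem_nhds ?_)).filter_mono nhdsWithin_le_nhds
  simpa using hx

variable {M : Model d} {t : ℝ} {x v : Vect d}

theorem Model.notMem_body_of_norm_lt {τ : ℝ} {p : Vect d} (h : p.1 ≠ position V τ)
    (h' : ‖p.2‖ < M.R) : p ∉ M.body V τ := by
  rintro (hp | hp)
  · exact h hp.1
  · exact h'.ne hp.2.2

theorem Model.eventually_inside (hV : ContinuousOn V (Ici 0)) (ht : 0 < t)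
    (hx : x.1 = position V t) (hxR : ‖x.2‖ < M.R) (hv : v.1 < V t) :
    ∀ᶠ τ in 𝓝[<] t, M.Inside V τ (x - (t - τ) • v) := by
  filter_upwards [eventually_norm_lt t hxR v.2,
    eventually_pos_left (hasDerivAt_relative hV ht x.1 t v.1) (by simp [hx]) (sub_neg.2 hv)]
    with τ h_norm h_front
  exact ⟨by simpa using h_front, by simpa using h_norm⟩

theorem eventually_behind (hV : ContinuousOn V (Ici 0)) (ht : 0 < t)
    (hx : x.1 = position V t) (hv : V t < v.1) :
    ∀ᶠ τ in 𝓝[<] t, (x - (t - τ) • v).1 < position V τ := by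
  filter_upwards [eventually_neg_left (hasDerivAt_relative hV ht x.1 t v.1) (by simp [hx])
    (sub_pos.2 hv)] with τ h_behind
  simpa using h_behind

theorem Model.eventually_notMem_body (hV : ContinuousOn V (Ici 0)) (ht : 0 < t)
    (hx : x.1 = position V t) (hxR : ‖x.2‖ < M.R) (hv : v.1 ≠ V t) :
    ∀ᶠ τ in 𝓝[<] t, x - (t - τ) • v ∉ M.body V τ := by
  rcases hv.lt_or_gt with hv | hv
  · filter_upwards [eventually_inside hV ht hx hxR hv] with τ h
    exact notMem_body_of_norm_lt h.1.ne' h.2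
  · filter_upwards [eventually_behind hV ht hx hv, eventually_norm_lt t hxR v.2] with τ h h'
    exact notMem_body_of_norm_lt h.ne (by simpa using h')

theorem Model.IsGasDensity.ae_trace {f : ℝ → Vect d → Vect d → ℝ} (hd : 2 ≤ d) (hR : M.R ≠ 0)
    (hV : ContinuousOn V (Ici 0)) (hf : M.IsGasDensity V f) :
    ∀ᵐ t : ℝ, 0 < t → ∀ᵐ p : Transverse d × Vect d, ‖p.1‖ ≤ M.R → ‖p.1‖ < M.R ∧
      (¬ M.Regular V t (position V t, p.1) p.2 →
        traceBefore f t (position V t, p.1) p.2 = M.f₀ p.2) ∧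
      (∀ v₀, M.History V t (position V t, p.1) p.2 v₀ →
        traceBefore f t (position V t, p.1) p.2 = M.f₀ v₀) := by
  filter_upwards [ae_notMem_returnSet hV] with t hret ht
  filter_upwards [ae_norm_ne hR, ae_not_touches hd M.R t, ae_longitudinal hret,
    ae_longitudinal (Measure.ae_ne volume (V t))] with p hpR htouch hpret hpV hle
  have hlt : ‖p.1‖ < M.R := lt_of_le_of_ne hle hpR
  refine ⟨hlt, fun h => hf.trace_of_not_regular ht
    (eventually_notMem_body hV ht rfl hlt hpV) h, fun v₀ H => ?_⟩
  refine (hf.trace_history H ht).resolve_right (not_or.2 ⟨htouch, ?_⟩)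
  rintro (h | ⟨k, s, hs, hst, hX, hmem⟩)
  · exact hpret 0 ⟨ht, hpV, h⟩
  · exact hpret (k + 1) ⟨hpV, s, hs, hst, by linear_combination hX, hmem⟩

end Arrivals

/-! ### Collisions along a history -/

section Collisions

variable {M : Model d} {V : ℝ → ℝ} {s t : ℝ} {x z v v₀ : Vect d}

theorem Model.History.longitudinal (H : M.History V t x v v₀) :
    v₀.1 = v.1 ∨ ∃ s, 0 < s ∧ s < t ∧ x.1 - (t - s) * v.1 = position V s := by
  induction H with
  | free => exact Or.inl rfl
  | base t s x v v₀ hs hst _ hhit => exact Or.inr ⟨s, hs, hst, by simpa using hhit.1.1⟩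
  | side t s x v v₀ _ hst _ _ _ ih =>
    refine ih.imp_right ?_
    rintro ⟨s', hs', hss', hX⟩
    simp only [reflectSide, Prod.fst_sub, Prod.smul_fst, smul_eq_mul] at hX
    exact ⟨s', hs', hss'.trans hst, by linarith⟩

theorem Model.History.norm_transverse (H : M.History V t x v v₀) : ‖v₀.2‖ = ‖v.2‖ := by
  induction H with
  | free => rfl
  | base _ _ _ _ _ _ _ _ _ _ ih => exact ih
  | side _ _ _ _ _ _ _ _ _ _ ih => rw [ih, norm_reflectSide]

theorem Model.Inside.not_outside {τ : ℝ} (h : M.Inside V τ x) : ¬ M.Outside V τ x :=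
  not_or.2 ⟨h.1.not_gt, h.2.not_gt⟩

theorem Model.inside_or_outside (hV : ContinuousOn V (Ici 0)) (hs : 0 ≤ s)
    (hfree : ∀ τ ∈ Ioo s t, x - (t - τ) • v ∉ M.body V τ)
    (hlow : ∀ τ ∈ Ioo s t, (x - (t - τ) • v).1 - position V τ < M.h) :
    (∀ τ ∈ Ioo s t, M.Inside V τ (x - (t - τ) • v)) ∨
      ∀ τ ∈ Ioo s t, M.Outside V τ (x - (t - τ) • v) := by
  let g : ℝ → ℝ × ℝ := fun τ => ((x - (t - τ) • v).1 - position V τ, ‖(x - (t - τ) • v).2‖)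
  have hg : ContinuousOn g (Ioo s t) :=
    ContinuousOn.prodMk (ContinuousOn.sub (by fun_prop)
      ((continuousOn_position hV).mono fun τ hτ => hs.trans hτ.1.le)) (by fun_prop)
  have h_in : IsOpen {p : ℝ × ℝ | 0 < p.1 ∧ p.2 < M.R} :=
    (isOpen_lt continuous_const continuous_fst).inter (isOpen_lt continuous_snd continuous_const)
  have h_out : IsOpen {p : ℝ × ℝ | p.1 < 0 ∨ M.R < p.2} :=
    (isOpen_lt continuous_fst continuous_const).union (isOpen_lt continuous_const continuous_snd)
  have h_disj : Disjoint {p : ℝ × ℝ | 0 < p.1 ∧ p.2 < M.R} {p | p.1 < 0 ∨ M.R < p.2} :=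
    Set.disjoint_left.2 fun p hp hp' => hp'.elim hp.1.not_gt hp.2.not_gt
  have h_cover : g '' Ioo s t ⊆ {p | 0 < p.1 ∧ p.2 < M.R} ∪ {p | p.1 < 0 ∨ M.R < p.2} := by
    rintro _ ⟨τ, hτ, rfl⟩
    refine or_iff_not_imp_right.2 fun h => ?_
    obtain ⟨hX, hn⟩ := not_or.1 h
    rw [not_lt] at hX hn
    exact ⟨lt_of_le_of_ne hX fun h => hfree τ hτ (Or.inl ⟨(sub_eq_zero.1 h.symm), hn⟩),
      lt_of_le_of_ne hn fun h => hfree τ hτ (Or.inr ⟨hX, (hlow τ hτ).le, h⟩)⟩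
  refine ((isPreconnected_Ioo.image g hg).subset_or_subset h_in h_out h_disj h_cover).imp
    (fun h τ hτ => ?_) (fun h τ hτ => ?_)
  · exact (h (mem_image_of_mem g hτ)).imp_left sub_pos.1
  · exact (h (mem_image_of_mem g hτ)).imp_left sub_neg.1

/-- No particle that collides twice with the base reaches the upper rim of the barrier
in between. -/
def Model.NoEscape (M : Model d) (V : ℝ → ℝ) : Prop :=
  ∀ s T u, 0 ≤ s → s < T → position V T - position V s = u * (T - s) →
    ∀ τ ∈ Icc s T, position V s + u * (τ - s) - position V τ < M.h

theorem Model.NoEscape.inside_or_outside (hesc : M.NoEscape V) (hV : ContinuousOn V (Ici 0))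
    {s' T : ℝ} (hs' : 0 ≤ s') (hss : s' ≤ s) (htT : t ≤ T)
    (hfree : ∀ τ ∈ Ioo s t, x - (t - τ) • v ∉ M.body V τ)
    (hXs : x.1 - (t - s') * v.1 = position V s') (hXT : x.1 + (T - t) * v.1 = position V T) :
    (∀ τ ∈ Ioo s t, M.Inside V τ (x - (t - τ) • v)) ∨
      ∀ τ ∈ Ioo s t, M.Outside V τ (x - (t - τ) • v) := by
  refine M.inside_or_outside hV (hs'.trans hss) hfree fun τ hτ => ?_
  have h_low := hesc s' T v.1 hs' (hss.trans_lt ((hτ.1.trans hτ.2).trans_le htT))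
    (by rw [← hXs, ← hXT]; ring) τ ⟨hss.trans hτ.1.le, hτ.2.le.trans htT⟩
  rw [← hXs] at h_low
  simp only [Prod.fst_sub, Prod.smul_fst, smul_eq_mul]
  linarith

theorem Model.NoEscape.eventually_inside (hesc : M.NoEscape V) (hV : ContinuousOn V (Ici 0))
    {s' T : ℝ} (hs' : 0 ≤ s') (hss : s' ≤ s) (hst : s < t) (htT : t ≤ T)
    (hfree : ∀ τ ∈ Ioo s t, x - (t - τ) • v ∉ M.body V τ)
    (hXs : x.1 - (t - s') * v.1 = position V s') (hXT : x.1 + (T - t) * v.1 = position V T)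
    (h : ∀ᶠ τ in 𝓝[<] t, M.Inside V τ (x - (t - τ) • v)) :
    ∀ᶠ τ in 𝓝[>] s, M.Inside V τ (x - (t - s) • v - (s - τ) • v) := by
  simp only [flight_eq]
  filter_upwards [Ioo_mem_nhdsGT hst] with r hr
  refine (hesc.inside_or_outside hV hs' hss htT hfree hXs hXT).elim (· r hr) fun h_out => ?_
  obtain ⟨τ, hτ, hτst⟩ := (h.and (Ioo_mem_nhdsLT hst)).exists
  exact absurd (h_out τ hτst) hτ.not_outside

theorem Model.NoEscape.eventually_outside (hesc : M.NoEscape V) (hV : ContinuousOn V (Ici 0))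
    {s' T : ℝ} (hs' : 0 ≤ s') (hss : s' ≤ s) (hst : s < t) (htT : t ≤ T)
    (hfree : ∀ τ ∈ Ioo s t, x - (t - τ) • v ∉ M.body V τ)
    (hXs : x.1 - (t - s') * v.1 = position V s') (hXT : x.1 + (T - t) * v.1 = position V T)
    (h : ∀ᶠ τ in 𝓝[<] t, M.Outside V τ (x - (t - τ) • v)) :
    ∀ᶠ τ in 𝓝[>] s, M.Outside V τ (x - (t - s) • v - (s - τ) • v) := by
  simp only [flight_eq]
  filter_upwards [Ioo_mem_nhdsGT hst] with r hr
  refine (hesc.inside_or_outside hV hs' hss htT hfree hXs hXT).elim (fun h_in => ?_) (· r hr)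
  obtain ⟨τ, hτ, hτst⟩ := (h.and (Ioo_mem_nhdsLT hst)).exists
  exact absurd hτ (h_in τ hτst).not_outside

theorem Model.HitsBase.lt_of_inside (hV : ContinuousOn V (Ici 0)) (hs : 0 < s)
    (hhit : M.HitsBase V s z v) (h : ∀ᶠ τ in 𝓝[>] s, M.Inside V τ (z - (s - τ) • v)) :
    V s < v.1 := by
  refine lt_of_le_of_ne (sub_nonneg.1 ?_) hhit.2.2.symm
  refine deriv_nonneg_of_pos_right (hasDerivAt_relative hV hs z.1 s v.1) (by simp [hhit.1.1]) ?_
  filter_upwards [h] with τ hτ using sub_pos.2 hτ.1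

theorem Model.HitsBase.lt_of_outside (hV : ContinuousOn V (Ici 0)) (hs : 0 < s)
    (hhit : M.HitsBase V s z v) (h : ∀ᶠ τ in 𝓝[>] s, M.Outside V τ (z - (s - τ) • v)) :
    v.1 < V s := by
  have h_norm : ContinuousAt (fun τ : ℝ => ‖(z - (s - τ) • v).2‖) s := by fun_prop
  have h_lt : ∀ᶠ τ in 𝓝[>] s, ‖(z - (s - τ) • v).2‖ < M.R :=
    (h_norm.eventually (gt_mem_nhds (by simpa using hhit.2.1))).filter_mono nhdsWithin_le_nhds
  refine lt_of_le_of_ne (sub_nonpos.1 ?_) hhit.2.2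
  refine deriv_nonpos_of_neg_right (hasDerivAt_relative hV hs z.1 s v.1) (by simp [hhit.1.1]) ?_
  filter_upwards [h, h_lt] with τ hτ hτR using sub_neg.2 (hτ.resolve_right hτR.not_gt)

theorem hasDerivAt_norm_sq_flight (s : ℝ) (y w : Transverse d) (R : ℝ) :
    HasDerivAt (fun τ => ‖y - (s - τ) • w‖ ^ 2 - R ^ 2) (2 * inner ℝ y w) s := by
  have h_flight : HasDerivAt (fun τ : ℝ => y - (s - τ) • w) w s := by
    simpa using (((hasDerivAt_id s).const_sub s).smul_const w).const_sub y
  simpa using h_flight.norm_sq.sub_const (R ^ 2)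

theorem Model.HitsSide.eventually_inside (hV : ContinuousOn V (Ici 0)) (hs : 0 < s)
    (hhit : M.HitsSide V s z v) (h : ∀ᶠ τ in 𝓝[>] s, M.Inside V τ (z - (s - τ) • v)) :
    ∀ᶠ τ in 𝓝[<] s, M.Inside V τ (z - (s - τ) • reflectSide z.2 v) := by
  have hz : ‖z.2‖ = M.R := hhit.1.2.2
  have h_inner : inner ℝ z.2 v.2 < 0 := by
    refine lt_of_le_of_ne ?_ (by rw [real_inner_comm]; exact hhit.2.2)
    refine nonpos_of_mul_nonpos_right (deriv_nonpos_of_neg_right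
      (hasDerivAt_norm_sq_flight s z.2 v.2 M.R) (by simp [hz]) ?_) two_pos
    filter_upwards [h] with τ hτ
    exact sub_neg.2 (pow_lt_pow_left₀ hτ.2 (norm_nonneg _) two_ne_zero)
  have h_front : ∀ᶠ τ in 𝓝[<] s, 0 < z.1 - (s - τ) * v.1 - position V τ :=
    ((hasDerivAt_relative hV hs z.1 s v.1).continuousAt.eventually
      (lt_mem_nhds (by simpa using hhit.2.1))).filter_mono nhdsWithin_le_nhds
  filter_upwards [h_front, eventually_neg_left
    (hasDerivAt_norm_sq_flight s z.2 (reflectSide z.2 v).2 M.R) (by simp [hz])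
    (by rw [inner_reflectSide]; linarith)] with τ hτ hτR
  exact ⟨sub_pos.1 hτ, lt_of_pow_lt_pow_left₀ 2 (hz ▸ norm_nonneg _) (sub_neg.1 hτR)⟩

theorem Model.HitsSide.eventually_outside (hV : ContinuousOn V (Ici 0)) (hs : 0 < s)
    (hhit : M.HitsSide V s z v) (h : ∀ᶠ τ in 𝓝[>] s, M.Outside V τ (z - (s - τ) • v)) :
    ∀ᶠ τ in 𝓝[<] s, M.Outside V τ (z - (s - τ) • reflectSide z.2 v) := by
  have hz : ‖z.2‖ = M.R := hhit.1.2.2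
  have h_front : ∀ᶠ τ in 𝓝[>] s, 0 < z.1 - (s - τ) * v.1 - position V τ :=
    ((hasDerivAt_relative hV hs z.1 s v.1).continuousAt.eventually
      (lt_mem_nhds (by simpa using hhit.2.1))).filter_mono nhdsWithin_le_nhds
  have h_inner : 0 < inner ℝ z.2 v.2 := by
    refine lt_of_le_of_ne ?_ (by rw [real_inner_comm]; exact hhit.2.2.symm)
    refine nonneg_of_mul_nonneg_right (deriv_nonneg_of_pos_right
      (hasDerivAt_norm_sq_flight s z.2 v.2 M.R) (by simp [hz]) ?_) two_pos
    filter_upwards [h, h_front] with τ hτ hτ0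
    exact sub_pos.2 (pow_lt_pow_left₀ (hτ.resolve_left (sub_pos.1 hτ0).not_gt)
      (hz ▸ norm_nonneg _) two_ne_zero)
  filter_upwards [eventually_pos_left (hasDerivAt_norm_sq_flight s z.2 (reflectSide z.2 v).2 M.R)
    (by simp [hz]) (by rw [inner_reflectSide]; linarith)] with τ hτ
  exact Or.inr (lt_of_pow_lt_pow_left₀ 2 (norm_nonneg _) (sub_pos.1 hτ))

theorem Model.History.sq_le_of_inside (hV : ContinuousOn V (Ici 0)) (hpos : ∀ t, 0 ≤ t → 0 < V t)
    (hesc : M.NoEscape V) (H : M.History V t x v v₀) (h : ∀ᶠ τ in 𝓝[<] t, M.Inside V τ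
      (x - (t - τ) • v)) {T : ℝ} (htT : t ≤ T) (hXT : x.1 + (T - t) * v.1 = position V T) :
    v₀.1 ^ 2 ≤ v.1 ^ 2 := by
  induction H generalizing T with
  | free => exact le_rfl
  | base t s x v v₀ hs hst hfree hhit _ ih =>
    have hXs : x.1 - (t - s) * v.1 = position V s := by simpa using hhit.1.1
    have hVv : V s < v.1 :=
      hhit.lt_of_inside hV hs (hesc.eventually_inside hV hs.le le_rfl hst htT hfree hXs hXT h)
    have h_prev : v₀.1 ^ 2 ≤ (reflectBase (V s) v).1 ^ 2 :=
      ih (M.eventually_inside hV hs hhit.1.1 hhit.2.1 (by simp only [reflectBase]; linarith))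
        le_rfl (by simpa using hXs)
    have hVs := hpos s hs.le
    refine h_prev.trans ?_
    simp only [reflectBase]
    nlinarith
  | side t s x v v₀ hs hst hfree hhit hprev ih =>
    rcases hprev.longitudinal with h' | ⟨s', hs', hss', hXs⟩
    · exact (congrArg (· ^ 2) h').le
    simp only [reflectSide, Prod.fst_sub, Prod.smul_fst, smul_eq_mul] at hXs
    have h_in := hesc.eventually_inside hV hs'.le hss'.le hst htT hfree (by linarith) hXT h
    refine ih (hhit.eventually_inside hV hs h_in) (hst.le.trans htT) ?_
    simp only [reflectSide, Prod.fst_sub, Prod.smul_fst, smul_eq_mul]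
    linarith

theorem Model.History.sq_le_of_outside (hV : ContinuousOn V (Ici 0)) (hpos : ∀ t, 0 ≤ t → 0 < V t)
    (hesc : M.NoEscape V) (H : M.History V t x v v₀) (h : ∀ᶠ τ in 𝓝[<] t, M.Outside V τ
      (x - (t - τ) • v)) {T : ℝ} (htT : t ≤ T) (hXT : x.1 + (T - t) * v.1 = position V T) :
    v.1 ^ 2 ≤ v₀.1 ^ 2 := by
  induction H generalizing T with
  | free => exact le_rfl
  | base t s x v v₀ hs hst hfree hhit _ ih =>
    have hXs : x.1 - (t - s) * v.1 = position V s := by simpa using hhit.1.1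
    have hVv : v.1 < V s :=
      hhit.lt_of_outside hV hs (hesc.eventually_outside hV hs.le le_rfl hst htT hfree hXs hXT h)
    have h_behind := eventually_behind hV hs hhit.1.1 (v := reflectBase (V s) v)
      (by simp only [reflectBase]; linarith)
    have h_prev : (reflectBase (V s) v).1 ^ 2 ≤ v₀.1 ^ 2 :=
      ih (h_behind.mono fun _ => Or.inl) le_rfl (by simpa using hXs)
    have hVs := hpos s hs.le
    refine le_trans ?_ h_prev
    simp only [reflectBase]
    nlinarith
  | side t s x v v₀ hs hst hfree hhit hprev ih =>
    rcases hprev.longitudinal with h' | ⟨s', hs', hss', hXs⟩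
    · exact (congrArg (· ^ 2) h').ge
    simp only [reflectSide, Prod.fst_sub, Prod.smul_fst, smul_eq_mul] at hXs
    have h_out := hesc.eventually_outside hV hs'.le hss'.le hst htT hfree (by linarith) hXT h
    refine ih (hhit.eventually_outside hV hs h_out) (hst.le.trans htT) ?_
    simp only [reflectSide, Prod.fst_sub, Prod.smul_fst, smul_eq_mul]
    linarith

end Collisions

/-! ### Particles that remain in the hollow -/

section Sojourn

theorem norm_sq_flight (R τ : ℝ) (x v : Transverse d) :
    ‖v‖ ^ 2 * (‖x - τ • v‖ ^ 2 - R ^ 2) = (inner ℝ x v - τ * ‖v‖ ^ 2) ^ 2 - disc R x v := by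
  rw [norm_sub_sq_real, inner_smul_right, norm_smul, mul_pow, Real.norm_eq_abs, sq_abs, disc]
  ring

theorem disc_sub_smul (R c : ℝ) (x v : Transverse d) : disc R (x - c • v) v = disc R x v := by
  rw [sub_eq_add_neg, ← neg_smul, disc_add_smul]

/-- The time that a particle which moves freely and is at `x` with velocity `v` has spent in the
ball of radius `R`. -/
def sojourn (R : ℝ) (x v : Transverse d) : ℝ := (inner ℝ x v + √(disc R x v)) / ‖v‖ ^ 2

variable {R τ : ℝ} {x v : Transverse d}

theorem sojourn_mul_norm_sq (hv : v ≠ 0) :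
    sojourn R x v * ‖v‖ ^ 2 = inner ℝ x v + √(disc R x v) :=
  div_mul_cancel₀ _ (by positivity)

theorem norm_flight_lt_of_lt_sojourn (hR : 0 ≤ R) (hv : v ≠ 0) (hx : inner ℝ x v ≤ √(disc R x v))
    (hτ : 0 < τ) (hτ' : τ < sojourn R x v) : ‖x - τ • v‖ < R := by
  have hN : 0 < ‖v‖ ^ 2 := by positivity
  have h_lt : (inner ℝ x v - τ * ‖v‖ ^ 2) ^ 2 < disc R x v := by
    rw [sojourn, lt_div_iff₀ hN] at hτ'
    exact Real.sq_lt.2 ⟨by linarith, by linarith [mul_pos hτ hN]⟩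
  have h_neg : ‖v‖ ^ 2 * (‖x - τ • v‖ ^ 2 - R ^ 2) < 0 := by rw [norm_sq_flight]; linarith
  exact lt_of_pow_lt_pow_left₀ 2 hR (sub_neg.1 (neg_of_mul_neg_right h_neg hN.le))

theorem inner_flight_sojourn (hv : v ≠ 0) :
    inner ℝ (x - sojourn R x v • v) v = -√(disc R x v) := by
  rw [inner_sub_left, inner_smul_left, real_inner_self_eq_norm_sq, conj_trivial,
    sojourn_mul_norm_sq hv]
  ring

theorem norm_flight_sojourn (hR : 0 ≤ R) (hv : v ≠ 0) (hD : 0 ≤ disc R x v) :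
    ‖x - sojourn R x v • v‖ = R := by
  have h_zero : ‖v‖ ^ 2 * (‖x - sojourn R x v • v‖ ^ 2 - R ^ 2) = 0 := by
    rw [norm_sq_flight, sojourn_mul_norm_sq hv, sub_add_cancel_left, neg_sq, Real.sq_sqrt hD,
      sub_self]
  have h_sq := (mul_eq_zero.1 h_zero).resolve_left (by positivity)
  exact (sq_eq_sq₀ (norm_nonneg _) hR).1 (sub_eq_zero.1 h_sq)

theorem touches_sojourn (hv : v ≠ 0) : Touches R (sojourn R x v) x v :=
  ⟨-1, by rw [sojourn_mul_norm_sq hv]; push_cast; ring⟩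

end Sojourn

section Hollow

/-- `M.Billiard V a t x v z w`: the particle that arrives at time `t` at the point `x` with
velocity `v` left the point `z` with velocity `w` at time `a`, and its only collisions in between
are finitely many reflections by the barrier. -/
inductive Model.Billiard (M : Model d) (V : ℝ → ℝ) (a : ℝ) :
    ℝ → Vect d → Vect d → Vect d → Vect d → Prop
  | free (t : ℝ) (x v : Vect d) (hat : a < t)
      (hfree : ∀ τ ∈ Ioo a t, x - (t - τ) • v ∉ M.body V τ) :
      M.Billiard V a t x v (x - (t - a) • v) v
  | side (t s : ℝ) (x v z w : Vect d) (has : a < s) (hst : s < t)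
      (hfree : ∀ τ ∈ Ioo s t, x - (t - τ) • v ∉ M.body V τ)
      (hhit : M.HitsSide V s (x - (t - s) • v) v)
      (hprev : M.Billiard V a s (x - (t - s) • v) (reflectSide (x - (t - s) • v).2 v) z w) :
      M.Billiard V a t x v z w

variable {M : Model d} {V : ℝ → ℝ} {a s t : ℝ} {x v z w : Vect d}

namespace Model.Billiard

theorem velocity_fst (H : M.Billiard V a t x v z w) : w.1 = v.1 := by
  induction H with
  | free => rfl
  | side _ _ _ _ _ _ _ _ _ _ _ ih => exact ih

theorem position_fst (H : M.Billiard V a t x v z w) : z.1 = x.1 - (t - a) * v.1 := by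
  induction H with
  | free => rfl
  | side _ _ _ _ _ _ _ _ _ _ _ ih =>
    rw [ih]
    simp only [reflectSide, Prod.fst_sub, Prod.smul_fst, smul_eq_mul]
    ring

theorem norm_transverse (H : M.Billiard V a t x v z w) : ‖w.2‖ = ‖v.2‖ := by
  induction H with
  | free => rfl
  | side _ _ _ _ _ _ _ _ _ _ _ ih => rw [ih, norm_reflectSide]

theorem touches_iff (H : M.Billiard V a t x v z w) (r : ℝ) :
    Touches M.R (a - r) z.2 w.2 ↔ Touches M.R (t - r) x.2 v.2 := by
  have h_flight (t s : ℝ) (x v : Vect d) :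
      Touches M.R (s - r) (x - (t - s) • v).2 v.2 ↔ Touches M.R (t - r) x.2 v.2 := by
    simpa using touches_flight M.R (t - r) (s - r) x.2 v.2
  induction H with
  | free t x v => exact h_flight t a x v
  | side t s x v _ _ _ _ _ hhit _ ih =>
    exact ih.trans ((touches_reflectSide_iff hhit.1.2.2).trans (h_flight t s x v))

theorem history (H : M.Billiard V 0 t x v z w) : M.History V t x v w := by
  induction H with
  | free t x v ht hfree => exact .free t x v ht.le hfree
  | side t s x v _ w hs hst hfree hhit _ ih => exact .side t s x v w hs hst hfree hhit ih

theorem history_of_hitsBase (H : M.Billiard V a t x v z w) (ha : 0 < a)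
    (hhit : M.HitsBase V a z w) {v₀ : Vect d} (hprev : M.History V a z (reflectBase (V a) w) v₀) :
    M.History V t x v v₀ := by
  induction H with
  | free t x v hat hfree => exact .base t a x v v₀ ha hat hfree hhit hprev
  | side t s x v _ _ has hst hfree hside _ ih =>
    exact .side t s x v v₀ (ha.trans has) hst hfree hside (ih hhit hprev)

end Model.Billiard

/-- The particle that arrives at time `t` at abscissa `x` with longitudinal velocity `u` was at the
height of the barrier during `(a, t)`, had it not met the base. -/
def Model.Alongside (M : Model d) (V : ℝ → ℝ) (a t x u : ℝ) : Prop :=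
  ∀ τ ∈ Ioo a t, 0 < x - (t - τ) * u - position V τ ∧ x - (t - τ) * u - position V τ < M.h

theorem Model.exists_billiard_of_lt_sojourn (hR : 0 ≤ M.R) (hat : a < t) (hv : v.2 ≠ 0)
    (hx : inner ℝ x.2 v.2 ≤ √(disc M.R x.2 v.2)) (hexit : t - a < sojourn M.R x.2 v.2)
    (halong : M.Alongside V a t x.1 v.1) : ∃ z w, M.Billiard V a t x v z w ∧ ‖z.2‖ < M.R := by
  have h_lt (τ : ℝ) (haτ : a ≤ τ) (hτt : τ < t) : ‖(x - (t - τ) • v).2‖ < M.R :=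
    norm_flight_lt_of_lt_sojourn hR hv hx (by linarith) (by linarith)
  exact ⟨_, _, .free t x v hat fun τ hτ => notMem_body_of_norm_lt
    (sub_ne_zero.1 (halong τ hτ).1.ne') (h_lt τ hτ.1.le hτ.2), h_lt a le_rfl hat⟩

theorem Model.Billiard.reflect (hR : 0 ≤ M.R) (hv : v.2 ≠ 0) (hD : 0 < disc M.R x.2 v.2)
    (hx : inner ℝ x.2 v.2 ≤ √(disc M.R x.2 v.2)) (hst : s < t)
    (hs : t - s = sojourn M.R x.2 v.2) (has : a < s) (halong : M.Alongside V a t x.1 v.1)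
    (H : M.Billiard V a s (x - (t - s) • v) (reflectSide (x - (t - s) • v).2 v) z w) :
    M.Billiard V a t x v z w := by
  have h_norm : ‖(x - (t - s) • v).2‖ = M.R := by
    rw [hs]; exact norm_flight_sojourn hR hv hD.le
  have h_inner : inner ℝ (x - (t - s) • v).2 v.2 = -√(disc M.R x.2 v.2) := by
    rw [hs]; exact inner_flight_sojourn hv
  obtain ⟨h_low, h_high⟩ := halong s ⟨has, hst⟩
  refine .side t s x v z w has hst (fun τ hτ => ?_) ⟨⟨h_low.le, h_high.le, h_norm⟩, h_low, ?_⟩ H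
  · exact notMem_body_of_norm_lt (sub_ne_zero.1 (halong τ ⟨has.trans hτ.1, hτ.2⟩).1.ne')
      (norm_flight_lt_of_lt_sojourn hR hv hx (by linarith [hτ.2]) (by linarith [hτ.1]))
  · rw [real_inner_comm, h_inner]
    exact (neg_lt_zero.2 (Real.sqrt_pos.2 hD)).ne

-- Between two collisions the particle flies for the time `2√D / ‖v_⊥‖²`, where `D` is its `disc`,
-- which the collisions preserve; hence there are at most `n` of them.
theorem Model.exists_billiard_of_lt (hR : 0 ≤ M.R) (n : ℕ) (hat : a < t) (hv : v.2 ≠ 0)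
    (hD : 0 < disc M.R x.2 v.2) (hx : inner ℝ x.2 v.2 ≤ √(disc M.R x.2 v.2))
    (hx' : -√(disc M.R x.2 v.2) < inner ℝ x.2 v.2)
    (hn : t - a < sojourn M.R x.2 v.2 + n * (2 * √(disc M.R x.2 v.2) / ‖v.2‖ ^ 2))
    (htouch : ¬ Touches M.R (t - a) x.2 v.2) (halong : M.Alongside V a t x.1 v.1) :
    ∃ z w, M.Billiard V a t x v z w ∧ ‖z.2‖ < M.R := by
  induction n generalizing t x v with
  | zero => exact exists_billiard_of_lt_sojourn hR hat hv hx (by simpa using hn) halong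
  | succ n ih =>
    rcases lt_or_ge (t - a) (sojourn M.R x.2 v.2) with hexit | hexit
    · exact exists_billiard_of_lt_sojourn hR hat hv hx hexit halong
    obtain ⟨s, hs⟩ : ∃ s, t - s = sojourn M.R x.2 v.2 := ⟨t - sojourn M.R x.2 v.2, by ring⟩
    have hst : s < t := sub_pos.1 (hs ▸ div_pos (by linarith) (by positivity))
    have has : a < s := lt_of_le_of_ne (by linarith) fun h =>
      htouch (by rw [h, hs]; exact touches_sojourn hv)
    set z := x - (t - s) • v with hz
    have hzR : ‖z.2‖ = M.R := by rw [hz, hs]; exact norm_flight_sojourn hR hv hD.le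
    have h_disc : disc M.R z.2 (reflectSide z.2 v).2 = disc M.R x.2 v.2 := by
      rw [disc_reflectSide]; exact disc_sub_smul _ _ _ _
    have h_inner : inner ℝ z.2 (reflectSide z.2 v).2 = √(disc M.R x.2 v.2) := by
      rw [inner_reflectSide, hz, hs, neg_eq_iff_eq_neg]; exact inner_flight_sojourn hv
    have h_sojourn : sojourn M.R z.2 (reflectSide z.2 v).2 =
        2 * √(disc M.R x.2 v.2) / ‖v.2‖ ^ 2 := by
      rw [sojourn, h_disc, h_inner, norm_reflectSide, two_mul]
    have h_touches : ¬ Touches M.R (s - a) z.2 (reflectSide z.2 v).2 := by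
      rw [touches_reflectSide_iff hzR]
      simpa [hz] using (touches_flight M.R (t - a) (s - a) x.2 v.2).not.2 htouch
    have h_along : M.Alongside V a s z.1 (reflectSide z.2 v).1 := fun τ hτ => by
      convert halong τ ⟨hτ.1, hτ.2.trans hst⟩ using 2 <;> simp [hz, reflectSide] <;> ring
    obtain ⟨y, w, H, hy⟩ := ih has (by rwa [← norm_ne_zero_iff, norm_reflectSide, norm_ne_zero_iff])
      (by rwa [h_disc]) (by rw [h_disc, h_inner])
      (by rw [h_disc, h_inner]; linarith [Real.sqrt_pos.2 hD])
      (by rw [h_sojourn, h_disc, norm_reflectSide]; push_cast at hn; linarith) h_touches h_along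
    exact ⟨y, w, H.reflect hR hv hD hx hst hs has halong, hy⟩

theorem Model.exists_billiard (hat : a < t) (hx : ‖x.2‖ < M.R) (hv : v.2 ≠ 0)
    (htouch : ¬ Touches M.R (t - a) x.2 v.2) (halong : M.Alongside V a t x.1 v.1) :
    ∃ z w, M.Billiard V a t x v z w ∧ ‖z.2‖ < M.R := by
  have h_lt : inner ℝ x.2 v.2 ^ 2 < disc M.R x.2 v.2 :=
    lt_add_of_pos_right _ (mul_pos (by positivity) (by nlinarith [norm_nonneg x.2]))
  have hD : 0 < disc M.R x.2 v.2 := (sq_nonneg _).trans_lt h_lt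
  obtain ⟨hx₁, hx₂⟩ := abs_lt.1 (Real.lt_sqrt_of_sq_lt ((sq_abs _).trans_lt h_lt))
  have h_chord : 0 < 2 * √(disc M.R x.2 v.2) / ‖v.2‖ ^ 2 := by
    have := Real.sqrt_pos.2 hD
    positivity
  obtain ⟨n, hn⟩ := exists_nat_gt ((t - a) / (2 * √(disc M.R x.2 v.2) / ‖v.2‖ ^ 2))
  rw [div_lt_iff₀ h_chord] at hn
  have h_sojourn : 0 < sojourn M.R x.2 v.2 := div_pos (by linarith) (by positivity)
  exact exists_billiard_of_lt ((norm_nonneg _).trans hx.le) n hat hv hD hx₂.le hx₁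
    (by linarith) htouch halong

/-- A particle in the hollow that arrives at the base at time `t` with longitudinal velocity `u` hit
the base once before, at time `s`, and never left the hollow since time `0`. -/
structure Model.Recollides (M : Model d) (V : ℝ → ℝ) (t u s : ℝ) : Prop where
  pos : 0 < s
  lt : s < t
  position_sub : position V t - (t - s) * u = position V s
  ne : u ≠ V s
  alongside : M.Alongside V s t (position V t) u
  alongside_before : M.Alongside V 0 s (position V s) (2 * V s - u)

theorem Model.Recollides.exists_history {x : Transverse d} (h : M.Recollides V t v.1 s)
    (hx : ‖x‖ < M.R) (hv : v.2 ≠ 0) (htouch : ¬ Touches M.R (t - s) x v.2)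
    (htouch₀ : ¬ Touches M.R t x v.2) :
    ∃ v₀, M.History V t (position V t, x) v v₀ ∧ v₀.1 = 2 * V s - v.1 := by
  obtain ⟨z, w, H, hz⟩ := M.exists_billiard (x := (position V t, x)) h.lt hx hv htouch h.alongside
  have hz₁ : z.1 = position V s := H.position_fst.trans h.position_sub
  have hw₁ : w.1 = v.1 := H.velocity_fst
  have hw : w.2 ≠ 0 := by rwa [← norm_ne_zero_iff, H.norm_transverse, norm_ne_zero_iff]
  have hz_touches : ¬ Touches M.R (s - 0) z.2 (reflectBase (V s) w).2 := by
    rw [reflectBase, H.touches_iff, sub_zero]; exact htouch₀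
  obtain ⟨_, v₀, H₀, -⟩ := M.exists_billiard (v := reflectBase (V s) w) h.pos hz hw hz_touches
    (by simpa only [reflectBase, hz₁, hw₁] using h.alongside_before)
  refine ⟨v₀, H.history_of_hitsBase h.pos ⟨⟨hz₁, hz.le⟩, hz, hw₁ ▸ h.ne⟩ H₀.history, ?_⟩
  rw [H₀.velocity_fst, reflectBase, hw₁]

end Hollow

/-! ### The force -/

section Slab

/-- Pairs `(x_⊥, v)` with `|x_⊥| ≤ R` and `v_x ∈ S`. -/
def slab (R : ℝ) (S : Set ℝ) : Set (Transverse d × Vect d) := Metric.closedBall 0 R ×ˢ (S ×ˢ univ)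

variable {R β : ℝ} {S : Set ℝ}

theorem mem_slab {p : Transverse d × Vect d} : p ∈ slab R S ↔ ‖p.1‖ ≤ R ∧ p.2.1 ∈ S := by
  simp [slab]

theorem measurableSet_slab (hS : MeasurableSet S) :
    MeasurableSet (slab R S : Set (Transverse d × Vect d)) :=
  measurableSet_closedBall.prod (hS.prod .univ)

theorem setIntegral_slab (R β : ℝ) (S : Set ℝ) (g : ℝ → ℝ) :
    ∫ p : Transverse d × Vect d in slab R S, g p.2.1 * Real.exp (-β * ‖p.2.2‖ ^ 2) =
      volume.real (Metric.closedBall (0 : Transverse d) R) *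
        ((∫ u in S, g u) * ∫ w : Transverse d, Real.exp (-β * ‖w‖ ^ 2)) := by
  have h_velocity : ∫ q : Vect d in S ×ˢ univ, g q.1 * Real.exp (-β * ‖q.2‖ ^ 2) =
      (∫ u in S, g u) * ∫ w : Transverse d, Real.exp (-β * ‖w‖ ^ 2) := by
    rw [← setIntegral_univ (μ := (volume : Measure (Transverse d)))]
    exact setIntegral_prod_mul g (fun w : Transverse d => Real.exp (-β * ‖w‖ ^ 2)) S univ
  have h_prod := setIntegral_prod_mul (μ := (volume : Measure (Transverse d)))
    (ν := (volume : Measure (Vect d))) (fun _ => (1 : ℝ))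
    (fun q : Vect d => g q.1 * Real.exp (-β * ‖q.2‖ ^ 2)) (Metric.closedBall 0 R) (S ×ˢ univ)
  simp only [one_mul, setIntegral_const, smul_eq_mul, mul_one, h_velocity] at h_prod
  exact h_prod

theorem integrableOn_slab (hβ : 0 < β) {g : ℝ → ℝ} (hg : IntegrableOn g S) :
    IntegrableOn (fun p : Transverse d × Vect d => g p.2.1 * Real.exp (-β * ‖p.2.2‖ ^ 2))
      (slab R S) := by
  have h_velocity : Integrable (fun q : Vect d => g q.1 * Real.exp (-β * ‖q.2‖ ^ 2))
      ((volume.restrict S).prod (volume.restrict univ)) := by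
    rw [Measure.restrict_univ]
    exact hg.mul_prod (integrable_gaussian_norm hβ)
  have h_one : IntegrableOn (fun _ : Transverse d => (1 : ℝ)) (Metric.closedBall 0 R) :=
    integrableOn_const measure_closedBall_lt_top.ne
  rw [Measure.prod_restrict] at h_velocity
  have h_prod := h_one.mul_prod h_velocity
  rw [Measure.prod_restrict] at h_prod
  simp only [one_mul] at h_prod
  exact h_prod

theorem abs_setIntegral_slab_le (hβ : 0 < β) (hS : MeasurableSet S) {g : ℝ → ℝ}
    (hg : Integrable g) (hg₀ : ∀ u, 0 ≤ g u) {F : Transverse d × Vect d → ℝ}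
    (hF : ∀ᵐ p, ‖p.1‖ ≤ R → |F p| ≤ g p.2.1 * Real.exp (-β * ‖p.2.2‖ ^ 2)) :
    |∫ p in slab R S, F p| ≤ volume.real (Metric.closedBall (0 : Transverse d) R) *
      ((∫ u, g u) * ∫ w : Transverse d, Real.exp (-β * ‖w‖ ^ 2)) := by
  refine (norm_integral_le_of_norm_le (f := F) (integrableOn_slab hβ hg.integrableOn)
    ((ae_restrict_iff' (measurableSet_slab hS)).2
      (hF.mono fun p hp h => hp (mem_slab.1 h).1))).trans ?_
  rw [setIntegral_slab]
  have _h_gaussian : 0 ≤ ∫ w : Transverse d, Real.exp (-β * ‖w‖ ^ 2) :=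
    integral_nonneg fun w => (Real.exp_pos _).le
  have h_restrict : ∫ u in S, g u ≤ ∫ u, g u := setIntegral_le_integral hg (ae_of_all _ hg₀)
  gcongr

end Slab

section Equilibrium

variable {M : Model d} {W : ℝ} {v w : Vect d}

/-- The normalization of the Maxwell–Boltzmann density. -/
def Model.amplitude (M : Model d) : ℝ := M.ρ * (M.β / Real.pi) ^ ((d : ℝ) / 2)

theorem Model.amplitude_nonneg (hρ : 0 ≤ M.ρ) (hβ : 0 ≤ M.β) : 0 ≤ M.amplitude := by
  unfold Model.amplitude; positivity

theorem Model.f₀_eq (M : Model d) (v : Vect d) :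
    M.f₀ v = M.amplitude * (Real.exp (-M.β * v.1 ^ 2) * Real.exp (-M.β * ‖v.2‖ ^ 2)) := by
  rw [Model.f₀, Model.amplitude, ← Real.exp_add, mul_add]

theorem Model.f₀_le_f₀ (hρ : 0 ≤ M.ρ) (hβ : 0 ≤ M.β) (h : w.1 ^ 2 ≤ v.1 ^ 2)
    (h' : ‖w.2‖ = ‖v.2‖) : M.f₀ v ≤ M.f₀ w := by
  have h_amp := M.amplitude_nonneg hρ hβ
  have h_exp : -M.β * v.1 ^ 2 ≤ -M.β * w.1 ^ 2 := by nlinarith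
  rw [M.f₀_eq, M.f₀_eq, h']
  gcongr

theorem Model.abs_f₀_sub_le (hρ : 0 ≤ M.ρ) (hβ : 0 ≤ M.β) (h : ‖w.2‖ = ‖v.2‖) :
    |M.f₀ w - M.f₀ v| ≤ M.amplitude * Real.exp (-M.β * ‖v.2‖ ^ 2) := by
  have h_amp := M.amplitude_nonneg hρ hβ
  have h_mem (u : Vect d) : M.f₀ u ∈ Icc 0 (M.amplitude * Real.exp (-M.β * ‖u.2‖ ^ 2)) := by
    have h_exp : Real.exp (-M.β * u.1 ^ 2) ≤ 1 :=
      Real.exp_le_one_iff.2 (by nlinarith [sq_nonneg u.1])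
    rw [M.f₀_eq]
    exact ⟨by positivity,
      mul_le_mul_of_nonneg_left (mul_le_of_le_one_left (Real.exp_pos _).le h_exp) h_amp⟩
  simpa only [sub_zero] using abs_sub_le_of_le_of_le (h_mem w).1 (h ▸ (h_mem w).2) (h_mem v).1
    (h_mem v).2

theorem exp_neg_mul_sub_ge {β κ B a b : ℝ} (hβ : 0 ≤ β) (hκ : 0 ≤ κ) (hab : κ ≤ a - b)
    (ha : a ≤ B) : β * κ * Real.exp (-β * B) ≤ Real.exp (-β * b) - Real.exp (-β * a) := by
  have h_tangent : β * κ ≤ Real.exp (β * (a - b)) - 1 := by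
    have : β * κ ≤ β * (a - b) := by gcongr
    linarith [Real.add_one_le_exp (β * (a - b))]
  have h_exp : Real.exp (-β * B) ≤ Real.exp (-β * a) := Real.exp_le_exp.2 (by nlinarith)
  calc β * κ * Real.exp (-β * B)
      ≤ (Real.exp (β * (a - b)) - 1) * Real.exp (-β * a) :=
        mul_le_mul h_tangent h_exp (Real.exp_pos _).le (le_trans (by positivity) h_tangent)
    _ = Real.exp (-β * b) - Real.exp (-β * a) := by
        rw [sub_mul, one_mul, ← Real.exp_add]; ring_nf

theorem Model.le_f₀_sub (hρ : 0 ≤ M.ρ) (hβ : 0 ≤ M.β) {κ B : ℝ} (hκ : 0 ≤ κ)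
    (h : κ ≤ v.1 ^ 2 - w.1 ^ 2) (hv : v.1 ^ 2 ≤ B) (h' : ‖w.2‖ = ‖v.2‖) :
    M.amplitude * (M.β * κ * Real.exp (-M.β * B)) * Real.exp (-M.β * ‖v.2‖ ^ 2) ≤
      M.f₀ w - M.f₀ v := by
  have h_amp := M.amplitude_nonneg hρ hβ
  rw [M.f₀_eq, M.f₀_eq, h', ← mul_sub, ← sub_mul, mul_assoc]
  gcongr
  exact exp_neg_mul_sub_ge hβ hκ h hv

theorem Model.A_eq (M : Model d) : M.A = 2 * (M.amplitude *
    (volume.real (Metric.closedBall (0 : Transverse d) M.R) *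
      ∫ w : Transverse d, Real.exp (-M.β * ‖w‖ ^ 2))) := by
  rw [Model.A, Model.amplitude]; ring

theorem Model.front_eq_slab (M : Model d) (W : ℝ) : M.front W = slab M.R (Iio W) := by
  ext p; simp [Model.front, mem_slab]

theorem Model.back_eq_slab (M : Model d) (W : ℝ) : M.back W = slab M.R (Ioi W) := by
  ext p; simp [Model.back, mem_slab]

theorem Model.equilibrium_pressure_eq (M : Model d) (W : ℝ) (p : Transverse d × Vect d) :
    (p.2.1 - W) ^ 2 * M.f₀ p.2 = M.amplitude * ((p.2.1 - W) ^ 2 * Real.exp (-M.β * p.2.1 ^ 2) *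
      Real.exp (-M.β * ‖p.2.2‖ ^ 2)) := by
  rw [M.f₀_eq]; ring

theorem Model.integrableOn_equilibrium_pressure (hβ : 0 < M.β) (W : ℝ) (S : Set ℝ) :
    IntegrableOn (fun p : Transverse d × Vect d => (p.2.1 - W) ^ 2 * M.f₀ p.2) (slab M.R S) := by
  simp only [M.equilibrium_pressure_eq]
  exact (integrableOn_slab hβ (integrable_sub_sq_mul_gaussian hβ W).integrableOn).const_mul _

theorem Model.F₀_eq_integral (M : Model d) (W : ℝ) :
    M.F₀ W = 2 * (∫ p in slab M.R (Iio W), (p.2.1 - W) ^ 2 * M.f₀ p.2) -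
      2 * ∫ p in slab M.R (Ioi W), (p.2.1 - W) ^ 2 * M.f₀ p.2 := by
  simp only [M.equilibrium_pressure_eq, integral_const_mul]
  rw [setIntegral_slab _ _ _ fun u => (u - W) ^ 2 * Real.exp (-M.β * u ^ 2),
    setIntegral_slab _ _ _ fun u => (u - W) ^ 2 * Real.exp (-M.β * u ^ 2), Model.F₀,
    integral_Ici_eq_integral_Ioi, M.A_eq]
  ring

end Equilibrium

section Excess

variable {M : Model d} {V : ℝ → ℝ} {f : ℝ → Vect d → Vect d → ℝ} {t : ℝ}

/-- The contribution of a particle to the difference between the force and the friction without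
recollisions. -/
def Model.excess (M : Model d) (V : ℝ → ℝ) (f : ℝ → Vect d → Vect d → ℝ) (t : ℝ)
    (p : Transverse d × Vect d) : ℝ :=
  (p.2.1 - V t) ^ 2 * (traceBefore f t (position V t, p.1) p.2 - M.f₀ p.2)

theorem Model.excess_eq (M : Model d) (V : ℝ → ℝ) (f : ℝ → Vect d → Vect d → ℝ) (t : ℝ) :
    M.excess V f t = fun p => pressure V f t p - (p.2.1 - V t) ^ 2 * M.f₀ p.2 := by
  ext p; rw [Model.excess, pressure, mul_sub]

/-- The force at time `t` is absolutely convergent, and determined by the backward evolution of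
almost every particle. -/
structure Model.GoodTime (M : Model d) (V : ℝ → ℝ) (f : ℝ → Vect d → Vect d → ℝ) (t : ℝ) :
    Prop where
  integrableOn_front : IntegrableOn (pressure V f t) (slab M.R (Iio (V t)))
  integrableOn_back : IntegrableOn (pressure V f t) (slab M.R (Ioi (V t)))
  ae_trace : ∀ᵐ p : Transverse d × Vect d, ‖p.1‖ ≤ M.R → ‖p.1‖ < M.R ∧
    (¬ M.Regular V t (position V t, p.1) p.2 →
      traceBefore f t (position V t, p.1) p.2 = M.f₀ p.2) ∧
    ∀ v₀, M.History V t (position V t, p.1) p.2 v₀ →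
      traceBefore f t (position V t, p.1) p.2 = M.f₀ v₀

theorem Model.IsSolution.ae_goodTime (hd : 2 ≤ d) (hR : M.R ≠ 0) {V₀ : ℝ}
    (hV : ContinuousOn V (Ici 0)) (hs : M.IsSolution V₀ V f) :
    ∀ᵐ t : ℝ, 0 < t → M.GoodTime V f t := by
  have h_int := (ae_restrict_iff' measurableSet_Ioi).1 hs.integrable
  simp only [M.front_eq_slab, M.back_eq_slab] at h_int
  filter_upwards [h_int, hs.gas.ae_trace hd hR hV] with t h h' ht
  exact ⟨(h ht).1, (h ht).2, h' ht⟩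

namespace Model.GoodTime

theorem integrableOn_excess (ht : M.GoodTime V f t) (hβ : 0 < M.β) :
    IntegrableOn (M.excess V f t) (slab M.R (Iio (V t))) ∧
      IntegrableOn (M.excess V f t) (slab M.R (Ioi (V t))) := by
  rw [M.excess_eq]
  exact ⟨ht.integrableOn_front.sub (M.integrableOn_equilibrium_pressure hβ _ _),
    ht.integrableOn_back.sub (M.integrableOn_equilibrium_pressure hβ _ _)⟩

theorem force_sub_F₀ (ht : M.GoodTime V f t) (hβ : 0 < M.β) :
    M.force V f t - M.F₀ (V t) = 2 * (∫ p in slab M.R (Iio (V t)), M.excess V f t p) -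
      2 * ∫ p in slab M.R (Ioi (V t)), M.excess V f t p := by
  rw [M.excess_eq, integral_sub ht.integrableOn_front (M.integrableOn_equilibrium_pressure hβ _ _),
    integral_sub ht.integrableOn_back (M.integrableOn_equilibrium_pressure hβ _ _), Model.force,
    M.F₀_eq_integral, M.front_eq_slab, M.back_eq_slab]
  ring

theorem ae_excess (ht : M.GoodTime V f t) : ∀ᵐ p : Transverse d × Vect d, ‖p.1‖ ≤ M.R →
    ‖p.1‖ < M.R ∧ (M.excess V f t p = 0 ∨ ∃ v₀, M.History V t (position V t, p.1) p.2 v₀ ∧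
      M.excess V f t p = (p.2.1 - V t) ^ 2 * (M.f₀ v₀ - M.f₀ p.2)) := by
  filter_upwards [ht.ae_trace] with p hp hpR
  obtain ⟨h_lt, h_irregular, h_history⟩ := hp hpR
  refine ⟨h_lt, ?_⟩
  by_cases h : M.Regular V t (position V t, p.1) p.2
  · obtain ⟨v₀, H⟩ := h
    exact .inr ⟨v₀, H, by rw [Model.excess, h_history v₀ H]⟩
  · exact .inl (by rw [Model.excess, h_irregular h, sub_self, mul_zero])

theorem ae_abs_excess_le (ht : M.GoodTime V f t) (hρ : 0 ≤ M.ρ) (hβ : 0 ≤ M.β) {δ : ℝ}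
    (hmean : ∀ s u, 0 < s → s < t → position V t - position V s = u * (t - s) → |u - V t| ≤ δ) :
    ∀ᵐ p : Transverse d × Vect d, ‖p.1‖ ≤ M.R → |M.excess V f t p| ≤
      (Icc (V t - δ) (V t + δ)).indicator (fun _ => M.amplitude * δ ^ 2) p.2.1 *
        Real.exp (-M.β * ‖p.2.2‖ ^ 2) := by
  have h_amp := M.amplitude_nonneg hρ hβ
  filter_upwards [ht.ae_excess] with p hp hpR
  have h_zero : |(0 : ℝ)| ≤ (Icc (V t - δ) (V t + δ)).indicator
      (fun _ => M.amplitude * δ ^ 2) p.2.1 * Real.exp (-M.β * ‖p.2.2‖ ^ 2) := by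
    rw [abs_zero]
    exact mul_nonneg (indicator_nonneg (fun _ _ => by positivity) _) (Real.exp_pos _).le
  obtain ⟨-, h | ⟨v₀, H, h⟩⟩ := hp hpR
  · rwa [h]
  rw [h]
  rcases H.longitudinal with h_eq | ⟨s, hs, hst, hX⟩
  · rwa [M.f₀_eq v₀, M.f₀_eq p.2, h_eq, H.norm_transverse, sub_self, mul_zero]
  have hu : |p.2.1 - V t| ≤ δ := hmean s p.2.1 hs hst (by simp only at hX; linarith)
  have h_mem : p.2.1 ∈ Icc (V t - δ) (V t + δ) :=
    ⟨by linarith [(abs_le.1 hu).1], by linarith [(abs_le.1 hu).2]⟩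
  rw [indicator_of_mem h_mem, abs_mul, abs_sq, ← sq_abs]
  calc |p.2.1 - V t| ^ 2 * |M.f₀ v₀ - M.f₀ p.2|
      ≤ δ ^ 2 * (M.amplitude * Real.exp (-M.β * ‖p.2.2‖ ^ 2)) := by
        gcongr
        exact M.abs_f₀_sub_le hρ hβ H.norm_transverse
    _ = M.amplitude * δ ^ 2 * Real.exp (-M.β * ‖p.2.2‖ ^ 2) := by ring

theorem abs_force_sub_le (ht : M.GoodTime V f t) (hρ : 0 ≤ M.ρ) (hβ : 0 < M.β) {δ : ℝ}
    (hδ : 0 ≤ δ)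
    (hmean : ∀ s u, 0 < s → s < t → position V t - position V s = u * (t - s) → |u - V t| ≤ δ) :
    |M.force V f t - M.F₀ (V t)| ≤ 4 * M.A * δ ^ 3 := by
  have h_amp := M.amplitude_nonneg hρ hβ.le
  have h_integrable : Integrable
      ((Icc (V t - δ) (V t + δ)).indicator fun _ => M.amplitude * δ ^ 2) :=
    (integrable_indicator_iff measurableSet_Icc).2 (integrableOn_const measure_Icc_lt_top.ne)
  have h_integral : ∫ u, (Icc (V t - δ) (V t + δ)).indicator (fun _ => M.amplitude * δ ^ 2) u =
      2 * M.amplitude * δ ^ 3 := by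
    rw [integral_indicator measurableSet_Icc, setIntegral_const, Real.volume_real_Icc,
      smul_eq_mul, max_eq_left (by linarith)]
    ring
  have h_slab (S : Set ℝ) (hS : MeasurableSet S) :
      |∫ p in slab M.R S, M.excess V f t p| ≤ M.A * δ ^ 3 := by
    refine (abs_setIntegral_slab_le hβ hS h_integrable
      (fun u => indicator_nonneg (fun _ _ => by positivity) u)
      (ht.ae_abs_excess_le hρ hβ.le hmean)).trans_eq ?_
    rw [h_integral, M.A_eq]
    ring
  rw [ht.force_sub_F₀ hβ]
  have h_front := abs_le.1 (h_slab (Iio (V t)) measurableSet_Iio)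
  have h_back := abs_le.1 (h_slab (Ioi (V t)) measurableSet_Ioi)
  exact abs_le.2 ⟨by linarith [h_front.1, h_back.2], by linarith [h_front.2, h_back.1]⟩

theorem ae_excess_sign (ht : M.GoodTime V f t) (ht₀ : 0 < t) (hρ : 0 ≤ M.ρ) (hβ : 0 ≤ M.β)
    (hV : ContinuousOn V (Ici 0)) (hpos : ∀ t, 0 ≤ t → 0 < V t) (hesc : M.NoEscape V) :
    ∀ᵐ p : Transverse d × Vect d, (p ∈ slab M.R (Iio (V t)) → 0 ≤ M.excess V f t p) ∧
      (p ∈ slab M.R (Ioi (V t)) → M.excess V f t p ≤ 0) := by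
  filter_upwards [ht.ae_excess] with p hp
  simp only [mem_slab]
  refine ⟨fun ⟨hpR, hpV⟩ => ?_, fun ⟨hpR, hpV⟩ => ?_⟩ <;>
    obtain ⟨h_lt, h | ⟨v₀, H, h⟩⟩ := hp hpR <;> rw [h]
  · have h_sq := H.sq_le_of_inside hV hpos hesc (M.eventually_inside hV ht₀ rfl h_lt hpV) le_rfl
      (by simp)
    exact mul_nonneg (sq_nonneg _) (sub_nonneg.2 (M.f₀_le_f₀ hρ hβ h_sq H.norm_transverse))
  · have h_sq := H.sq_le_of_outside hV hpos hesc
      ((eventually_behind hV ht₀ rfl hpV).mono fun _ => .inl) le_rfl (by simp)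
    exact mul_nonpos_of_nonneg_of_nonpos (sq_nonneg _)
      (sub_nonpos.2 (M.f₀_le_f₀ hρ hβ h_sq H.norm_transverse.symm))

theorem two_mul_setIntegral_excess_le (ht : M.GoodTime V f t) (ht₀ : 0 < t) (hρ : 0 ≤ M.ρ)
    (hβ : 0 < M.β) (hV : ContinuousOn V (Ici 0)) (hpos : ∀ t, 0 ≤ t → 0 < V t)
    (hesc : M.NoEscape V) {G : Set (Transverse d × Vect d)} (hG : G ⊆ slab M.R (Iio (V t))) :
    2 * ∫ p in G, M.excess V f t p ≤ M.force V f t - M.F₀ (V t) := by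
  have h_sign := ht.ae_excess_sign ht₀ hρ hβ.le hV hpos hesc
  have h_front : ∫ p in G, M.excess V f t p ≤ ∫ p in slab M.R (Iio (V t)), M.excess V f t p :=
    setIntegral_mono_set (ht.integrableOn_excess hβ).1
      ((ae_restrict_iff' (measurableSet_slab measurableSet_Iio)).2 (h_sign.mono fun _ hp => hp.1))
      (Eventually.of_forall hG)
  have h_back : ∫ p in slab M.R (Ioi (V t)), M.excess V f t p ≤ 0 :=
    integral_nonpos_of_ae
      ((ae_restrict_iff' (measurableSet_slab measurableSet_Ioi)).2 (h_sign.mono fun _ hp => hp.2))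
  rw [ht.force_sub_F₀ hβ]
  linarith

theorem force_sub_nonneg (ht : M.GoodTime V f t) (ht₀ : 0 < t) (hρ : 0 ≤ M.ρ) (hβ : 0 < M.β)
    (hV : ContinuousOn V (Ici 0)) (hpos : ∀ t, 0 ≤ t → 0 < V t) (hesc : M.NoEscape V) :
    0 ≤ M.force V f t - M.F₀ (V t) := by
  simpa using ht.two_mul_setIntegral_excess_le ht₀ hρ hβ hV hpos hesc (empty_subset _)

theorem ae_le_excess_of_recollides (ht : M.GoodTime V f t) (hd : 2 ≤ d) (hρ : 0 ≤ M.ρ)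
    (hβ : 0 ≤ M.β) (hV : ContinuousOn V (Ici 0)) {a κ B : ℝ} {S : Set ℝ} (ha : 0 ≤ a) (hκ : 0 ≤ κ)
    (hrec : ∀ u ∈ S, a ≤ V t - u ∧ u ^ 2 ≤ B ∧
      ∃ s, M.Recollides V t u s ∧ κ ≤ u ^ 2 - (2 * V s - u) ^ 2) :
    ∀ᵐ p : Transverse d × Vect d, p ∈ slab M.R S →
      M.amplitude * (a ^ 2 * (M.β * κ * Real.exp (-M.β * B))) * Real.exp (-M.β * ‖p.2.2‖ ^ 2) ≤
        M.excess V f t p := by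
  have h_amp := M.amplitude_nonneg hρ hβ
  filter_upwards [ht.ae_trace, ae_not_touches hd M.R t, ae_transverse_ne_zero hd,
    ae_not_edge hV hd M.R t] with p hp h_touches h_ne h_edge hpS
  rw [mem_slab] at hpS
  obtain ⟨h_lt, -, h_history⟩ := hp hpS.1
  obtain ⟨hau, huB, s, hrec, hκs⟩ := hrec _ hpS.2
  obtain ⟨v₀, H, hv₀⟩ := hrec.exists_history h_lt h_ne
    (h_edge s hrec.pos.le hrec.lt (by linarith [hrec.position_sub])) h_touches
  have h_f₀ := M.le_f₀_sub hρ hβ hκ (by rwa [hv₀]) huB H.norm_transverse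
  have h_sq : a ^ 2 ≤ (p.2.1 - V t) ^ 2 := by nlinarith
  rw [Model.excess, h_history v₀ H]
  calc M.amplitude * (a ^ 2 * (M.β * κ * Real.exp (-M.β * B))) * Real.exp (-M.β * ‖p.2.2‖ ^ 2)
      = a ^ 2 * (M.amplitude * (M.β * κ * Real.exp (-M.β * B)) *
          Real.exp (-M.β * ‖p.2.2‖ ^ 2)) := by ring
    _ ≤ (p.2.1 - V t) ^ 2 * (M.f₀ v₀ - M.f₀ p.2) :=
        mul_le_mul h_sq h_f₀ (by positivity) (sq_nonneg _)

theorem le_force_sub_of_recollides (ht : M.GoodTime V f t) (ht₀ : 0 < t) (hd : 2 ≤ d)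
    (hρ : 0 ≤ M.ρ) (hβ : 0 < M.β) (hV : ContinuousOn V (Ici 0)) (hpos : ∀ t, 0 ≤ t → 0 < V t)
    (hesc : M.NoEscape V) {a κ B u₁ u₂ : ℝ} (ha : 0 < a) (hκ : 0 ≤ κ) (hu : u₁ ≤ u₂)
    (hrec : ∀ u ∈ Ioo u₁ u₂, a ≤ V t - u ∧ u ^ 2 ≤ B ∧
      ∃ s, M.Recollides V t u s ∧ κ ≤ u ^ 2 - (2 * V s - u) ^ 2) :
    M.A * ((u₂ - u₁) * (a ^ 2 * (M.β * κ * Real.exp (-M.β * B)))) ≤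
      M.force V f t - M.F₀ (V t) := by
  set q := M.amplitude * (a ^ 2 * (M.β * κ * Real.exp (-M.β * B))) with hq
  have h_front : slab M.R (Ioo u₁ u₂) ⊆ (slab M.R (Iio (V t)) : Set (Transverse d × Vect d)) := by
    intro p hp
    rw [mem_slab] at hp ⊢
    exact ⟨hp.1, show p.2.1 < V t by linarith [(hrec _ hp.2).1]⟩
  have h_le : ∫ p : Transverse d × Vect d in slab M.R (Ioo u₁ u₂),
      q * Real.exp (-M.β * ‖p.2.2‖ ^ 2) ≤ ∫ p in slab M.R (Ioo u₁ u₂), M.excess V f t p :=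
    integral_mono_ae (integrableOn_slab hβ (integrableOn_const measure_Ioo_lt_top.ne))
      ((ht.integrableOn_excess hβ).1.mono_set h_front)
      ((ae_restrict_iff' (measurableSet_slab measurableSet_Ioo)).2
        (ht.ae_le_excess_of_recollides hd hρ hβ.le hV ha.le hκ hrec))
  rw [setIntegral_slab _ _ _ fun _ => q, setIntegral_const, Real.volume_real_Ioo_of_le hu,
    smul_eq_mul] at h_le
  refine le_trans ?_ (ht.two_mul_setIntegral_excess_le ht₀ hρ hβ hV hpos hesc h_front)
  refine le_trans (le_of_eq ?_) (mul_le_mul_of_nonneg_left h_le zero_le_two)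
  rw [M.A_eq, hq]
  ring

end Model.GoodTime

end Excess

/-! ### Comparison for the velocity -/

section Comparison

theorem nonneg_of_integral_comparison {D g : ℝ → ℝ} {a T : ℝ} (haT : a ≤ T)
    (hg : IntervalIntegrable g volume a T) (hD : ∀ t ∈ Icc a T, D t = D a + ∫ τ in a..t, g τ)
    (hDa : 0 ≤ D a) (hcmp : ∀ᵐ τ, τ ∈ Ioo a T → D τ < 0 → 0 ≤ g τ) : 0 ≤ D T := by
  by_contra! h_neg
  have h_cont : ContinuousOn D (Icc a T) := by
    have h := intervalIntegral.continuousOn_primitive_interval' hg left_mem_uIcc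
    rw [uIcc_of_le haT] at h
    exact (continuousOn_const.add h).congr hD
  have h_compact : IsCompact (Icc a T ∩ D ⁻¹' Ici 0) :=
    isCompact_Icc.of_isClosed_subset
      (h_cont.preimage_isClosed_of_isClosed isClosed_Icc isClosed_Ici) inter_subset_left
  obtain ⟨s, ⟨hsI, hDs : 0 ≤ D s⟩, h_last⟩ := h_compact.exists_isGreatest ⟨a, ⟨le_rfl, haT⟩, hDa⟩
  have h_sub : D T = D s + ∫ τ in s..T, g τ := by
    have h_as : IntervalIntegrable g volume a s := hg.mono_set (by
      rw [uIcc_of_le haT, uIcc_of_le hsI.1]; exact Icc_subset_Icc_right hsI.2)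
    have h_sT : IntervalIntegrable g volume s T := hg.mono_set (by
      rw [uIcc_of_le haT, uIcc_of_le hsI.2]; exact Icc_subset_Icc_left hsI.1)
    rw [hD T ⟨haT, le_rfl⟩, hD s hsI, ← intervalIntegral.integral_add_adjacent_intervals h_as h_sT]
    ring
  have h_integral : 0 ≤ ∫ τ in s..T, g τ := by
    rw [intervalIntegral.integral_of_le hsI.2, integral_Ioc_eq_integral_Ioo]
    refine setIntegral_nonneg_of_ae_restrict ((ae_restrict_iff' measurableSet_Ioo).2 ?_)
    filter_upwards [hcmp] with τ hτ hτI
    refine hτ ⟨hsI.1.trans_lt hτI.1, hτI.2⟩ ?_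
    by_contra! h
    exact absurd (h_last ⟨⟨hsI.1.trans hτI.1.le, hτI.2.le⟩, h⟩) (not_le.2 hτI.1)
  linarith

theorem le_of_bootstrap {g φ : ℝ → ℝ} (hg : ContinuousOn g (Ici 0)) (hφ : ContinuousOn φ (Ici 0))
    (hφ₀ : ∀ t, 0 ≤ t → 0 < φ t)
    (hstep : ∀ T, 0 ≤ T → (∀ t ∈ Ico 0 T, g t ≤ 2 * φ t) → g T ≤ φ T) {t : ℝ} (ht : 0 ≤ t) :
    g t ≤ φ t := by
  by_contra! hlt
  have h_cont : ContinuousOn (fun τ => g τ - 2 * φ τ) (Icc 0 t) :=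
    (hg.sub (continuousOn_const.mul hφ)).mono Icc_subset_Ici_self
  have h_compact : IsCompact (Icc 0 t ∩ (fun τ => g τ - 2 * φ τ) ⁻¹' Ici 0) :=
    isCompact_Icc.of_isClosed_subset
      (h_cont.preimage_isClosed_of_isClosed isClosed_Icc isClosed_Ici) inter_subset_left
  obtain ⟨τ, hτ, hτφ⟩ : ∃ τ ∈ Ico 0 t, 2 * φ τ < g τ := by
    by_contra! h
    exact not_le.2 hlt (hstep t ht h)
  obtain ⟨T, ⟨hTI, hT : 0 ≤ g T - 2 * φ T⟩, h_first⟩ := h_compact.exists_isLeast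
    ⟨τ, ⟨hτ.1, hτ.2.le⟩, show 0 ≤ g τ - 2 * φ τ by linarith⟩
  have h_step : g T ≤ φ T := hstep T hTI.1 fun σ hσ => by
    by_contra! h
    exact absurd (h_first ⟨⟨hσ.1, hσ.2.le.trans hTI.2⟩, show 0 ≤ g σ - 2 * φ σ by linarith⟩)
      (not_le.2 hσ.2)
  linarith [hφ₀ T hTI.1]

namespace Model.IsSolution

variable {M : Model d} {V₀ Vinf a T : ℝ} {V : ℝ → ℝ} {f : ℝ → Vect d → Vect d → ℝ}

theorem intervalIntegrable (hs : M.IsSolution V₀ V f) {b : ℝ} (ha : 0 ≤ a) (hb : 0 ≤ b) :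
    IntervalIntegrable (fun τ => M.E - M.force V f τ) volume a b :=
  intervalIntegrable_const.sub ((hs.force_integrable a ha).symm.trans (hs.force_integrable b hb))

theorem velocity_zero (hs : M.IsSolution V₀ V f) : V 0 = V₀ := by
  simpa using hs.motion 0 le_rfl

theorem velocity_eq (hs : M.IsSolution V₀ V f) {t : ℝ} (ha : 0 ≤ a) (ht : 0 ≤ t) :
    V t = V a + ∫ τ in a..t, (M.E - M.force V f τ) := by
  rw [hs.motion t ht, hs.motion a ha, ← intervalIntegral.integral_add_adjacent_intervals
    (hs.intervalIntegrable le_rfl ha) (hs.intervalIntegrable ha ht)]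
  ring

theorem continuousOn (hs : M.IsSolution V₀ V f) : ContinuousOn V (Ici 0) := by
  intro t (ht : 0 ≤ t)
  have h_primitive := intervalIntegral.continuousOn_primitive_interval'
    (hs.intervalIntegrable le_rfl (by linarith : 0 ≤ t + 1)) left_mem_uIcc
  rw [uIcc_of_le (by linarith)] at h_primitive
  have h_cont : ContinuousOn V (Icc 0 (t + 1)) :=
    (continuousOn_const.add h_primitive).congr fun τ hτ => hs.motion τ hτ.1
  refine (h_cont t ⟨ht, by linarith⟩).mono_of_mem_nhdsWithin ?_
  filter_upwards [self_mem_nhdsWithin, mem_nhdsWithin_of_mem_nhds (Iio_mem_nhds (lt_add_one t))]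
    with τ hτ hτt
  exact ⟨hτ, hτt.le⟩

theorem mul_sub_le_of_supersolution (hs : M.IsSolution V₀ V f) {φ φ' : ℝ → ℝ} {σ : ℝ} (ha : 0 ≤ a)
    (haT : a ≤ T) (hφ : ∀ t ∈ Icc a T, HasDerivAt φ (φ' t) t) (hφ' : ContinuousOn φ' (Icc a T))
    (hφa : σ * (Vinf - V a) ≤ φ a)
    (hcmp : ∀ᵐ τ, τ ∈ Ioo a T → φ τ < σ * (Vinf - V τ) → σ * (M.force V f τ - M.E) ≤ φ' τ) :
    σ * (Vinf - V T) ≤ φ T := by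
  have hφ_int : IntervalIntegrable φ' volume a T :=
    ContinuousOn.intervalIntegrable (by rwa [uIcc_of_le haT])
  have h_eq (t : ℝ) (ht : t ∈ Icc a T) : φ t - σ * (Vinf - V t) =
      φ a - σ * (Vinf - V a) + ∫ τ in a..t, (φ' τ + σ * (M.E - M.force V f τ)) := by
    have h_int : IntervalIntegrable φ' volume a t := hφ_int.mono_set (by
      rw [uIcc_of_le haT, uIcc_of_le ht.1]; exact Icc_subset_Icc_right ht.2)
    have h_ftc : ∫ τ in a..t, φ' τ = φ t - φ a :=
      intervalIntegral.integral_eq_sub_of_hasDerivAt (fun τ hτ => by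
        rw [uIcc_of_le ht.1] at hτ
        exact hφ τ ⟨hτ.1, hτ.2.trans ht.2⟩) h_int
    rw [intervalIntegral.integral_add h_int
      ((hs.intervalIntegrable ha (ha.trans ht.1)).const_mul σ), h_ftc,
      intervalIntegral.integral_const_mul, hs.velocity_eq ha (ha.trans ht.1)]
    ring
  refine sub_nonneg.1 (nonneg_of_integral_comparison (D := fun t => φ t - σ * (Vinf - V t)) haT
    (hφ_int.add ((hs.intervalIntegrable ha (ha.trans haT)).const_mul σ)) h_eq
    (sub_nonneg.2 hφa) ?_)
  filter_upwards [hcmp] with τ hτ hτI hτφ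
  linarith [hτ hτI (sub_neg.1 hτφ)]

theorem abs_sub_le_of_supersolution (hs : M.IsSolution V₀ V f) (hA : 0 < M.A) (hβ : 0 < M.β)
    (hE : M.F₀ Vinf = M.E) {φ φ' : ℝ → ℝ} (ha : 0 ≤ a) (haT : a ≤ T)
    (hφ : ∀ t ∈ Icc a T, HasDerivAt φ (φ' t) t) (hφ' : ContinuousOn φ' (Icc a T))
    (hφ₀ : ∀ t ∈ Icc a T, 0 ≤ φ t) (hφa : |Vinf - V a| ≤ φ a)
    (hcmp : ∀ᵐ τ, τ ∈ Ioo a T →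
      |M.force V f τ - M.F₀ (V τ)| ≤ deriv M.F₀ 0 * φ τ + φ' τ) :
    |Vinf - V T| ≤ φ T := by
  rw [abs_le] at hφa
  have h_upper : 1 * (Vinf - V T) ≤ φ T := by
    refine hs.mul_sub_le_of_supersolution ha haT hφ hφ' (by linarith) ?_
    filter_upwards [hcmp] with τ hτ hτI hτφ
    have h_excess := abs_le.1 (hτ hτI)
    have h_F₀ := M.mul_sub_le_F₀_sub hA.le hβ (V := V τ) (V' := Vinf)
      (by linarith [hφ₀ τ ⟨hτI.1.le, hτI.2.le⟩])
    have h_mul := mul_le_mul_of_nonneg_left hτφ.le (M.deriv_F₀_pos hA hβ 0).le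
    linarith [h_excess.2]
  have h_lower : -1 * (Vinf - V T) ≤ φ T := by
    refine hs.mul_sub_le_of_supersolution ha haT hφ hφ' (by linarith) ?_
    filter_upwards [hcmp] with τ hτ hτI hτφ
    have h_excess := abs_le.1 (hτ hτI)
    have h_F₀ := M.mul_sub_le_F₀_sub hA.le hβ (V := Vinf) (V' := V τ)
      (by linarith [hφ₀ τ ⟨hτI.1.le, hτI.2.le⟩])
    have h_mul := mul_le_mul_of_nonneg_left hτφ.le (M.deriv_F₀_pos hA hβ 0).le
    linarith [h_excess.1]
  exact abs_le.2 ⟨by linarith, by linarith⟩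

theorem le_sub_of_subsolution (hs : M.IsSolution V₀ V f) (hA : 0 < M.A) (hβ : 0 < M.β)
    (hE : M.F₀ Vinf = M.E) (hV : ∀ t, 0 ≤ t → 0 ≤ V t) {ψ ψ' : ℝ → ℝ} (ha : 0 ≤ a) (haT : a ≤ T)
    (hψ : ∀ t ∈ Icc a T, HasDerivAt ψ (ψ' t) t) (hψ' : ContinuousOn ψ' (Icc a T))
    (hψ₀ : ∀ t ∈ Icc a T, 0 ≤ ψ t) (hψa : ψ a ≤ Vinf - V a)
    (hcmp : ∀ᵐ τ, τ ∈ Ioo a T →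
      ψ' τ + deriv M.F₀ Vinf * ψ τ ≤ M.force V f τ - M.F₀ (V τ)) :
    ψ T ≤ Vinf - V T := by
  have h := hs.mul_sub_le_of_supersolution (Vinf := Vinf) (σ := -1) ha haT
    (fun t ht => (hψ t ht).fun_neg) hψ'.fun_neg (by linarith) ?_
  · linarith
  filter_upwards [hcmp] with τ hτ hτI hτψ
  have h_excess := hτ hτI
  have hC := (M.deriv_F₀_pos hA hβ Vinf).le
  rcases le_total (V τ) Vinf with hle | hle
  · have h_F₀ := M.F₀_sub_le hA.le hβ (hV τ (ha.trans hτI.1.le)) hle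
    have h_mul := mul_le_mul_of_nonneg_left (by linarith : Vinf - V τ ≤ ψ τ) hC
    linarith
  · have h_F₀ := M.mul_sub_le_F₀_sub hA.le hβ hle
    have h_mul := mul_nonneg (M.deriv_F₀_pos hA hβ 0).le (sub_nonneg.2 hle)
    have h_ψ := mul_nonneg hC (hψ₀ τ ⟨hτI.1.le, hτI.2.le⟩)
    linarith

end Model.IsSolution

end Comparison

/-! ### Decay of the deviation from the limiting velocity -/

section Decay

/-- The profile `γ L² / (L + t)²`, which bounds the deviation from the limiting velocity. -/
def decay (γ L t : ℝ) : ℝ := γ * L ^ 2 / (L + t) ^ 2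

variable {γ L t : ℝ}

theorem two_mul_decay (γ L t : ℝ) : 2 * decay γ L t = decay (2 * γ) L t := by
  unfold decay; ring

theorem decay_zero (hL : L ≠ 0) (γ : ℝ) : decay γ L 0 = γ := by
  unfold decay
  rw [add_zero, mul_div_cancel_right₀ _ (pow_ne_zero 2 hL)]

theorem decay_pos (hγ : 0 < γ) (hL : 0 < L) (ht : 0 ≤ t) : 0 < decay γ L t := by
  unfold decay; positivity

theorem decay_le_div (hγ : 0 ≤ γ) (hL : 0 < L) (ht : 0 ≤ t) :
    decay γ L t ≤ γ * L / (L + t) := by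
  unfold decay
  rw [div_le_div_iff₀ (by positivity) (by positivity)]
  calc γ * L ^ 2 * (L + t) = γ * L * (L + t) * L := by ring
    _ ≤ γ * L * (L + t) * (L + t) := by gcongr; linarith
    _ = γ * L * (L + t) ^ 2 := by ring

theorem decay_le (hγ : 0 ≤ γ) (hL : 0 < L) (ht : 0 ≤ t) : decay γ L t ≤ γ := by
  refine (decay_le_div hγ hL ht).trans ?_
  rw [div_le_iff₀ (by positivity)]
  gcongr
  linarith

theorem hasDerivAt_decay (hL : 0 < L) (ht : 0 ≤ t) :
    HasDerivAt (decay γ L) (-(2 / (L + t)) * decay γ L t) t := by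
  have h_ne : L + t ≠ 0 := by positivity
  have h_inv := (((hasDerivAt_id t).const_add L).fun_pow 2).fun_inv (pow_ne_zero 2 h_ne)
  unfold decay
  refine (h_inv.const_mul (γ * L ^ 2)).congr_deriv ?_
  simp only [id_eq]
  field_simp
  push_cast
  ring

theorem continuousOn_decay (hL : 0 < L) : ContinuousOn (decay γ L) (Ici 0) :=
  fun _ ht => (hasDerivAt_decay hL ht).continuousAt.continuousWithinAt

variable {a b : ℝ}

theorem integral_decay (hL : 0 < L) (ha : 0 ≤ a) (hab : a ≤ b) :
    ∫ τ in a..b, decay γ L τ = γ * L ^ 2 * (b - a) / ((L + a) * (L + b)) := by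
  have hb := ha.trans hab
  have h_primitive (τ : ℝ) (hτ : τ ∈ uIcc a b) :
      HasDerivAt (fun τ => -(γ * L ^ 2) * (L + τ)⁻¹) (decay γ L τ) τ := by
    rw [uIcc_of_le hab] at hτ
    have h_ne : L + τ ≠ 0 := by linarith [hτ.1]
    refine ((((hasDerivAt_id τ).const_add L).fun_inv h_ne).const_mul _).congr_deriv ?_
    unfold decay
    simp only [id_eq]
    field_simp
  rw [intervalIntegral.integral_eq_sub_of_hasDerivAt h_primitive
    (intervalIntegrable_of_continuousOn_Ici (continuousOn_decay hL) ha hb)]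
  field_simp
  ring

theorem integral_decay_le_mul (hγ : 0 ≤ γ) (hL : 0 < L) (ha : 0 ≤ a) (hab : a ≤ b) :
    ∫ τ in a..b, decay γ L τ ≤ γ * L / (L + b) * (b - a) := by
  have hb := ha.trans hab
  have _hab' : 0 ≤ b - a := sub_nonneg.2 hab
  rw [integral_decay hL ha hab, div_le_iff₀ (by positivity)]
  calc γ * L ^ 2 * (b - a) = γ * L * (b - a) * L := by ring
    _ ≤ γ * L * (b - a) * (L + a) := by gcongr; linarith
    _ = γ * L / (L + b) * (b - a) * ((L + a) * (L + b)) := by field_simp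

theorem integral_decay_le (hγ : 0 ≤ γ) (hL : 0 < L) (ha : 0 ≤ a) (hab : a ≤ b) :
    ∫ τ in a..b, decay γ L τ ≤ γ * L := by
  have hb := ha.trans hab
  refine (integral_decay_le_mul hγ hL ha hab).trans ?_
  rw [div_mul_eq_mul_div, div_le_iff₀ (by positivity)]
  gcongr
  linarith

variable {V : ℝ → ℝ} {Vinf : ℝ}

theorem position_sub_eq_sub_integral (hV : ContinuousOn V (Ici 0)) (Vinf : ℝ) (ha : 0 ≤ a)
    (hb : 0 ≤ b) :
    position V b - position V a = Vinf * (b - a) - ∫ τ in a..b, (Vinf - V τ) := by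
  rw [position_sub hV ha hb, intervalIntegral.integral_sub intervalIntegrable_const
    (intervalIntegrable_of_continuousOn_Ici hV ha hb), intervalIntegral.integral_const, smul_eq_mul]
  ring

theorem abs_integral_le_integral_decay (hL : 0 < L) (ha : 0 ≤ a) (hab : a ≤ b)
    (h : ∀ τ ∈ Ioc a b, |Vinf - V τ| ≤ decay γ L τ) :
    |∫ τ in a..b, (Vinf - V τ)| ≤ ∫ τ in a..b, decay γ L τ :=
  intervalIntegral.norm_integral_le_of_norm_le (f := fun τ => Vinf - V τ) hab (ae_of_all _ h)
    (intervalIntegrable_of_continuousOn_Ici (continuousOn_decay hL) ha (ha.trans hab))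

theorem abs_mean_velocity_sub_le (hV : ContinuousOn V (Ici 0)) (hγ : 0 ≤ γ) (hL : 0 < L) {s u : ℝ}
    (hs : 0 ≤ s) (hst : s < t) (h : ∀ τ ∈ Ioc s t, |Vinf - V τ| ≤ decay γ L τ)
    (hu : position V t - position V s = u * (t - s)) : |u - V t| ≤ 2 * (γ * L / (L + t)) := by
  have ht : 0 ≤ t := hs.trans hst.le
  have hts : 0 < t - s := sub_pos.2 hst
  have h_integral := (abs_integral_le_integral_decay hL hs hst.le h).trans
    (integral_decay_le_mul hγ hL hs hst.le)
  have h_now : |Vinf - V t| ≤ γ * L / (L + t) :=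
    (h t ⟨hst, le_rfl⟩).trans (decay_le_div hγ hL ht)
  rw [position_sub_eq_sub_integral hV Vinf hs ht] at hu
  refine le_of_mul_le_mul_right ?_ hts
  calc |u - V t| * (t - s)
      = |(Vinf - V t) * (t - s) - ∫ τ in s..t, (Vinf - V τ)| := by
        rw [← abs_of_pos hts, ← abs_mul, abs_of_pos hts]
        congr 1
        linear_combination -hu
    _ ≤ |Vinf - V t| * (t - s) + |∫ τ in s..t, (Vinf - V τ)| := by
        refine (abs_sub _ _).trans_eq ?_
        rw [abs_mul, abs_of_pos hts]
    _ ≤ γ * L / (L + t) * (t - s) + γ * L / (L + t) * (t - s) := by gcongr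
    _ = 2 * (γ * L / (L + t)) * (t - s) := by ring

variable {M : Model d} {f : ℝ → Vect d → Vect d → ℝ}

theorem Model.GoodTime.abs_force_sub_le_decay (hg : M.GoodTime V f t) (ht : 0 ≤ t)
    (hρ : 0 ≤ M.ρ) (hβ : 0 < M.β) (hV : ContinuousOn V (Ici 0)) (hγ : 0 ≤ γ) (hL : 0 < L)
    (h : ∀ τ ∈ Icc 0 t, |Vinf - V τ| ≤ 2 * decay γ L τ) :
    |M.force V f t - M.F₀ (V t)| ≤ 256 * M.A * γ ^ 2 * decay γ L t := by
  have hA := M.A_nonneg hρ hβ.le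
  have h_decay : (0 : ℝ) ≤ decay γ L t := by unfold decay; positivity
  have h_ratio : L / (L + t) ≤ 1 := by rw [div_le_one (by positivity)]; linarith
  have h_force : |M.force V f t - M.F₀ (V t)| ≤ 4 * M.A * (4 * (γ * L / (L + t))) ^ 3 := by
    refine hg.abs_force_sub_le hρ hβ (by positivity) fun s u hs hst hX => ?_
    have h_mean := abs_mean_velocity_sub_le hV (Vinf := Vinf) (γ := 2 * γ) (by positivity) hL hs.le
      hst (fun τ hτ => two_mul_decay γ L τ ▸ h τ ⟨hs.le.trans hτ.1.le, hτ.2⟩) hX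
    exact h_mean.trans_eq (by ring)
  calc |M.force V f t - M.F₀ (V t)|
      ≤ 4 * M.A * (4 * (γ * L / (L + t))) ^ 3 := h_force
    _ = 256 * M.A * γ ^ 2 * (L / (L + t)) * decay γ L t := by unfold decay; field_simp; ring
    _ ≤ 256 * M.A * γ ^ 2 * 1 * decay γ L t := by gcongr
    _ = 256 * M.A * γ ^ 2 * decay γ L t := by ring

theorem Model.IsSolution.abs_sub_le_decay (hs : M.IsSolution (Vinf - γ) V f) (hd : 2 ≤ d)
    (hR : 0 < M.R) (hρ : 0 < M.ρ) (hβ : 0 < M.β) (hE : M.F₀ Vinf = M.E) (hγ : 0 < γ) (hL : 0 < L)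
    (hLF : 4 ≤ deriv M.F₀ 0 * L) (hsmall : 512 * M.A * γ ^ 2 ≤ deriv M.F₀ 0) (ht : 0 ≤ t) :
    |Vinf - V t| ≤ decay γ L t := by
  have hA := M.A_pos hR hρ hβ
  have hV := hs.continuousOn
  refine le_of_bootstrap (continuousOn_const.sub hV).abs (continuousOn_decay hL)
    (fun τ hτ => decay_pos hγ hL hτ) (fun T hT hboot => ?_) ht
  have h_cont : ContinuousOn (fun t => -(2 / (L + t)) * decay γ L t) (Icc 0 T) := by
    have h_ne : ∀ t ∈ Icc 0 T, L + t ≠ 0 := fun t ht => by linarith [ht.1]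
    exact (continuousOn_const.div (by fun_prop) h_ne).neg.mul
      ((continuousOn_decay hL).mono Icc_subset_Ici_self)
  refine hs.abs_sub_le_of_supersolution hA hβ hE le_rfl hT
    (fun t ht => hasDerivAt_decay hL ht.1) h_cont (fun t ht => (decay_pos hγ hL ht.1).le) ?_ ?_
  · rw [hs.velocity_zero, decay_zero hL.ne', sub_sub_cancel, abs_of_pos hγ]
  filter_upwards [hs.ae_goodTime hd hR.ne' hV] with τ hg hτ
  have h_rate : 2 / (L + τ) ≤ deriv M.F₀ 0 / 2 := by
    have := mul_nonneg (M.deriv_F₀_pos hA hβ 0).le hτ.1.le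
    rw [div_le_div_iff₀ (by linarith [hτ.1]) two_pos]
    linarith
  calc |M.force V f τ - M.F₀ (V τ)|
      ≤ 256 * M.A * γ ^ 2 * decay γ L τ :=
        (hg hτ.1).abs_force_sub_le_decay hτ.1.le hρ.le hβ hV hγ.le hL fun σ hσ =>
          hboot σ ⟨hσ.1, hσ.2.trans_lt hτ.2⟩
    _ ≤ (deriv M.F₀ 0 - 2 / (L + τ)) * decay γ L τ :=
        mul_le_mul_of_nonneg_right (by linarith) (decay_pos hγ hL hτ.1.le).le
    _ = deriv M.F₀ 0 * decay γ L τ + -(2 / (L + τ)) * decay γ L τ := by ring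

theorem Model.noEscape_of_decay (hV : ContinuousOn V (Ici 0)) (hγ : 0 ≤ γ) (hL : 0 < L)
    (hh : 2 * (γ * L) < M.h) (hdecay : ∀ t, 0 ≤ t → |Vinf - V t| ≤ decay γ L t) :
    M.NoEscape V := by
  intro s T u hs hsT hX τ hτ
  have h_integral (b : ℝ) (hb : s ≤ b) : |∫ σ in s..b, (Vinf - V σ)| ≤ γ * L :=
    (abs_integral_le_integral_decay hL hs hb fun σ hσ => hdecay σ (hs.trans hσ.1.le)).trans
      (integral_decay_le hγ hL hs hb)
  have h_position := position_sub_eq_sub_integral hV Vinf hs (hs.trans hτ.1)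
  rw [position_sub_eq_sub_integral hV Vinf hs (hs.trans hsT.le)] at hX
  have h_end : |(Vinf - u) * (T - s)| ≤ γ * L := by
    rw [show (Vinf - u) * (T - s) = ∫ σ in s..T, (Vinf - V σ) by linear_combination hX]
    exact h_integral T hsT.le
  have h_now : |(Vinf - u) * (τ - s)| ≤ γ * L := by
    refine le_trans ?_ h_end
    rw [abs_mul, abs_mul, abs_of_nonneg (sub_nonneg.2 hτ.1), abs_of_pos (sub_pos.2 hsT)]
    exact mul_le_mul_of_nonneg_left (sub_le_sub_right hτ.2 s) (abs_nonneg _)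
  calc position V s + u * (τ - s) - position V τ
      = (∫ σ in s..τ, (Vinf - V σ)) - (Vinf - u) * (τ - s) := by linear_combination -h_position
    _ ≤ γ * L + γ * L :=
        by linarith [(abs_le.1 (h_integral τ hτ.1)).2, (abs_le.1 h_now).1]
    _ < M.h := by linarith

theorem Model.IsSolution.mul_exp_le_sub (hs : M.IsSolution (Vinf - γ) V f) (hd : 2 ≤ d)
    (hR : 0 < M.R) (hρ : 0 < M.ρ) (hβ : 0 < M.β) (hE : M.F₀ Vinf = M.E) (hγ : 0 ≤ γ)
    (hpos : ∀ t, 0 ≤ t → 0 < V t) (hesc : M.NoEscape V) (ht : 0 ≤ t) :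
    γ * Real.exp (-deriv M.F₀ Vinf * t) ≤ Vinf - V t := by
  have hV := hs.continuousOn
  have h_deriv (τ : ℝ) : HasDerivAt (fun τ => γ * Real.exp (-deriv M.F₀ Vinf * τ))
      (γ * (Real.exp (-deriv M.F₀ Vinf * τ) * -deriv M.F₀ Vinf)) τ := by
    simpa using ((hasDerivAt_id τ).const_mul (-deriv M.F₀ Vinf)).exp.const_mul γ
  refine hs.le_sub_of_subsolution (M.A_pos hR hρ hβ) hβ hE (fun τ hτ => (hpos τ hτ).le) le_rfl ht
    (fun τ _ => h_deriv τ) (by fun_prop) (fun τ _ => by positivity) (by simp [hs.velocity_zero]) ?_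
  filter_upwards [hs.ae_goodTime hd hR.ne' hV] with τ hg hτ
  refine le_trans (le_of_eq ?_) ((hg hτ.1).force_sub_nonneg hτ.1 hρ.le hβ hV hpos hesc)
  ring

end Decay

/-! ### The distribution of the deviation over long times -/

section Layer

/-- The bounds on the deviation `W` from the limiting velocity that force late recollisions with
the particles reflected in the initial layer `[0, s₀]`. -/
structure LayerBounds (W : ℝ → ℝ) (γ L s₀ c : ℝ) : Prop where
  continuousOn : ContinuousOn W (Ici 0)
  γ_pos : 0 < γ
  L_pos : 0 < L
  s₀_pos : 0 < s₀
  s₀_le_one : s₀ ≤ 1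
  c_pos : 0 < c
  nonneg : ∀ τ, 0 ≤ τ → 0 ≤ W τ
  le_decay : ∀ τ, 0 ≤ τ → W τ ≤ decay γ L τ
  initial : ∀ τ ∈ Icc 0 s₀, 4 / 5 * γ ≤ W τ
  lower : ∀ τ ∈ Icc 0 2, c * γ ≤ W τ

/-- A time after which the recollisions with the particles reflected in the initial layer are
under control. -/
def lateTime (L c : ℝ) : ℝ := 2 + 10 * L + L / c + L ^ 3 / c ^ 2 + 2 * L ^ 2 / c

variable {W : ℝ → ℝ} {γ L s₀ c t : ℝ}

theorem two_le_lateTime (hL : 0 ≤ L) (hc : 0 ≤ c) : 2 ≤ lateTime L c := by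
  have : 0 ≤ 10 * L + L / c + L ^ 3 / c ^ 2 + 2 * L ^ 2 / c := by positivity
  unfold lateTime
  linarith

theorem bounds_of_lateTime_le (hL : 0 < L) (hc : 0 < c) (ht : lateTime L c ≤ t) :
    10 * L + 2 ≤ t ∧ L ≤ c * (t - 1) ∧ L ^ 3 ≤ c ^ 2 * (t - 1) ∧ 2 * L ^ 2 ≤ c * t := by
  have h₁ : 0 < L / c := by positivity
  have h₂ : 0 < L ^ 3 / c ^ 2 := by positivity
  have h₃ : 0 < 2 * L ^ 2 / c := by positivity
  unfold lateTime at ht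
  refine ⟨by linarith, (div_le_iff₀' hc).1 ?_, (div_le_iff₀' (pow_pos hc 2)).1 ?_,
    (div_le_iff₀' hc).1 ?_⟩ <;> linarith

namespace LayerBounds

variable {a b : ℝ}

theorem intervalIntegrable (h : LayerBounds W γ L s₀ c) (ha : 0 ≤ a) (hb : 0 ≤ b) :
    IntervalIntegrable W volume a b :=
  intervalIntegrable_of_continuousOn_Ici h.continuousOn ha hb

theorem le (h : LayerBounds W γ L s₀ c) (ht : 0 ≤ t) : W t ≤ γ :=
  (h.le_decay t ht).trans (decay_le h.γ_pos.le h.L_pos ht)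

theorem integral_nonneg (h : LayerBounds W γ L s₀ c) (ha : 0 ≤ a) (hab : a ≤ b) :
    0 ≤ ∫ τ in a..b, W τ :=
  intervalIntegral.integral_nonneg hab fun τ hτ => h.nonneg τ (ha.trans hτ.1)

theorem integral_le_integral_decay (h : LayerBounds W γ L s₀ c) (ha : 0 ≤ a) (hab : a ≤ b) :
    ∫ τ in a..b, W τ ≤ ∫ τ in a..b, decay γ L τ :=
  intervalIntegral.integral_mono_on hab (h.intervalIntegrable ha (ha.trans hab))
    (intervalIntegrable_of_continuousOn_Ici (continuousOn_decay h.L_pos) ha (ha.trans hab))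
    fun τ hτ => h.le_decay τ (ha.trans hτ.1)

theorem integral_le (h : LayerBounds W γ L s₀ c) (ha : 0 ≤ a) (hab : a ≤ b) :
    ∫ τ in a..b, W τ ≤ γ * L :=
  (h.integral_le_integral_decay ha hab).trans (integral_decay_le h.γ_pos.le h.L_pos ha hab)

theorem integral_add (h : LayerBounds W γ L s₀ c) {e : ℝ} (ha : 0 ≤ a) (hb : 0 ≤ b)
    (he : 0 ≤ e) : (∫ τ in a..b, W τ) + ∫ τ in b..e, W τ = ∫ τ in a..e, W τ :=
  intervalIntegral.integral_add_adjacent_intervals (h.intervalIntegrable ha hb)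
    (h.intervalIntegrable hb he)

theorem mul_sub_le_integral (h : LayerBounds W γ L s₀ c) {m : ℝ} (ha : 0 ≤ a) (hab : a ≤ b)
    (hm : ∀ τ ∈ Icc a b, m ≤ W τ) : m * (b - a) ≤ ∫ τ in a..b, W τ := by
  calc m * (b - a) = ∫ _ in a..b, m := by
        rw [intervalIntegral.integral_const, smul_eq_mul, mul_comm]
    _ ≤ ∫ τ in a..b, W τ := intervalIntegral.integral_mono_on hab intervalIntegrable_const
        (h.intervalIntegrable ha (ha.trans hab)) hm

theorem mul_min_le_integral (h : LayerBounds W γ L s₀ c) (hb : s₀ ≤ b) :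
    c * γ * min 1 (b - s₀) ≤ ∫ τ in s₀..b, W τ := by
  have hs₀ := h.s₀_pos.le
  set m := s₀ + min 1 (b - s₀) with hm
  have h_left : s₀ ≤ m := by linarith [le_min zero_le_one (sub_nonneg.2 hb)]
  have h_right : m ≤ b := by linarith [min_le_right 1 (b - s₀)]
  have h_two : m ≤ 2 := by linarith [min_le_left 1 (b - s₀), h.s₀_le_one]
  calc c * γ * min 1 (b - s₀) = c * γ * (m - s₀) := by rw [hm, add_sub_cancel_left]
    _ ≤ ∫ τ in s₀..m, W τ := h.mul_sub_le_integral hs₀ h_left fun τ hτ =>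
        h.lower τ ⟨hs₀.trans hτ.1, hτ.2.trans h_two⟩
    _ ≤ (∫ τ in s₀..m, W τ) + ∫ τ in m..b, W τ :=
        le_add_of_nonneg_right (h.integral_nonneg (hs₀.trans h_left) h_right)
    _ = ∫ τ in s₀..b, W τ := h.integral_add hs₀ (hs₀.trans h_left) (hs₀.trans hb)

theorem mul_le_integral (h : LayerBounds W γ L s₀ c) (hb : s₀ + 1 ≤ b) :
    c * γ ≤ ∫ τ in s₀..b, W τ := by
  have := h.mul_min_le_integral (b := b) (by linarith)
  rwa [min_eq_left (by linarith), mul_one] at this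

theorem integral_tail_le_of_early (h : LayerBounds W γ L s₀ c) {τ : ℝ} (hτ : s₀ ≤ τ)
    (hτt : τ ≤ t) (ht : L ≤ c * (t - s₀)) (h_early : L * (τ - s₀) ≤ c * (t - s₀)) :
    (∫ σ in τ..t, W σ) * (t - s₀) ≤ (∫ σ in s₀..t, W σ) * (t - τ) := by
  have hs₀ := h.s₀_pos.le
  have hτs : 0 ≤ τ - s₀ := sub_nonneg.2 hτ
  have hts : 0 ≤ t - s₀ := by linarith
  have hγ := h.γ_pos.le
  have h_min : L * (τ - s₀) ≤ c * min 1 (τ - s₀) * (t - s₀) := by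
    rcases min_choice 1 (τ - s₀) with h_one | h_sub
    · rwa [h_one, mul_one]
    · rw [h_sub, mul_right_comm]
      exact mul_le_mul_of_nonneg_right ht hτs
  have h_head : (∫ σ in s₀..t, W σ) * (τ - s₀) ≤ (∫ σ in s₀..τ, W σ) * (t - s₀) :=
    calc (∫ σ in s₀..t, W σ) * (τ - s₀) ≤ γ * L * (τ - s₀) := by
          gcongr
          exact h.integral_le hs₀ (hτ.trans hτt)
      _ = γ * (L * (τ - s₀)) := by ring
      _ ≤ γ * (c * min 1 (τ - s₀) * (t - s₀)) := by gcongr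
      _ = c * γ * min 1 (τ - s₀) * (t - s₀) := by ring
      _ ≤ (∫ σ in s₀..τ, W σ) * (t - s₀) := by
          gcongr
          exact h.mul_min_le_integral hτ
  rw [← h.integral_add hs₀ (hs₀.trans hτ) (hs₀.trans (hτ.trans hτt))] at h_head ⊢
  linarith

theorem integral_tail_le_of_late (h : LayerBounds W γ L s₀ c) {τ : ℝ} (hτ : s₀ + 1 ≤ τ)
    (hτt : τ ≤ t) (ht : L ^ 3 ≤ c ^ 2 * (t - s₀)) (h_late : c * (t - s₀) ≤ L * (τ - s₀)) :
    (∫ σ in τ..t, W σ) * (t - s₀) ≤ (∫ σ in s₀..t, W σ) * (t - τ) := by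
  have hs₀ := h.s₀_pos
  have hL := h.L_pos
  have hc := h.c_pos
  have hγ := h.γ_pos
  have hτ₀ : 0 < τ := by linarith
  have hts : 0 ≤ t - s₀ := by linarith
  have _htτ : 0 ≤ t - τ := sub_nonneg.2 hτt
  have h_pos : 0 < (L + τ) * (L + t) := mul_pos (by linarith) (by linarith)
  have h_time : L ^ 2 * (t - s₀) ≤ c * ((L + τ) * (L + t)) := by
    refine le_of_mul_le_mul_left ?_ hL
    calc L * (L ^ 2 * (t - s₀)) = L ^ 3 * (t - s₀) := by ring
      _ ≤ c ^ 2 * (t - s₀) * (t - s₀) := by gcongr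
      _ = c * (c * (t - s₀)) * (t - s₀) := by ring
      _ ≤ c * (L * (L + τ)) * (L + t) := by
          have h_left : c * (t - s₀) ≤ L * (L + τ) := h_late.trans (by gcongr; linarith)
          gcongr
          linarith
      _ = L * (c * ((L + τ) * (L + t))) := by ring
  calc (∫ σ in τ..t, W σ) * (t - s₀) ≤ (∫ σ in τ..t, decay γ L σ) * (t - s₀) := by
        gcongr
        exact h.integral_le_integral_decay hτ₀.le hτt
    _ = γ * (t - τ) * (L ^ 2 * (t - s₀)) / ((L + τ) * (L + t)) := by
        rw [integral_decay hL hτ₀.le hτt]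
        ring
    _ ≤ γ * (t - τ) * (c * ((L + τ) * (L + t))) / ((L + τ) * (L + t)) := by gcongr
    _ = c * γ * (t - τ) := by
        rw [← mul_assoc, mul_div_cancel_right₀ _ h_pos.ne']
        ring
    _ ≤ (∫ σ in s₀..t, W σ) * (t - τ) := by
        gcongr
        exact h.mul_le_integral (hτ.trans hτt)

theorem integral_tail_le (h : LayerBounds W γ L s₀ c) (ht : lateTime L c ≤ t) {τ : ℝ}
    (hτ : s₀ ≤ τ) (hτt : τ ≤ t) :
    (∫ σ in τ..t, W σ) * (t - s₀) ≤ (∫ σ in s₀..t, W σ) * (t - τ) := by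
  have hc := h.c_pos
  have h_sub : t - 1 ≤ t - s₀ := sub_le_sub_left h.s₀_le_one t
  obtain ⟨-, h_linear, h_cubic, -⟩ := bounds_of_lateTime_le h.L_pos hc ht
  replace h_linear : L ≤ c * (t - s₀) := h_linear.trans (by gcongr)
  replace h_cubic : L ^ 3 ≤ c ^ 2 * (t - s₀) := h_cubic.trans (by gcongr)
  rcases le_total (L * (τ - s₀)) (c * (t - s₀)) with h_early | h_late
  · exact h.integral_tail_le_of_early hτ hτt h_linear h_early
  · refine h.integral_tail_le_of_late ?_ hτt h_cubic h_late
    have : L * 1 ≤ L * (τ - s₀) := by linarith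
    linarith [le_of_mul_le_mul_left this h.L_pos]

end LayerBounds

theorem exists_eq_zero_forall_pos {g : ℝ → ℝ} {a b : ℝ} (hab : a ≤ b)
    (hg : ContinuousOn g (Icc a b)) (ha : g a < 0) (hb : 0 < g b) :
    ∃ s ∈ Ioo a b, g s = 0 ∧ ∀ τ ∈ Ioc s b, 0 < g τ := by
  have h_compact : IsCompact (Icc a b ∩ g ⁻¹' {0}) := isCompact_Icc.of_isClosed_subset
    (hg.preimage_isClosed_of_isClosed isClosed_Icc isClosed_singleton) inter_subset_left
  obtain ⟨s, ⟨hs, hs₀⟩, hmax⟩ := h_compact.exists_isGreatest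
    (intermediate_value_Icc hab hg ⟨ha.le, hb.le⟩)
  rw [mem_preimage, mem_singleton_iff] at hs₀
  refine ⟨s, ⟨hs.1.lt_of_ne ?_, hs.2.lt_of_ne ?_⟩, hs₀, fun τ hτ => ?_⟩
  · rintro rfl
    exact ha.ne hs₀
  · rintro rfl
    exact hb.ne' hs₀
  by_contra! hgτ
  have haτ : a ≤ τ := hs.1.trans hτ.1.le
  obtain ⟨σ, hσ, hσ₀⟩ := intermediate_value_Icc hτ.2 (hg.mono (Icc_subset_Icc_left haτ))
    ⟨hgτ, hb.le⟩
  exact (hτ.1.trans_le hσ.1).not_ge (hmax ⟨⟨haτ.trans hσ.1, hσ.2⟩, hσ₀⟩)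

theorem LayerBounds.exists_hit (h : LayerBounds W γ L s₀ c) (ht : lateTime L c ≤ t) {w : ℝ}
    (hw₁ : (∫ σ in s₀..t, W σ) < w * (t - s₀)) (hw₂ : w * t < ∫ σ in (0 : ℝ)..t, W σ) :
    ∃ s ∈ Ioo 0 s₀, w * (t - s) = (∫ σ in s..t, W σ) ∧
      ∀ τ ∈ Ioo s t, ∫ σ in τ..t, W σ < w * (t - τ) := by
  have hs₀ := h.s₀_pos.le
  have ht₂ : 2 ≤ t := (two_le_lateTime h.L_pos.le h.c_pos.le).trans ht
  have ht₀ : 0 ≤ t := by linarith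
  have hst : s₀ < t := by linarith [h.s₀_le_one]
  have h_cont : ContinuousOn (fun τ => w * (t - τ) - ∫ σ in τ..t, W σ) (Icc 0 s₀) := by
    have h_primitive := intervalIntegral.continuousOn_primitive_interval'
      (h.intervalIntegrable le_rfl ht₀) right_mem_uIcc
    rw [uIcc_of_le ht₀] at h_primitive
    simp only [intervalIntegral.integral_symm t, sub_neg_eq_add]
    exact ContinuousOn.add (by fun_prop) (h_primitive.mono (Icc_subset_Icc_right hst.le))
  obtain ⟨s, hs, h_zero, h_pos⟩ := exists_eq_zero_forall_pos hs₀ h_cont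
    (by rw [sub_zero]; exact sub_neg.2 hw₂) (sub_pos.2 hw₁)
  refine ⟨s, hs, sub_eq_zero.1 h_zero, fun τ hτ => ?_⟩
  rcases le_total τ s₀ with hτs | hτs
  · exact sub_pos.1 (h_pos τ ⟨hτ.1, hτs⟩)
  refine lt_of_mul_lt_mul_right ?_ (sub_pos.2 hst).le
  calc (∫ σ in τ..t, W σ) * (t - s₀) ≤ (∫ σ in s₀..t, W σ) * (t - τ) :=
        h.integral_tail_le ht hτs hτ.2.le
    _ < w * (t - s₀) * (t - τ) := mul_lt_mul_of_pos_right hw₁ (sub_pos.2 hτ.2)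
    _ = w * (t - τ) * (t - s₀) := by ring

namespace LayerBounds

theorem le_div (h : LayerBounds W γ L s₀ c) (ht : lateTime L c ≤ t) :
    W t ≤ c * γ / (2 * t) := by
  have hL := h.L_pos
  have hγ := h.γ_pos
  have hc := h.c_pos
  obtain ⟨h_time, -, -, h_sq⟩ := bounds_of_lateTime_le hL hc ht
  have ht₀ : 0 < t := by linarith
  calc W t ≤ γ * L ^ 2 / (L + t) ^ 2 := h.le_decay t ht₀.le
    _ ≤ γ * L ^ 2 / t ^ 2 := by gcongr; linarith
    _ = γ * (2 * L ^ 2) / (2 * t ^ 2) := by field_simp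
    _ ≤ γ * (c * t) / (2 * t ^ 2) := by gcongr
    _ = c * γ / (2 * t) := by field_simp

theorem div_le_mean (h : LayerBounds W γ L s₀ c) (ht : s₀ + 1 ≤ t) :
    c * γ / t ≤ (∫ τ in s₀..t, W τ) / (t - s₀) := by
  have hs₀ := h.s₀_pos
  have hts : 0 < t - s₀ := by linarith
  have hcγ := (mul_pos h.c_pos h.γ_pos).le
  calc c * γ / t ≤ c * γ / (t - s₀) := by gcongr; linarith
    _ ≤ (∫ τ in s₀..t, W τ) / (t - s₀) := by gcongr; exact h.mul_le_integral ht

theorem mean_le (h : LayerBounds W γ L s₀ c) (ht₀ : 0 < t) (ht : 10 * L ≤ t) :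
    (∫ τ in (0 : ℝ)..t, W τ) / t ≤ γ / 10 := by
  have hγ := h.γ_pos
  rw [div_le_div_iff₀ ht₀ (by norm_num)]
  calc (∫ τ in (0 : ℝ)..t, W τ) * 10 ≤ γ * L * 10 := by gcongr; exact h.integral_le le_rfl ht₀.le
    _ = γ * (10 * L) := by ring
    _ ≤ γ * t := by gcongr

theorem le_mean_sub_mean (h : LayerBounds W γ L s₀ c) (ht : 10 * L + 2 ≤ t) :
    γ * s₀ / (2 * t) ≤ (∫ τ in (0 : ℝ)..t, W τ) / t - (∫ τ in s₀..t, W τ) / (t - s₀) := by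
  have hs₀ := h.s₀_pos
  have hs₁ := h.s₀_le_one
  have hL := h.L_pos
  have hγ := h.γ_pos
  have ht₀ : 0 < t := by linarith
  have hts : 0 < t - s₀ := by linarith
  have h_head : 4 / 5 * γ * s₀ ≤ ∫ τ in (0 : ℝ)..s₀, W τ := by
    simpa only [sub_zero] using h.mul_sub_le_integral le_rfl hs₀.le h.initial
  have h_tail : (∫ τ in s₀..t, W τ) / (t - s₀) ≤ γ / 10 := by
    rw [div_le_iff₀ hts]
    calc ∫ τ in s₀..t, W τ ≤ γ * L := h.integral_le hs₀.le (by linarith)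
      _ ≤ γ * ((t - s₀) / 10) := by gcongr; linarith
      _ = γ / 10 * (t - s₀) := by ring
  rw [← h.integral_add le_rfl hs₀.le ht₀.le]
  calc γ * s₀ / (2 * t) ≤ (4 / 5 * γ * s₀ - s₀ * (γ / 10)) / t := by
        rw [div_le_div_iff₀ (by positivity) ht₀]
        have : 0 ≤ γ * s₀ * t := by positivity
        linarith
    _ ≤ ((∫ τ in (0 : ℝ)..s₀, W τ) - s₀ * ((∫ τ in s₀..t, W τ) / (t - s₀))) / t := by
        gcongr
    _ = ((∫ τ in (0 : ℝ)..s₀, W τ) + ∫ τ in s₀..t, W τ) / t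
          - (∫ τ in s₀..t, W τ) / (t - s₀) := by
        field_simp
        ring

end LayerBounds

end Layer

/-! ### Recollisions with the initial layer -/

section LateRecollision

variable {M : Model d} {V : ℝ → ℝ} {Vinf γ L s₀ c s t u : ℝ}

namespace LayerBounds

theorem alongside_after_hit (h : LayerBounds (fun τ => Vinf - V τ) γ L s₀ c)
    (hV : ContinuousOn V (Ici 0)) (hγh : γ * L < M.h) (hs : 0 ≤ s) (hu : u ≤ Vinf)
    (h_hit : (Vinf - u) * (t - s) = ∫ σ in s..t, (Vinf - V σ))
    (h_after : ∀ τ ∈ Ioo s t, ∫ σ in τ..t, (Vinf - V σ) < (Vinf - u) * (t - τ)) :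
    M.Alongside V s t (position V t) u := by
  intro τ hτ
  have hτ₀ : 0 ≤ τ := hs.trans hτ.1.le
  have ht : 0 ≤ t := hτ₀.trans hτ.2.le
  have h_distance : position V t - (t - τ) * u - position V τ
      = (Vinf - u) * (t - τ) - ∫ σ in τ..t, (Vinf - V σ) := by
    linear_combination position_sub_eq_sub_integral hV Vinf hτ₀ ht
  rw [h_distance]
  refine ⟨sub_pos.2 (h_after τ hτ), ?_⟩
  calc (Vinf - u) * (t - τ) - ∫ σ in τ..t, (Vinf - V σ)
      ≤ (Vinf - u) * (t - s) - ∫ σ in τ..t, (Vinf - V σ) := by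
        gcongr
        exact hτ.1.le
    _ = ∫ σ in s..τ, (Vinf - V σ) := by
        rw [h_hit, ← h.integral_add hs hτ₀ ht, add_sub_cancel_right]
    _ ≤ γ * L := h.integral_le hs hτ.1.le
    _ < M.h := hγh

theorem alongside_before_hit (h : LayerBounds (fun τ => Vinf - V τ) γ L s₀ c)
    (hV : ContinuousOn V (Ici 0)) (hγh : 2 * γ < M.h) (hs : s ∈ Ioo 0 s₀)
    (hu : u ∈ Icc (Vinf - γ / 10) Vinf) :
    M.Alongside V 0 s (position V s) (2 * V s - u) := by
  intro τ hτ
  have hτ₀ := hτ.1.le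
  have hγ := h.γ_pos
  have hsτ : 0 < s - τ := sub_pos.2 hτ.2
  have h_distance : position V s - (s - τ) * (2 * V s - u) - position V τ
      = (2 * (Vinf - V s) - (Vinf - u)) * (s - τ) - ∫ σ in τ..s, (Vinf - V σ) := by
    linear_combination position_sub_eq_sub_integral hV Vinf hτ₀ hs.1.le
  have h_integral : ∫ σ in τ..s, (Vinf - V σ) ≤ γ * (s - τ) := by
    refine (intervalIntegral.integral_mono_on hτ.2.le (h.intervalIntegrable hτ₀ hs.1.le)
      (intervalIntegrable_const (c := γ)) fun σ hσ => h.le (hτ₀.trans hσ.1)).trans_eq ?_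
    rw [intervalIntegral.integral_const, smul_eq_mul, mul_comm]
  rw [h_distance]
  constructor
  · have h_initial := h.initial s ⟨hs.1.le, hs.2.le⟩
    calc (0 : ℝ) < 1 / 2 * γ * (s - τ) := by positivity
      _ = 3 / 2 * γ * (s - τ) - γ * (s - τ) := by ring
      _ ≤ _ := by gcongr; linarith [hu.1]
  · calc _ ≤ (2 * (Vinf - V s) - (Vinf - u)) * (s - τ) :=
          sub_le_self _ (h.integral_nonneg hτ₀ hτ.2.le)
      _ ≤ 2 * γ * 1 := by
          gcongr
          · linarith [h.le hs.1.le, hu.2]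
          · linarith [hs.2, h.s₀_le_one]
      _ < M.h := by linarith

theorem div_le_velocity_sub (h : LayerBounds (fun τ => Vinf - V τ) γ L s₀ c)
    (ht : lateTime L c ≤ t) (hu : u < Vinf - (∫ σ in s₀..t, (Vinf - V σ)) / (t - s₀)) :
    c * γ / (2 * t) ≤ V t - u := by
  have h_two := (two_le_lateTime h.L_pos.le h.c_pos.le).trans ht
  have h_split : c * γ / t = c * γ / (2 * t) + c * γ / (2 * t) := by
    have : t ≠ 0 := by linarith
    field_simp
    norm_num
  linarith [h.le_div ht, h.div_le_mean (t := t) (by linarith [h.s₀_le_one])]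

theorem velocity_mem (h : LayerBounds (fun τ => Vinf - V τ) γ L s₀ c) (ht : lateTime L c ≤ t)
    (hu : u ∈ Ioo (Vinf - (∫ σ in (0 : ℝ)..t, (Vinf - V σ)) / t)
      (Vinf - (∫ σ in s₀..t, (Vinf - V σ)) / (t - s₀))) :
    u ∈ Icc (Vinf - γ / 10) Vinf := by
  have hL := h.L_pos
  obtain ⟨h_time, -, -, -⟩ := bounds_of_lateTime_le hL h.c_pos ht
  have ht₀ : 0 < t := by linarith
  refine ⟨by linarith [h.mean_le ht₀ (by linarith), hu.1], ?_⟩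
  have hst : s₀ ≤ t := by linarith [h.s₀_le_one]
  linarith [hu.2, div_nonneg (h.integral_nonneg h.s₀_pos.le hst) (sub_nonneg.2 hst)]

theorem exists_recollides (h : LayerBounds (fun τ => Vinf - V τ) γ L s₀ c)
    (hV : ContinuousOn V (Ici 0)) (hγL : γ * L < M.h) (hγh : 2 * γ < M.h)
    (ht : lateTime L c ≤ t)
    (hu : u ∈ Ioo (Vinf - (∫ σ in (0 : ℝ)..t, (Vinf - V σ)) / t)
      (Vinf - (∫ σ in s₀..t, (Vinf - V σ)) / (t - s₀))) :
    ∃ s, M.Recollides V t u s ∧ V s ≤ u - 7 / 10 * γ := by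
  have h_two := (two_le_lateTime h.L_pos.le h.c_pos.le).trans ht
  have hs₁ := h.s₀_le_one
  have hu_mem := h.velocity_mem ht hu
  obtain ⟨s, hs, h_hit, h_after⟩ := h.exists_hit ht (w := Vinf - u)
    ((div_lt_iff₀ (by linarith)).1 (lt_sub_comm.1 hu.2))
    ((lt_div_iff₀ (by linarith)).1 (sub_lt_comm.1 hu.1))
  have hst : s < t := by linarith [hs.2]
  have h_gap : V s ≤ u - 7 / 10 * γ := by
    linarith [h.initial s ⟨hs.1.le, hs.2.le⟩, hu_mem.1]
  exact ⟨s, {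
    pos := hs.1
    lt := hst
    position_sub := by
      linear_combination position_sub_eq_sub_integral hV Vinf hs.1.le (hs.1.trans hst).le + h_hit
    ne := ne_of_gt (by linarith [h.γ_pos])
    alongside := h.alongside_after_hit hV hγL hs.1.le hu_mem.2 h_hit h_after
    alongside_before := h.alongside_before_hit hV hγh hs hu_mem }, h_gap⟩

end LayerBounds

theorem Model.GoodTime.le_force_sub_of_layerBounds {f : ℝ → Vect d → Vect d → ℝ}
    (hg : M.GoodTime V f t) (hd : 2 ≤ d) (hρ : 0 ≤ M.ρ) (hβ : 0 < M.β)
    (hV : ContinuousOn V (Ici 0)) (hpos : ∀ t, 0 ≤ t → 0 < V t) (hesc : M.NoEscape V)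
    (h : LayerBounds (fun τ => Vinf - V τ) γ L s₀ c) (hγV : 2 * γ ≤ Vinf) (hγL : γ * L < M.h)
    (hγh : 2 * γ < M.h) (ht : lateTime L c ≤ t) :
    M.A * s₀ * c ^ 2 * M.β * Vinf * Real.exp (-M.β * Vinf ^ 2) / 8 * (γ ^ 4 / t ^ 3) ≤
      M.force V f t - M.F₀ (V t) := by
  have hA := M.A_nonneg hρ hβ.le
  have hs₀ := h.s₀_pos
  have hc := h.c_pos
  have hγ := h.γ_pos
  obtain ⟨h_time, -, -, -⟩ := bounds_of_lateTime_le h.L_pos hc ht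
  have ht₀ : 0 < t := by linarith [h.L_pos]
  have h_length := h.le_mean_sub_mean h_time
  have h_length_pos : 0 < γ * s₀ / (2 * t) := by positivity
  have hVinf : 0 < Vinf := by linarith
  rw [← sub_sub_sub_cancel_left _ _ Vinf] at h_length
  refine le_trans ?_ (hg.le_force_sub_of_recollides ht₀ hd hρ hβ hV hpos hesc
    (a := c * γ / (2 * t)) (κ := Vinf * γ) (B := Vinf ^ 2) (by positivity) (by positivity)
    (sub_nonneg.1 (h_length_pos.le.trans h_length)) fun u hu => ?_)
  · refine le_trans (le_of_eq ?_) (mul_le_mul_of_nonneg_left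
      (mul_le_mul_of_nonneg_right h_length (by positivity)) hA)
    field_simp
    ring
  have hu_mem := h.velocity_mem ht hu
  obtain ⟨s, hrec, h_gap⟩ := h.exists_recollides hV hγL hγh ht hu
  refine ⟨h.div_le_velocity_sub ht hu.2, pow_le_pow_left₀ (by linarith [hu_mem.1]) hu_mem.2 2,
    s, hrec, ?_⟩
  have hVs : Vinf / 2 ≤ V s := by linarith [h.le hrec.pos.le]
  calc Vinf * γ ≤ 4 * (Vinf / 2) * (7 / 10 * γ) := by
        have : 0 ≤ Vinf * γ := by positivity
        linarith
    _ ≤ 4 * V s * (u - V s) :=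
        mul_le_mul (by linarith) (by linarith) (by positivity) (by linarith)
    _ = u ^ 2 - (2 * V s - u) ^ 2 := by ring

end LateRecollision

/-! ### The algebraic tail -/

section Tail

/-- The lower barrier for the deviation from the limiting velocity: the exponential plus a multiple
of a function that vanishes at `T` and is of order `t⁻³` at infinity. -/
def barrier (γ C a T t : ℝ) : ℝ := γ * Real.exp (-C * t) + a * ((t - T) / t ^ 4)

variable {γ C a T t : ℝ}

theorem barrier_self (γ C a T : ℝ) : barrier γ C a T T = γ * Real.exp (-C * T) := by
  rw [barrier, sub_self, zero_div, mul_zero, add_zero]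

theorem barrier_nonneg (hγ : 0 ≤ γ) (ha : 0 ≤ a) (ht : T ≤ t) : 0 ≤ barrier γ C a T t :=
  add_nonneg (by positivity)
    (mul_nonneg ha (div_nonneg (sub_nonneg.2 ht) (Even.pow_nonneg (by decide) t)))

theorem le_barrier (ha : 0 ≤ a) (ht₀ : 0 < t) (ht : 2 * T ≤ t) :
    γ * Real.exp (-C * t) + a / 2 / t ^ 3 ≤ barrier γ C a T t := by
  unfold barrier
  gcongr
  calc a / 2 / t ^ 3 = a * (t / 2 / t ^ 4) := by field_simp
    _ ≤ a * ((t - T) / t ^ 4) := by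
        gcongr
        linarith

theorem hasDerivAt_barrier (γ C a T : ℝ) (ht : t ≠ 0) :
    HasDerivAt (barrier γ C a T)
      (-C * (γ * Real.exp (-C * t)) + a * (1 / t ^ 4 - 4 * (t - T) / t ^ 5)) t := by
  have h_exp := ((hasDerivAt_id t).const_mul (-C)).exp.const_mul γ
  have h_tail := (((hasDerivAt_id t).sub_const T).fun_div (hasDerivAt_pow 4 t)
    (pow_ne_zero 4 ht)).const_mul a
  refine (h_exp.fun_add h_tail).congr_deriv ?_
  simp only [id_eq]
  field_simp
  push_cast
  ring

theorem barrier_deriv_add_le (ha : 0 ≤ a) (hC : 0 ≤ C) (hT : 1 ≤ T) (ht : T ≤ t) :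
    -C * (γ * Real.exp (-C * t)) + a * (1 / t ^ 4 - 4 * (t - T) / t ^ 5)
      + C * barrier γ C a T t ≤ (1 + C) * a / t ^ 3 := by
  have ht₁ : 1 ≤ t := hT.trans ht
  have _ht₀ : 0 < t := by linarith
  have h_tail : (t - T) / t ^ 4 ≤ 1 / t ^ 3 := by
    calc (t - T) / t ^ 4 ≤ t / t ^ 4 := by gcongr; linarith
      _ = 1 / t ^ 3 := by field_simp
  have h_deriv : 1 / t ^ 4 - 4 * (t - T) / t ^ 5 ≤ 1 / t ^ 3 := by
    calc 1 / t ^ 4 - 4 * (t - T) / t ^ 5 ≤ 1 / t ^ 4 :=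
          sub_le_self _ (div_nonneg (by linarith) (by positivity))
      _ ≤ 1 / t ^ 3 := by
          gcongr
          norm_num
  calc _ = a * (1 / t ^ 4 - 4 * (t - T) / t ^ 5) + C * (a * ((t - T) / t ^ 4)) := by
        unfold barrier
        ring
    _ ≤ a * (1 / t ^ 3) + C * (a * (1 / t ^ 3)) := by gcongr
    _ = (1 + C) * a / t ^ 3 := by ring

variable {M : Model d} {V : ℝ → ℝ} {f : ℝ → Vect d → Vect d → ℝ} {V₀ Vinf κ : ℝ}

theorem Model.IsSolution.mul_exp_add_le_sub (hs : M.IsSolution V₀ V f) (hd : 2 ≤ d)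
    (hR : 0 < M.R) (hρ : 0 < M.ρ) (hβ : 0 < M.β) (hE : M.F₀ Vinf = M.E)
    (hpos : ∀ t, 0 ≤ t → 0 < V t) (hγ : 0 ≤ γ)
    (hexp : ∀ t, 0 ≤ t → γ * Real.exp (-deriv M.F₀ Vinf * t) ≤ Vinf - V t) (hκ : 0 ≤ κ)
    (hT : 1 ≤ T)
    (hforce : ∀ t, T ≤ t → M.GoodTime V f t → κ / t ^ 3 ≤ M.force V f t - M.F₀ (V t))
    (ht : 2 * T ≤ t) :
    γ * Real.exp (-deriv M.F₀ Vinf * t) + κ / (1 + deriv M.F₀ Vinf) / 2 / t ^ 3 ≤ Vinf - V t := by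
  have hA := M.A_pos hR hρ hβ
  set C := deriv M.F₀ Vinf
  have hC : 0 < C := M.deriv_F₀_pos hA hβ Vinf
  have hT₀ : 0 < T := by linarith
  have ha : 0 ≤ κ / (1 + C) := by positivity
  have h_ne : ∀ τ ∈ Icc T t, τ ≠ 0 := fun τ hτ => (hT₀.trans_le hτ.1).ne'
  refine (le_barrier ha (by linarith) ht).trans ?_
  refine hs.le_sub_of_subsolution hA hβ hE (fun τ hτ => (hpos τ hτ).le) hT₀.le (by linarith)
    (fun τ hτ => hasDerivAt_barrier γ C _ T (h_ne τ hτ)) ?_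
    (fun τ hτ => barrier_nonneg hγ ha hτ.1) ((barrier_self γ C _ T).trans_le (hexp T hT₀.le)) ?_
  · have h_ne₄ : ∀ τ ∈ Icc T t, τ ^ 4 ≠ 0 := fun τ hτ => pow_ne_zero 4 (h_ne τ hτ)
    have h_ne₅ : ∀ τ ∈ Icc T t, τ ^ 5 ≠ 0 := fun τ hτ => pow_ne_zero 5 (h_ne τ hτ)
    fun_prop (disch := assumption)
  filter_upwards [hs.ae_goodTime hd hR.ne' hs.continuousOn] with τ hg hτ
  calc _ ≤ (1 + C) * (κ / (1 + C)) / τ ^ 3 := barrier_deriv_add_le ha hC.le hT hτ.1.le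
    _ = κ / τ ^ 3 := by rw [mul_div_cancel₀ _ (by positivity)]
    _ ≤ M.force V f τ - M.F₀ (V τ) := hforce τ hτ.1.le (hg (hT₀.trans hτ.1))

end Tail

/-! ### Small initial deviations -/

section SmallDeviation

variable {M : Model d} {Vinf γ : ℝ}

/-- The length `L` in the decay profile `γ L² / (L + t)²` of the deviation. -/
def Model.decayTime (M : Model d) : ℝ := 4 / deriv M.F₀ 0

/-- The length of the initial layer, in which the deviation loses at most a fifth of its size. -/
def Model.layerWidth (M : Model d) (Vinf : ℝ) : ℝ := min 1 (1 / (5 * deriv M.F₀ Vinf))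

/-- The fraction of the initial deviation that is certainly left at time `2`. -/
def Model.remainingFraction (M : Model d) (Vinf : ℝ) : ℝ := Real.exp (-deriv M.F₀ Vinf * 2)

/-- The coefficient of `γ⁴ / t³` in the lower bound for the friction due to recollisions. -/
def Model.recollisionRate (M : Model d) (Vinf : ℝ) : ℝ :=
  M.A * M.layerWidth Vinf * M.remainingFraction Vinf ^ 2 * M.β * Vinf *
    Real.exp (-M.β * Vinf ^ 2) / 8

/-- The smallness of the initial deviation `γ` that keeps the particles alongside the body and the
effect of the recollisions perturbative. -/
structure Model.SmallDeviation (M : Model d) (Vinf γ : ℝ) : Prop where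
  pos : 0 < γ
  two_mul_le : 2 * γ ≤ Vinf
  lt_height : 2 * (γ * (M.decayTime + 1)) < M.h
  sq_le : 512 * M.A * γ ^ 2 ≤ deriv M.F₀ 0

theorem Model.decayTime_pos (hA : 0 < M.A) (hβ : 0 < M.β) : 0 < M.decayTime :=
  div_pos four_pos (M.deriv_F₀_pos hA hβ 0)

theorem Model.layerWidth_pos (hA : 0 < M.A) (hβ : 0 < M.β) (Vinf : ℝ) : 0 < M.layerWidth Vinf := by
  have := M.deriv_F₀_pos hA hβ Vinf
  exact lt_min one_pos (by positivity)

theorem Model.remainingFraction_pos (M : Model d) (Vinf : ℝ) : 0 < M.remainingFraction Vinf :=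
  Real.exp_pos _

theorem Model.recollisionRate_pos (hA : 0 < M.A) (hβ : 0 < M.β) (hVinf : 0 < Vinf) :
    0 < M.recollisionRate Vinf := by
  have := M.layerWidth_pos hA hβ Vinf
  have := M.remainingFraction_pos Vinf
  unfold recollisionRate
  positivity

theorem Model.exists_smallDeviation (hA : 0 < M.A) (hβ : 0 < M.β) (hh : 0 < M.h)
    (hVinf : 0 < Vinf) : ∃ γ₀ > 0, ∀ γ ∈ Ioo 0 γ₀, M.SmallDeviation Vinf γ := by
  have hF := M.deriv_F₀_pos hA hβ 0
  have hL := M.decayTime_pos hA hβ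
  refine ⟨min (min (Vinf / 2) (M.h / (2 * (M.decayTime + 1)))) √(deriv M.F₀ 0 / (512 * M.A)),
    by positivity, fun γ ⟨hγ, hγ₀⟩ => ?_⟩
  obtain ⟨⟨h_velocity, h_height⟩, h_sq⟩ := by simpa only [lt_min_iff] using hγ₀
  rw [Real.lt_sqrt hγ.le, lt_div_iff₀ (by positivity)] at h_sq
  rw [lt_div_iff₀ (by positivity)] at h_height
  exact ⟨hγ, by linarith, by linarith, by linarith⟩

variable {V : ℝ → ℝ} {f : ℝ → Vect d → Vect d → ℝ} {t : ℝ}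

theorem Model.SmallDeviation.abs_sub_le_decay (hγ : M.SmallDeviation Vinf γ)
    (hs : M.IsSolution (Vinf - γ) V f) (hd : 2 ≤ d) (hR : 0 < M.R) (hρ : 0 < M.ρ) (hβ : 0 < M.β)
    (hE : M.F₀ Vinf = M.E) (ht : 0 ≤ t) : |Vinf - V t| ≤ decay γ M.decayTime t := by
  have hA := M.A_pos hR hρ hβ
  exact hs.abs_sub_le_decay hd hR hρ hβ hE hγ.pos (M.decayTime_pos hA hβ)
    (mul_div_cancel₀ 4 (M.deriv_F₀_pos hA hβ 0).ne').ge hγ.sq_le ht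

theorem Model.SmallDeviation.velocity_pos (hγ : M.SmallDeviation Vinf γ)
    (hs : M.IsSolution (Vinf - γ) V f) (hd : 2 ≤ d) (hR : 0 < M.R) (hρ : 0 < M.ρ) (hβ : 0 < M.β)
    (hE : M.F₀ Vinf = M.E) (ht : 0 ≤ t) : 0 < V t := by
  have h_decay := hγ.abs_sub_le_decay hs hd hR hρ hβ hE ht
  have h_le := decay_le hγ.pos.le (M.decayTime_pos (M.A_pos hR hρ hβ) hβ) ht
  linarith [(abs_le.1 h_decay).2, hγ.two_mul_le, hγ.pos]

theorem Model.SmallDeviation.noEscape (hγ : M.SmallDeviation Vinf γ)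
    (hs : M.IsSolution (Vinf - γ) V f) (hd : 2 ≤ d) (hR : 0 < M.R) (hρ : 0 < M.ρ) (hβ : 0 < M.β)
    (hE : M.F₀ Vinf = M.E) : M.NoEscape V :=
  M.noEscape_of_decay hs.continuousOn hγ.pos.le (M.decayTime_pos (M.A_pos hR hρ hβ) hβ)
    (by linarith [hγ.lt_height, hγ.pos]) fun _ => hγ.abs_sub_le_decay hs hd hR hρ hβ hE

theorem Model.SmallDeviation.mul_exp_le_sub (hγ : M.SmallDeviation Vinf γ)
    (hs : M.IsSolution (Vinf - γ) V f) (hd : 2 ≤ d) (hR : 0 < M.R) (hρ : 0 < M.ρ) (hβ : 0 < M.β)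
    (hE : M.F₀ Vinf = M.E) (ht : 0 ≤ t) :
    γ * Real.exp (-deriv M.F₀ Vinf * t) ≤ Vinf - V t :=
  hs.mul_exp_le_sub hd hR hρ hβ hE hγ.pos.le (fun _ => hγ.velocity_pos hs hd hR hρ hβ hE)
    (hγ.noEscape hs hd hR hρ hβ hE) ht

theorem Model.SmallDeviation.layerBounds (hγ : M.SmallDeviation Vinf γ)
    (hs : M.IsSolution (Vinf - γ) V f) (hd : 2 ≤ d) (hR : 0 < M.R) (hρ : 0 < M.ρ) (hβ : 0 < M.β)
    (hE : M.F₀ Vinf = M.E) :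
    LayerBounds (fun t => Vinf - V t) γ M.decayTime (M.layerWidth Vinf)
      (M.remainingFraction Vinf) := by
  have hA := M.A_pos hR hρ hβ
  have hC := M.deriv_F₀_pos hA hβ Vinf
  have h_exp (t : ℝ) (ht : 0 ≤ t) := hγ.mul_exp_le_sub hs hd hR hρ hβ hE ht
  exact {
    continuousOn := continuousOn_const.sub hs.continuousOn
    γ_pos := hγ.pos
    L_pos := M.decayTime_pos hA hβ
    s₀_pos := M.layerWidth_pos hA hβ Vinf
    s₀_le_one := min_le_left _ _
    c_pos := M.remainingFraction_pos Vinf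
    nonneg := fun t ht => (mul_nonneg hγ.pos.le (Real.exp_pos _).le).trans (h_exp t ht)
    le_decay := fun t ht =>
      (le_abs_self _).trans (hγ.abs_sub_le_decay hs hd hR hρ hβ hE ht)
    initial := fun t ht => by
      have h_layer := ht.2.trans (min_le_right _ _)
      rw [le_div_iff₀ (by positivity)] at h_layer
      refine le_trans ?_ (h_exp t ht.1)
      rw [mul_comm]
      exact mul_le_mul_of_nonneg_left
        (by linarith [Real.add_one_le_exp (-deriv M.F₀ Vinf * t)]) hγ.pos.le
    lower := fun t ht => by
      refine le_trans ?_ (h_exp t ht.1)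
      rw [mul_comm]
      refine mul_le_mul_of_nonneg_left (Real.exp_le_exp.2 ?_) hγ.pos.le
      exact mul_le_mul_of_nonpos_left ht.2 (neg_nonpos.2 hC.le) }

theorem Model.SmallDeviation.le_force_sub (hγ : M.SmallDeviation Vinf γ)
    (hs : M.IsSolution (Vinf - γ) V f) (hd : 2 ≤ d) (hR : 0 < M.R) (hρ : 0 < M.ρ) (hβ : 0 < M.β)
    (hE : M.F₀ Vinf = M.E) (hg : M.GoodTime V f t)
    (ht : lateTime M.decayTime (M.remainingFraction Vinf) ≤ t) :
    M.recollisionRate Vinf * γ ^ 4 / t ^ 3 ≤ M.force V f t - M.F₀ (V t) := by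
  have hγ_pos := hγ.pos
  have hL := M.decayTime_pos (M.A_pos hR hρ hβ) hβ
  have hγL : 0 < γ * M.decayTime := by positivity
  rw [mul_div_assoc]
  exact hg.le_force_sub_of_layerBounds hd hρ.le hβ hs.continuousOn
    (fun _ => hγ.velocity_pos hs hd hR hρ hβ hE) (hγ.noEscape hs hd hR hρ hβ hE)
    (hγ.layerBounds hs hd hR hρ hβ hE) hγ.two_mul_le
    (by linarith [hγ.lt_height]) (by linarith [hγ.lt_height]) ht

theorem Model.SmallDeviation.mul_exp_add_le_sub (hγ : M.SmallDeviation Vinf γ)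
    (hs : M.IsSolution (Vinf - γ) V f) (hd : 2 ≤ d) (hR : 0 < M.R) (hρ : 0 < M.ρ) (hβ : 0 < M.β)
    (hE : M.F₀ Vinf = M.E) (ht : 2 * lateTime M.decayTime (M.remainingFraction Vinf) ≤ t) :
    γ * Real.exp (-deriv M.F₀ Vinf * t) +
      M.recollisionRate Vinf / (1 + deriv M.F₀ Vinf) / 2 * γ ^ 4 / t ^ 3 ≤ Vinf - V t := by
  have hA := M.A_pos hR hρ hβ
  have hγ_pos := hγ.pos
  have h_rate := M.recollisionRate_pos hA hβ (show 0 < Vinf by linarith [hγ.two_mul_le])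
  have h_late := two_le_lateTime (M.decayTime_pos hA hβ).le (M.remainingFraction_pos Vinf).le
  convert hs.mul_exp_add_le_sub hd hR hρ hβ hE (fun _ => hγ.velocity_pos hs hd hR hρ hβ hE)
    hγ_pos.le (fun _ => hγ.mul_exp_le_sub hs hd hR hρ hβ hE) (mul_pos h_rate (pow_pos hγ_pos 4)).le
    (one_le_two.trans h_late) (fun _ ht hg => hγ.le_force_sub hs hd hR hρ hβ hE hg ht) ht using 2
  ring

end SmallDeviation

end HollowCylinder

end

theorem theorem3p2_general (d : ℕ) (hd : 2 ≤ d) (M : HollowCylinder.Model d)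
    (hR : 0 < M.R) (hh : 0 < M.h) (hρ : 0 < M.ρ) (hβ : 0 < M.β)
    (Vinf : ℝ) (hVinf : 0 < Vinf) (hE : M.F₀ Vinf = M.E) :
    ∃ γ₀ : ℝ, 0 < γ₀ ∧ ∃ Aminus : ℝ, 0 < Aminus ∧ ∃ tbar : ℝ, 0 < tbar ∧
      ∀ γ ∈ Set.Ioo 0 γ₀,
        ∀ (V : ℝ → ℝ) (f : ℝ → HollowCylinder.Vect d → HollowCylinder.Vect d → ℝ),
          M.IsSolution (Vinf - γ) V f →
            ∀ t : ℝ, 0 ≤ t →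
              γ * Real.exp (-(deriv M.F₀ Vinf) * t) +
                  Set.indicator (Set.Ioi tbar) (fun s => Aminus * γ ^ 4 / s ^ 3) t ≤
                Vinf - V t := by
  have hA := M.A_pos hR hρ hβ
  have h_rate := M.recollisionRate_pos hA hβ hVinf
  have h_slope := M.deriv_F₀_pos hA hβ Vinf
  have h_late := HollowCylinder.two_le_lateTime (M.decayTime_pos hA hβ).le
    (M.remainingFraction_pos Vinf).le
  obtain ⟨γ₀, hγ₀, h_small⟩ := M.exists_smallDeviation hA hβ hh hVinf
  refine ⟨γ₀, hγ₀, M.recollisionRate Vinf / (1 + deriv M.F₀ Vinf) / 2, by positivity,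
    2 * HollowCylinder.lateTime M.decayTime (M.remainingFraction Vinf), by linarith,
    fun γ hγ V f hs t ht => ?_⟩
  by_cases h_tail : t ∈ Set.Ioi (2 * HollowCylinder.lateTime M.decayTime (M.remainingFraction Vinf))
  · rw [Set.indicator_of_mem h_tail]
    exact (h_small γ hγ).mul_exp_add_le_sub hs hd hR hρ hβ hE (le_of_lt h_tail)
  · rw [Set.indicator_of_notMem h_tail, add_zero]
    exact (h_small γ hγ).mul_exp_le_sub hs hd hR hρ hβ hE ht

theorem theorem3p2 (d : ℕ) (hd : d = 2 ∨ d = 3) (M : HollowCylinder.Model d)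
    (hR : 0 < M.R) (hh : 0 < M.h) (hρ : 0 < M.ρ) (hβ : 0 < M.β)
    (Vinf : ℝ) (hVinf : 0 < Vinf) (hE : M.F₀ Vinf = M.E) :
    ∃ γ₀ : ℝ, 0 < γ₀ ∧ ∃ Aminus : ℝ, 0 < Aminus ∧
      ∀ γ ∈ Set.Ioo 0 γ₀, ∃ tbar : ℝ, 0 < tbar ∧
        ∀ (V : ℝ → ℝ) (f : ℝ → HollowCylinder.Vect d → HollowCylinder.Vect d → ℝ),
          M.IsSolution (Vinf - γ) V f →
            ∀ t : ℝ, 0 ≤ t →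
              γ * Real.exp (-(deriv M.F₀ Vinf) * t) +
                  Set.indicator (Set.Ioi tbar) (fun s => Aminus * γ ^ 4 / s ^ 3) t ≤
                Vinf - V t := by
  obtain ⟨γ₀, hγ₀, Aminus, hAminus, tbar, htbar, h⟩ :=
    theorem3p2_general d (by lia) M hR hh hρ hβ Vinf hVinf hE
  exact ⟨γ₀, hγ₀, Aminus, hAminus, fun γ hγ => ⟨tbar, htbar, h γ hγ⟩⟩
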